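/- Throughout, a fusion category is a semisimple abelian rigid $\mathbb{C}$-linear monoidal category with finite-dimensional spaces of morphisms, finitely many isomorphism classes of simple objects and $\mathrm{End}(\mathbf 1)=\mathbb{C}$; it is pointed if every simple object is invertible. Its global dimension is the sum of the squared dimensions of its simple objects, one for each isomorphism class. A tensor equivalence is a $\mathbb{C}$-linear monoidal equivalence. For a finite group $H$ and a 3-cocycle $\eta\in Z^3(H,\mathbb{C}^*)$ (trivial action), $Vect(H,\eta)$ is the category of finite-dimensional $H$-graded complex vector spaces with associativity constraint $(x\otimes y)\otimes z\mapsto \eta(a,b,c)\,x\otimes(y\otimes z)$ on homogeneous vectors $x,y,z$ of degrees $a,b,c$. **Theorem.** Up to tensor equivalence there are exactly 47 pointed fusion categories of global dimension 8. More precisely: 1. Every pointed fusion category of global dimension 8 is tensor equivalent to $Vect(H,\eta)$ for some 3-cocycle $\eta$ on one of the five groups $H=(\mathbb{Z}/2)^3,\ \mathbb{Z}/4\times\mathbb{Z}/2,\ \mathbb{Z}/8,\ D_8,\ Q_8$ ($D_8$ and $Q_8$ are the dihedral and the quaternion group of order 8). Conversely, for every group $H$ of order 8 and every $\eta\in Z^3(H,\mathbb{C}^*)$,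 $Vect(H,\eta)$ is a pointed fusion category of global dimension 8. For groups $H,H'$ of order 8, $Vect(H,\eta)$ and $Vect(H',\eta')$ are tensor equivalent if and only if there is an isomorphism $\varphi:H\to H'$ with $\varphi^*[\eta']=[\eta]$ in $H^3(H,\mathbb{C}^*)$; and every class in $H^3(H,\mathbb{C}^*)$ is the class of some 3-cocycle $\eta$. 2. For every finite group $H$ there is an isomorphism $H^3(H,\mathbb{C}^*)\cong H^4(H,\mathbb{Z})$ that is compatible with the action of $\mathrm{Aut}(H)$. The orbit space $H^3(H,\mathbb{C}^*)/\mathrm{Aut}(H)$ has 10 elements for $(\mathbb{Z}/2)^3$, 9 for $\mathbb{Z}/4\times\mathbb{Z}/2$, 8 for $\mathbb{Z}/8$, 12 for $D_8$ and 8 for $Q_8$. 3. The orbits are the following. * $(\mathbb{Z}/2)^3$: there is an isomorphism of $H^3((\mathbb{Z}/2)^3,\mathbb{C}^*)$ with the kernel of $Sq^1$ on the homogeneous polynomials of degree 4 in $\mathbb{F}_2[x,y,z]$, where $Sq^1$ is the derivation with $x\mapsto x^2$, $y\mapsto y^2$, $z\mapsto z^2$, compatible with the action of $\mathrm{Aut}((\mathbb{Z}/2)^3)=GL(3,\mathbb{F}_2)$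 by linear substitutions ($x,y,z$ being the coordinate functions on $(\mathbb{Z}/2)^3$). With $m=x^2yz+xy^2z+xyz^2$, the 10 orbits are those of $0$, $x^4$, $x^2y^2$, $x^4+y^2z^2$, $x^4+y^4+x^2y^2$, $x^4+m$, $x^4+m+y^2z^2$, $m+x^2y^2+x^2z^2+y^2z^2$, $m$, $x^4+y^4+z^4+m+x^2y^2+x^2z^2+y^2z^2$; each element of the kernel lies in the orbit of exactly one of them. * $\mathbb{Z}/4\times\mathbb{Z}/2$: there is an isomorphism $H^3\cong\mathbb{Z}/4\langle u^2\rangle\oplus\mathbb{Z}/2\langle uv\rangle\oplus\mathbb{Z}/2\langle v^2\rangle$ (here $u^2$, $uv$, $v^2$ are just names of generators) under which the orbits are $\{u^2,u^2+v^2\}$, $\{v^2\}$, $\{uv,\,2u^2+uv+v^2,\,2u^2+uv,\,uv+v^2\}$, $\{u^2+uv,3u^2+uv\}$, $\{3u^2,3u^2+v^2\}$, $\{u^2+uv+v^2,3u^2+uv+v^2\}$, $\{2u^2\}$, $\{2u^2+v^2\}$, $\{0\}$. * $\mathbb{Z}/8$: $H^3\cong\mathbb{Z}/8$, and every orbit has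 one element. * $D_8$: there is an isomorphism $H^3\cong\mathbb{Z}/4\langle\gamma\rangle\oplus\mathbb{Z}/2\langle\alpha\rangle\oplus\mathbb{Z}/2\langle\beta\rangle$ under which the orbits are $\{0\}$, $\{\gamma\}$, $\{2\gamma\}$, $\{3\gamma\}$, $\{\alpha\}$, $\{\beta,\alpha+\beta\}$, $\{\gamma+\beta,\gamma+\alpha+\beta\}$, $\{2\gamma+\beta,2\gamma+\alpha+\beta\}$, $\{3\gamma+\beta,3\gamma+\alpha+\beta\}$, $\{\gamma+\alpha\}$, $\{2\gamma+\alpha\}$, $\{3\gamma+\alpha\}$. * $Q_8$: $H^3\cong\mathbb{Z}/8$, and every orbit has one element. -/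

import Mathlib

open CategoryTheory CategoryTheory.Limits MonoidalCategory
open scoped TensorProduct

universe v u v' u'

set_option linter.unusedSectionVars false
set_option linter.checkUnivs false

noncomputable section

namespace PointedFusion

/-! ## Cohomology of groups with trivial coefficients, and orbits of automorphisms -/

/-- `Hⁿ(G, A)` for an abelian group `A` with trivial `G`-action. -/
abbrev Coh (G : Type) [Group G] (A : Type) [AddCommGroup A] (n : ℕ) : Type :=
  groupCohomology (Rep.trivial ℤ G A) n

/-- `f^* : Hⁿ(H, A) → Hⁿ(G, A)`, induced by precomposing cochains with `f : G → H`. -/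
def cohPullback {G H : Type} [Group G] [Group H] (A : Type) [AddCommGroup A] (n : ℕ) (f : G →* H) :
    Coh H A n →+ Coh G A n :=
  (groupCohomology.map (A := Rep.trivial ℤ H A) (B := Rep.trivial ℤ G A) f
    (Rep.ofHom ⟨LinearMap.id, fun _ => rfl⟩) n).hom.toAddMonoidHom

theorem cohPullback_id {G : Type} [Group G] (A : Type) [AddCommGroup A] (n : ℕ) (c : Coh G A n) :
    cohPullback A n (MonoidHom.id G) c = c := by
  have h := groupCohomology.map_id (B := Rep.trivial ℤ G A) n
  exact congrArg (fun m => m.hom c) h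

theorem cohPullback_comp {G H K : Type} [Group G] [Group H] [Group K] (A : Type) [AddCommGroup A]
    (n : ℕ) (f : H →* K) (g : G →* H) (c : Coh K A n) :
    cohPullback A n (f.comp g) c = cohPullback A n g (cohPullback A n f c) := by
  have h := groupCohomology.map_comp (A := Rep.trivial ℤ K A) (B := Rep.trivial ℤ H A)
    (C := Rep.trivial ℤ G A) f g (Rep.ofHom ⟨LinearMap.id, fun _ => rfl⟩)
    (Rep.ofHom ⟨LinearMap.id, fun _ => rfl⟩) n
  exact congrArg (fun m => m.hom c) h

/-- Two classes in `Hⁿ(G, A)` are in the same orbit of `Aut(G)`. -/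
def SameOrbit {G : Type} [Group G] {A : Type} [AddCommGroup A] {n : ℕ} (c d : Coh G A n) : Prop :=
  ∃ φ : G ≃* G, cohPullback A n φ.toMonoidHom d = c

/-- The orbit equivalence relation of `Aut(G)` on `Hⁿ(G, A)`. -/
def orbitSetoid (G : Type) [Group G] (A : Type) [AddCommGroup A] (n : ℕ) :
    Setoid (Coh G A n) where
  r := SameOrbit
  iseqv :=
    { refl := fun c => ⟨MulEquiv.refl G, cohPullback_id A n c⟩
      symm := by
        rintro c d ⟨φ, rfl⟩
        refine ⟨φ.symm, ?_⟩
        rw [← cohPullback_comp]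
        convert cohPullback_id A n d
        ext x
        simp
      trans := by
        rintro c d e ⟨φ, rfl⟩ ⟨ψ, rfl⟩
        exact ⟨φ.trans ψ, cohPullback_comp A n ψ.toMonoidHom φ.toMonoidHom e⟩ }

/-- The orbit space `Hⁿ(G, A) / Aut(G)`. -/
abbrev OrbitSpace (G : Type) [Group G] (A : Type) [AddCommGroup A] (n : ℕ) : Type :=
  Quotient (orbitSetoid G A n)

/-- `H³(G, ℂ^*)`. -/
abbrev H3 (G : Type) [Group G] : Type := Coh G (Additive ℂˣ) 3

/-- `H⁴(G, ℤ)`. -/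
abbrev H4 (G : Type) [Group G] : Type := Coh G ℤ 4

/-- The group `Z³(G, ℂ^*)` of 3-cocycles, as a type of functions of three variables. -/
structure Cocycle3 (G : Type) [Group G] where
  toFun : G → G → G → ℂˣ
  cocycle : ∀ a b c d : G,
    toFun b c d * toFun a (b * c) d * toFun a b c = toFun (a * b) c d * toFun a b (c * d)

instance (G : Type) [Group G] : CoeFun (Cocycle3 G) (fun _ => G → G → G → ℂˣ) :=
  ⟨Cocycle3.toFun⟩

theorem Cocycle3.d_eq_zero {G : Type} [Group G] (η : Cocycle3 G) :
    inhomogeneousCochains.d (Rep.trivial ℤ G (Additive ℂˣ)) 3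
      (fun g => Additive.ofMul (η (g 0) (g 1) (g 2))) = 0 := by
  refine funext fun g => ?_
  have h := congrArg Additive.ofMul (η.cocycle (g 0) (g 1) (g 2) (g 3))
  simp only [ofMul_mul] at h
  change Additive.ofMul (η (g 1) (g 2) (g 3)) + ∑ j : Fin 4, (-1 : ℤ) ^ ((j : ℕ) + 1) •
    Additive.ofMul (η (Fin.contractNth j (· * ·) g 0) (Fin.contractNth j (· * ·) g 1)
      (Fin.contractNth j (· * ·) g 2)) = 0
  rw [Fin.sum_univ_four]
  change Additive.ofMul (η (g 1) (g 2) (g 3)) +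
    ((-1 : ℤ) ^ 1 • Additive.ofMul (η (g 0 * g 1) (g 2) (g 3)) +
      (-1 : ℤ) ^ 2 • Additive.ofMul (η (g 0) (g 1 * g 2) (g 3)) +
      (-1 : ℤ) ^ 3 • Additive.ofMul (η (g 0) (g 1) (g 2 * g 3)) +
      (-1 : ℤ) ^ 4 • Additive.ofMul (η (g 0) (g 1) (g 2))) = 0
  generalize Additive.ofMul (η (g 1) (g 2) (g 3)) = p1 at *
  generalize Additive.ofMul (η (g 0 * g 1) (g 2) (g 3)) = p2 at *
  generalize Additive.ofMul (η (g 0) (g 1 * g 2) (g 3)) = p3 at *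
  generalize Additive.ofMul (η (g 0) (g 1) (g 2 * g 3)) = p4 at *
  generalize Additive.ofMul (η (g 0) (g 1) (g 2)) = p5 at *
  have h' : p1 + p3 + p5 - (p2 + p4) = 0 := sub_eq_zero.2 h
  rw [← h']
  norm_num
  abel

/-- The class `[η] ∈ H³(G, ℂ^*)` of a 3-cocycle. -/
def Cocycle3.cls {G : Type} [Group G] (η : Cocycle3 G) : H3 G :=
  groupCohomology.π (Rep.trivial ℤ G (Additive ℂˣ)) 3
    (groupCohomology.cocyclesMk (fun g => Additive.ofMul (η (g 0) (g 1) (g 2))) η.d_eq_zero)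

/-! ## Graded vector spaces -/

/-- An `H`-grading `V = ⨁ V_h` of a complex vector space, given by the projections
`proj h : V → V` onto the homogeneous components. -/
structure Grading (H : Type) [Fintype H] (V : Type) [AddCommGroup V] [Module ℂ V] where
  proj : H → V →ₗ[ℂ] V
  proj_self : ∀ h x, proj h (proj h x) = proj h x
  proj_ne : ∀ g h x, g ≠ h → proj g (proj h x) = 0
  sum_proj : ∀ x, ∑ h, proj h x = x

namespace Grading

section

variable {H : Type} [Fintype H]
variable {V W U T : Type} [AddCommGroup V] [Module ℂ V] [AddCommGroup W] [Module ℂ W]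
  [AddCommGroup U] [Module ℂ U] [AddCommGroup T] [Module ℂ T]

/-- Degree-preserving linear maps. -/
def IsHom (P : Grading H V) (Q : Grading H W) (f : V →ₗ[ℂ] W) : Prop :=
  ∀ h x, f (P.proj h x) = Q.proj h (f x)

theorem proj_of_homog (P : Grading H V) {a : H} {x : V} (hx : P.proj a x = x) (g : H) :
    P.proj g x = open Classical in if g = a then x else 0 := by
  split_ifs with h
  · rw [h, hx]
  · rw [← hx, P.proj_ne g a x h]

/-- Every vector is a sum of homogeneous ones. -/
theorem homog_induction (P : Grading H V) {C : V → Prop} (h0 : C 0)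
    (hh : ∀ a x, P.proj a x = x → C x)
    (hadd : ∀ x y, C x → C y → C (x + y)) (x : V) : C x := by
  rw [← P.sum_proj x]
  exact Finset.sum_induction _ C hadd h0 (fun h _ => hh h _ (P.proj_self h x))

theorem lin_ext (P : Grading H V) {f g : V →ₗ[ℂ] W}
    (h : ∀ a x, P.proj a x = x → f x = g x) : f = g := by
  ext x
  refine P.homog_induction (C := fun x => f x = g x) ?_ h ?_ x
  · simp
  · intro x y hx hy
    simp only [map_add, hx, hy]

theorem IsHom.homog {P : Grading H V} {Q : Grading H W} {f : V →ₗ[ℂ] W} (hf : IsHom P Q f)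
    {a : H} {x : V} (hx : P.proj a x = x) : Q.proj a (f x) = f x := by
  rw [← hf, hx]

/-- A linear map is degree-preserving as soon as it preserves degrees of homogeneous vectors. -/
theorem isHom_of_homog {P : Grading H V} {Q : Grading H W} {f : V →ₗ[ℂ] W}
    (hf : ∀ a x, P.proj a x = x → Q.proj a (f x) = f x) : IsHom P Q f := by
  intro h x
  refine P.homog_induction (C := fun x => f (P.proj h x) = Q.proj h (f x)) ?_ ?_ ?_ x
  · simp
  · intro a x hx
    rw [P.proj_of_homog hx, Q.proj_of_homog (hf a x hx)]
    split_ifs <;> simp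
  · intro x y hx hy
    simp only [map_add, hx, hy]

variable [Group H]

open Classical in
/-- The unit object `ℂ`, in degree `1`. -/
def unit (H : Type) [Fintype H] [Group H] : Grading H ℂ where
  proj h := if h = 1 then LinearMap.id else 0
  proj_self h x := by split_ifs <;> simp
  proj_ne g h x hgh := by
    by_cases h1 : h = 1
    · have : g ≠ 1 := fun h' => hgh (h'.trans h1.symm)
      simp [this]
    · simp [h1]
  sum_proj x := by
    rw [Finset.sum_eq_single 1] <;> simp +contextual

theorem unit_homog (x : ℂ) : (unit H).proj 1 x = x := by
  simp [unit]

theorem unit_eq_zero {a : H} (ha : a ≠ 1) {x : ℂ} (hx : (unit H).proj a x = x) : x = 0 := by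
  rw [← hx]
  simp [unit, ha]

/-- The projections of the tensor product: `(V ⊗ W)_x = ⨁_{gh = x} V_g ⊗ W_h`. -/
def tensorProj (P : Grading H V) (Q : Grading H W) (x : H) : V ⊗[ℂ] W →ₗ[ℂ] V ⊗[ℂ] W :=
  ∑ g : H, TensorProduct.map (P.proj g) (Q.proj (g⁻¹ * x))

theorem tensorProj_tmul (P : Grading H V) (Q : Grading H W) {a b : H} {x : V} {y : W}
    (hx : P.proj a x = x) (hy : Q.proj b y = y) (g : H) :
    tensorProj P Q g (x ⊗ₜ y) = open Classical in if g = a * b then x ⊗ₜ y else 0 := by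
  simp only [tensorProj, LinearMap.sum_apply, TensorProduct.map_tmul]
  rw [Finset.sum_eq_single a]
  · rw [hx, Q.proj_of_homog hy]
    by_cases h : g = a * b
    · simp [h]
    · have : ¬ a⁻¹ * g = b := fun h' => h (by rw [← h']; group)
      simp [h, this]
  · intro c _ hc
    rw [P.proj_of_homog hx, if_neg hc, TensorProduct.zero_tmul]
  · simp

/-- Linear maps on a tensor product agree if they agree on pure tensors of homogeneous vectors. -/
theorem tensor_ext (P : Grading H V) (Q : Grading H W) {f g : V ⊗[ℂ] W →ₗ[ℂ] U}
    (h : ∀ a b x y, P.proj a x = x → Q.proj b y = y → f (x ⊗ₜ y) = g (x ⊗ₜ y)) : f = g := by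
  refine TensorProduct.ext (P.lin_ext fun a x hx => Q.lin_ext fun b y hy => ?_)
  exact h a b x y hx hy

/-- The grading of a tensor product. -/
def tensor (P : Grading H V) (Q : Grading H W) : Grading H (V ⊗[ℂ] W) where
  proj := tensorProj P Q
  proj_self h t := by
    refine LinearMap.congr_fun (f := tensorProj P Q h ∘ₗ tensorProj P Q h)
      (tensor_ext P Q fun a b x y hx hy => ?_) t
    rw [LinearMap.comp_apply, tensorProj_tmul P Q hx hy]
    split_ifs with h'
    · rw [tensorProj_tmul P Q hx hy, if_pos h']
    · simp
  proj_ne g h t hgh := by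
    refine LinearMap.congr_fun (f := tensorProj P Q g ∘ₗ tensorProj P Q h) (g := 0)
      (tensor_ext P Q fun a b x y hx hy => ?_) t
    rw [LinearMap.comp_apply, tensorProj_tmul P Q hx hy]
    split_ifs with h'
    · rw [tensorProj_tmul P Q hx hy, if_neg (by rw [← h']; exact hgh)]
      rfl
    · simp
  sum_proj t := by
    rw [← LinearMap.sum_apply]
    refine LinearMap.congr_fun (g := LinearMap.id)
      (tensor_ext P Q fun a b x y hx hy => ?_) t
    simp only [LinearMap.sum_apply, tensorProj_tmul P Q hx hy]
    rw [Finset.sum_eq_single (a * b)] <;> simp +contextual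

theorem tensor_homog (P : Grading H V) (Q : Grading H W) {a b : H} {x : V} {y : W}
    (hx : P.proj a x = x) (hy : Q.proj b y = y) :
    (tensor P Q).proj (a * b) (x ⊗ₜ y) = x ⊗ₜ y := by
  have := tensorProj_tmul P Q hx hy (a * b)
  rwa [if_pos rfl] at this

theorem isHom_tensor_of_homog {P : Grading H V} {Q : Grading H W} {R : Grading H U}
    {f : V ⊗[ℂ] W →ₗ[ℂ] U}
    (hf : ∀ a b x y, P.proj a x = x → Q.proj b y = y →
      R.proj (a * b) (f (x ⊗ₜ y)) = f (x ⊗ₜ y)) : IsHom (tensor P Q) R f := by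
  intro h t
  refine LinearMap.congr_fun (f := f ∘ₗ (tensor P Q).proj h) (g := R.proj h ∘ₗ f)
    (tensor_ext P Q fun a b x y hx hy => ?_) t
  rw [LinearMap.comp_apply, LinearMap.comp_apply,
    (tensor P Q).proj_of_homog (tensor_homog P Q hx hy), R.proj_of_homog (hf a b x y hx hy)]
  split_ifs <;> simp

theorem isHom_map {P : Grading H V} {Q : Grading H W} {P' : Grading H U} {Q' : Grading H T}
    {f : V →ₗ[ℂ] U} {g : W →ₗ[ℂ] T} (hf : IsHom P P' f) (hg : IsHom Q Q' g) :
    IsHom (tensor P Q) (tensor P' Q') (TensorProduct.map f g) :=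
  isHom_tensor_of_homog fun a b x y hx hy => by
    rw [TensorProduct.map_tmul]
    exact tensor_homog P' Q' (hf.homog hx) (hg.homog hy)

theorem tensor_ext_left (P : Grading H V) (Q : Grading H W) (R : Grading H U)
    {f g : (V ⊗[ℂ] W) ⊗[ℂ] U →ₗ[ℂ] T}
    (h : ∀ a b c x y z, P.proj a x = x → Q.proj b y = y → R.proj c z = z →
      f ((x ⊗ₜ y) ⊗ₜ z) = g ((x ⊗ₜ y) ⊗ₜ z)) : f = g := by
  refine TensorProduct.ext (tensor_ext P Q fun a b x y hx hy => R.lin_ext fun c z hz => ?_)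
  exact h a b c x y z hx hy hz

theorem tensor_ext_right (P : Grading H V) (Q : Grading H W) (R : Grading H U)
    {f g : V ⊗[ℂ] (W ⊗[ℂ] U) →ₗ[ℂ] T}
    (h : ∀ a b c x y z, P.proj a x = x → Q.proj b y = y → R.proj c z = z →
      f (x ⊗ₜ (y ⊗ₜ z)) = g (x ⊗ₜ (y ⊗ₜ z))) : f = g := by
  refine TensorProduct.ext (P.lin_ext fun a x hx => tensor_ext Q R fun b c y z hy hz => ?_)
  exact h a b c x y z hx hy hz

/-- The associator `(x ⊗ y) ⊗ z ↦ s(a, b, c) x ⊗ (y ⊗ z)` for homogeneous `x, y, z` of degrees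
`a, b, c`. -/
def assocLin (s : H → H → H → ℂˣ) (P : Grading H V) (Q : Grading H W) (R : Grading H U) :
    (V ⊗[ℂ] W) ⊗[ℂ] U →ₗ[ℂ] V ⊗[ℂ] (W ⊗[ℂ] U) :=
  (TensorProduct.assoc ℂ V W U).toLinearMap ∘ₗ
    ∑ a : H, ∑ b : H, ∑ c : H, (s a b c : ℂ) •
      TensorProduct.map (TensorProduct.map (P.proj a) (Q.proj b)) (R.proj c)

/-- The inverse of the associator. -/
def assocInvLin (s : H → H → H → ℂˣ) (P : Grading H V) (Q : Grading H W) (R : Grading H U) :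
    V ⊗[ℂ] (W ⊗[ℂ] U) →ₗ[ℂ] (V ⊗[ℂ] W) ⊗[ℂ] U :=
  (TensorProduct.assoc ℂ V W U).symm.toLinearMap ∘ₗ
    ∑ a : H, ∑ b : H, ∑ c : H, (((s a b c)⁻¹ : ℂˣ) : ℂ) •
      TensorProduct.map (P.proj a) (TensorProduct.map (Q.proj b) (R.proj c))

theorem triple_sum {H : Type} [Fintype H] {M : Type} [AddCommGroup M] (f : H → H → H → M)
    (a b c : H) (h : ∀ a' b' c', ¬ (a' = a ∧ b' = b ∧ c' = c) → f a' b' c' = 0) :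
    ∑ a' : H, ∑ b' : H, ∑ c' : H, f a' b' c' = f a b c := by
  rw [Finset.sum_eq_single a, Finset.sum_eq_single b, Finset.sum_eq_single c]
  · exact fun c' _ hc => h _ _ _ (fun h' => hc h'.2.2)
  · simp
  · exact fun b' _ hb => Finset.sum_eq_zero fun c' _ => h _ _ _ (fun h' => hb h'.2.1)
  · simp
  · exact fun a' _ ha => Finset.sum_eq_zero fun b' _ => Finset.sum_eq_zero fun c' _ =>
      h _ _ _ (fun h' => ha h'.1)
  · simp

theorem assocLin_tmul (s : H → H → H → ℂˣ) (P : Grading H V) (Q : Grading H W)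
    (R : Grading H U) {a b c : H} {x : V} {y : W} {z : U}
    (hx : P.proj a x = x) (hy : Q.proj b y = y) (hz : R.proj c z = z) :
    assocLin s P Q R ((x ⊗ₜ y) ⊗ₜ z) = (s a b c : ℂ) • (x ⊗ₜ (y ⊗ₜ z)) := by
  simp only [assocLin, LinearMap.comp_apply, LinearMap.sum_apply, LinearMap.smul_apply,
    TensorProduct.map_tmul]
  rw [triple_sum _ a b c]
  · simp [hx, hy, hz]
  · intro a' b' c' h
    rw [P.proj_of_homog hx, Q.proj_of_homog hy, R.proj_of_homog hz]
    by_cases h1 : a' = a <;> by_cases h2 : b' = b <;> by_cases h3 : c' = c <;>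
      simp_all

theorem assocInvLin_tmul (s : H → H → H → ℂˣ) (P : Grading H V) (Q : Grading H W)
    (R : Grading H U) {a b c : H} {x : V} {y : W} {z : U}
    (hx : P.proj a x = x) (hy : Q.proj b y = y) (hz : R.proj c z = z) :
    assocInvLin s P Q R (x ⊗ₜ (y ⊗ₜ z)) = (((s a b c)⁻¹ : ℂˣ) : ℂ) • ((x ⊗ₜ y) ⊗ₜ z) := by
  simp only [assocInvLin, LinearMap.comp_apply, LinearMap.sum_apply, LinearMap.smul_apply,
    TensorProduct.map_tmul]
  rw [triple_sum _ a b c]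
  · simp [hx, hy, hz]
  · intro a' b' c' h
    rw [P.proj_of_homog hx, Q.proj_of_homog hy, R.proj_of_homog hz]
    by_cases h1 : a' = a <;> by_cases h2 : b' = b <;> by_cases h3 : c' = c <;>
      simp_all

theorem isHom_assocLin (s : H → H → H → ℂˣ) (P : Grading H V) (Q : Grading H W)
    (R : Grading H U) :
    IsHom (tensor (tensor P Q) R) (tensor P (tensor Q R)) (assocLin s P Q R) := by
  intro h t
  refine LinearMap.congr_fun (f := assocLin s P Q R ∘ₗ (tensor (tensor P Q) R).proj h)
    (g := (tensor P (tensor Q R)).proj h ∘ₗ assocLin s P Q R)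
    (tensor_ext_left P Q R fun a b c x y z hx hy hz => ?_) t
  rw [LinearMap.comp_apply, LinearMap.comp_apply, assocLin_tmul s P Q R hx hy hz, map_smul,
    proj_of_homog _ (tensor_homog (tensor P Q) R (tensor_homog P Q hx hy) hz),
    proj_of_homog _ (tensor_homog P (tensor Q R) hx (tensor_homog Q R hy hz)), mul_assoc]
  split_ifs
  · exact assocLin_tmul s P Q R hx hy hz
  · simp

theorem isHom_assocInvLin (s : H → H → H → ℂˣ) (P : Grading H V) (Q : Grading H W)
    (R : Grading H U) :
    IsHom (tensor P (tensor Q R)) (tensor (tensor P Q) R) (assocInvLin s P Q R) := by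
  intro h t
  refine LinearMap.congr_fun (f := assocInvLin s P Q R ∘ₗ (tensor P (tensor Q R)).proj h)
    (g := (tensor (tensor P Q) R).proj h ∘ₗ assocInvLin s P Q R)
    (tensor_ext_right P Q R fun a b c x y z hx hy hz => ?_) t
  rw [LinearMap.comp_apply, LinearMap.comp_apply, assocInvLin_tmul s P Q R hx hy hz, map_smul,
    proj_of_homog _ (tensor_homog (tensor P Q) R (tensor_homog P Q hx hy) hz),
    proj_of_homog _ (tensor_homog P (tensor Q R) hx (tensor_homog Q R hy hz)), mul_assoc]
  split_ifs
  · exact assocInvLin_tmul s P Q R hx hy hz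
  · simp

theorem assocInvLin_comp (s : H → H → H → ℂˣ) (P : Grading H V) (Q : Grading H W)
    (R : Grading H U) : assocInvLin s P Q R ∘ₗ assocLin s P Q R = LinearMap.id := by
  refine tensor_ext_left P Q R fun a b c x y z hx hy hz => ?_
  rw [LinearMap.comp_apply, assocLin_tmul s P Q R hx hy hz, map_smul,
    assocInvLin_tmul s P Q R hx hy hz, smul_smul]
  simp

theorem assocLin_comp (s : H → H → H → ℂˣ) (P : Grading H V) (Q : Grading H W)
    (R : Grading H U) : assocLin s P Q R ∘ₗ assocInvLin s P Q R = LinearMap.id := by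
  refine tensor_ext_right P Q R fun a b c x y z hx hy hz => ?_
  rw [LinearMap.comp_apply, assocInvLin_tmul s P Q R hx hy hz, map_smul,
    assocLin_tmul s P Q R hx hy hz, smul_smul]
  simp

/-- The endomorphism that multiplies the component of degree `a` by `s a`. -/
def scale (s : H → ℂˣ) (P : Grading H V) : V →ₗ[ℂ] V := ∑ a : H, (s a : ℂ) • P.proj a

theorem scale_homog (s : H → ℂˣ) (P : Grading H V) {a : H} {x : V} (hx : P.proj a x = x) :
    scale s P x = (s a : ℂ) • x := by
  simp only [scale, LinearMap.sum_apply, LinearMap.smul_apply, P.proj_of_homog hx]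
  rw [Finset.sum_eq_single a] <;> simp +contextual

theorem isHom_scale (s : H → ℂˣ) (P : Grading H V) : IsHom P P (scale s P) :=
  isHom_of_homog fun a x hx => by rw [scale_homog s P hx, map_smul, hx]

theorem scale_comp {s t : H → ℂˣ} (h : ∀ a, s a * t a = 1) (P : Grading H V) :
    scale s P ∘ₗ scale t P = LinearMap.id := by
  refine P.lin_ext fun a x hx => ?_
  rw [LinearMap.comp_apply, scale_homog t P hx, map_smul, scale_homog s P hx, smul_smul,
    mul_comm, ← Units.val_mul, h]
  simp

theorem isHom_lid (P : Grading H V) :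
    IsHom (tensor (unit H) P) P (TensorProduct.lid ℂ V).toLinearMap :=
  isHom_tensor_of_homog fun a b x y hx hy => by
    by_cases ha : a = 1
    · simp [ha, hy]
    · simp [unit_eq_zero ha hx]

theorem isHom_lid_symm (P : Grading H V) :
    IsHom P (tensor (unit H) P) (TensorProduct.lid ℂ V).symm.toLinearMap :=
  isHom_of_homog fun a x hx => by
    have := tensor_homog (unit H) P (unit_homog 1) hx
    rw [one_mul] at this
    simpa using this

theorem isHom_rid (P : Grading H V) :
    IsHom (tensor P (unit H)) P (TensorProduct.rid ℂ V).toLinearMap :=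
  isHom_tensor_of_homog fun a b x y hx hy => by
    by_cases hb : b = 1
    · simp [hb, hx]
    · simp [unit_eq_zero hb hy]

theorem isHom_rid_symm (P : Grading H V) :
    IsHom P (tensor P (unit H)) (TensorProduct.rid ℂ V).symm.toLinearMap :=
  isHom_of_homog fun a x hx => by
    have := tensor_homog P (unit H) hx (unit_homog 1)
    rw [mul_one] at this
    simpa using this

end

end Grading

/-! ## The tensor category `Vect(H, η)` -/

/-- The objects of `Vect(H, η)`: finite-dimensional `H`-graded complex vector spaces. -/
structure Vect {H : Type} [Group H] [Fintype H] (η : Cocycle3 H) where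
  V : Type
  [addCommGroup : AddCommGroup V]
  [module : Module ℂ V]
  [finite : FiniteDimensional ℂ V]
  grading : Grading H V

namespace Vect

attribute [instance] Vect.addCommGroup Vect.module Vect.finite

section

variable {H : Type} [Group H] [Fintype H] {η : Cocycle3 H}

/-- The morphisms of `Vect(H, η)`: degree-preserving linear maps. -/
def hom (X Y : Vect η) : Submodule ℂ (X.V →ₗ[ℂ] Y.V) where
  carrier := {f | Grading.IsHom X.grading Y.grading f}
  add_mem' := by
    intro f g hf hg h x
    simp [hf h x, hg h x]
  zero_mem' := by
    intro h x
    simp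
  smul_mem' := by
    intro c f hf h x
    simp [hf h x]

instance : Category (Vect η) where
  Hom X Y := hom X Y
  id X := ⟨LinearMap.id, fun _ _ => rfl⟩
  comp f g := ⟨g.1 ∘ₗ f.1, fun h x => by
    simp only [LinearMap.comp_apply]
    rw [f.2, g.2]⟩

/-- The linear map underlying a morphism. -/
def lin {X Y : Vect η} (f : X ⟶ Y) : X.V →ₗ[ℂ] Y.V := Subtype.val (p := (· ∈ hom X Y)) f

theorem isHom_lin {X Y : Vect η} (f : X ⟶ Y) : Grading.IsHom X.grading Y.grading (lin f) :=
  Subtype.property (p := (· ∈ hom X Y)) f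

theorem hom_ext {X Y : Vect η} {f g : X ⟶ Y} (h : lin f = lin g) : f = g :=
  Subtype.ext (p := (· ∈ hom X Y)) h

/-- A morphism from a degree-preserving linear map. -/
def ofLin {X Y : Vect η} (f : X.V →ₗ[ℂ] Y.V) (hf : Grading.IsHom X.grading Y.grading f) :
    X ⟶ Y :=
  Subtype.mk (p := (· ∈ hom X Y)) f hf

@[simp] theorem lin_ofLin {X Y : Vect η} (f : X.V →ₗ[ℂ] Y.V)
    (hf : Grading.IsHom X.grading Y.grading f) : lin (ofLin f hf) = f := rfl
@[simp] theorem lin_id (X : Vect η) : lin (𝟙 X) = LinearMap.id := rfl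
@[simp] theorem lin_comp {X Y Z : Vect η} (f : X ⟶ Y) (g : Y ⟶ Z) :
    lin (f ≫ g) = lin g ∘ₗ lin f := rfl

instance : Preadditive (Vect η) where
  homGroup X Y := inferInstanceAs (AddCommGroup (hom X Y))
  add_comp _ _ _ f f' g := hom_ext (LinearMap.comp_add (lin f) (lin f') (lin g))
  comp_add _ _ _ f g g' := hom_ext (LinearMap.add_comp (lin f) (lin g') (lin g))

instance : Linear ℂ (Vect η) where
  homModule X Y := inferInstanceAs (Module ℂ (hom X Y))
  smul_comp _ _ _ r f g := hom_ext (LinearMap.comp_smul (lin g) r (lin f))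
  comp_smul _ _ _ f r g := hom_ext (LinearMap.smul_comp r (lin g) (lin f))

/-- The tensor product of graded vector spaces. -/
abbrev tensor (X Y : Vect η) : Vect η where
  V := X.V ⊗[ℂ] Y.V
  grading := X.grading.tensor Y.grading

/-- The unit object. -/
abbrev unit (η : Cocycle3 H) : Vect η where
  V := ℂ
  grading := Grading.unit H

/-- The tensor product of morphisms. -/
def tensorMap {X Y X' Y' : Vect η} (f : X ⟶ X') (g : Y ⟶ Y') : tensor X Y ⟶ tensor X' Y' :=
  ofLin (X := tensor X Y) (Y := tensor X' Y') (TensorProduct.map (lin f) (lin g))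
    (Grading.isHom_map (isHom_lin f) (isHom_lin g))

/-- The associativity constraint defined by `η`. -/
def assoc (X Y Z : Vect η) : tensor (tensor X Y) Z ≅ tensor X (tensor Y Z) where
  hom := ofLin (X := tensor (tensor X Y) Z) (Y := tensor X (tensor Y Z))
    (Grading.assocLin η X.grading Y.grading Z.grading) (Grading.isHom_assocLin _ _ _ _)
  inv := ofLin (X := tensor X (tensor Y Z)) (Y := tensor (tensor X Y) Z)
    (Grading.assocInvLin η X.grading Y.grading Z.grading) (Grading.isHom_assocInvLin _ _ _ _)
  hom_inv_id := hom_ext (Grading.assocInvLin_comp _ _ _ _)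
  inv_hom_id := hom_ext (Grading.assocLin_comp _ _ _ _)

/-- The automorphism of `X` that multiplies the component of degree `a` by `s a`. -/
def scaleIso (s : H → ℂˣ) (X : Vect η) : X ≅ X where
  hom := ofLin (Grading.scale s X.grading) (Grading.isHom_scale _ _)
  inv := ofLin (Grading.scale (fun a => (s a)⁻¹) X.grading) (Grading.isHom_scale _ _)
  hom_inv_id := hom_ext (Grading.scale_comp (fun _ => inv_mul_cancel _) _)
  inv_hom_id := hom_ext (Grading.scale_comp (fun _ => mul_inv_cancel _) _)

/-- The canonical isomorphism `ℂ ⊗ X ≅ X`. -/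
def lid (X : Vect η) : tensor (unit η) X ≅ X where
  hom := ofLin (X := tensor (unit η) X) (TensorProduct.lid ℂ X.V).toLinearMap
    (Grading.isHom_lid _)
  inv := ofLin (Y := tensor (unit η) X) (TensorProduct.lid ℂ X.V).symm.toLinearMap
    (Grading.isHom_lid_symm _)
  hom_inv_id := hom_ext (LinearMap.ext fun t => (TensorProduct.lid ℂ X.V).symm_apply_apply t)
  inv_hom_id := hom_ext (LinearMap.ext fun t => (TensorProduct.lid ℂ X.V).apply_symm_apply t)

/-- The canonical isomorphism `X ⊗ ℂ ≅ X`. -/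
def rid (X : Vect η) : tensor X (unit η) ≅ X where
  hom := ofLin (X := tensor X (unit η)) (TensorProduct.rid ℂ X.V).toLinearMap
    (Grading.isHom_rid _)
  inv := ofLin (Y := tensor X (unit η)) (TensorProduct.rid ℂ X.V).symm.toLinearMap
    (Grading.isHom_rid_symm _)
  hom_inv_id := hom_ext (LinearMap.ext fun t => (TensorProduct.rid ℂ X.V).symm_apply_apply t)
  inv_hom_id := hom_ext (LinearMap.ext fun t => (TensorProduct.rid ℂ X.V).apply_symm_apply t)

/-- The unit constraints are corrected by `η(1, 1, a)⁻¹` and `η(a, 1, 1)` in degree `a`, as the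
triangle axiom requires; both factors are `1` when `η` is normalized. -/
instance : MonoidalCategoryStruct (Vect η) where
  tensorObj := tensor
  whiskerLeft X _ _ g := tensorMap (𝟙 X) g
  whiskerRight f Y := tensorMap f (𝟙 Y)
  tensorHom f g := tensorMap f g
  tensorUnit := unit η
  associator := assoc
  leftUnitor X := lid X ≪≫ scaleIso (fun a => (η 1 1 a)⁻¹) X
  rightUnitor X := rid X ≪≫ scaleIso (fun a => η a 1 1) X

theorem triangle_identity (η : Cocycle3 H) (a b : H) : η a 1 b * (η 1 1 b)⁻¹ = η a 1 1 := by
  have h := η.cocycle a 1 1 b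
  simp only [mul_one, one_mul] at h
  rw [mul_inv_eq_iff_eq_mul, mul_comm]
  refine mul_right_cancel (b := η a 1 b) ?_
  rw [← h]
  ac_rfl

theorem associator_nat {X₁ X₂ X₃ Y₁ Y₂ Y₃ : Vect η} (f₁ : X₁ ⟶ Y₁) (f₂ : X₂ ⟶ Y₂)
    (f₃ : X₃ ⟶ Y₃) :
    tensorMap (tensorMap f₁ f₂) f₃ ≫ (assoc Y₁ Y₂ Y₃).hom =
      (assoc X₁ X₂ X₃).hom ≫ tensorMap f₁ (tensorMap f₂ f₃) := by
  refine hom_ext (Grading.tensor_ext_left X₁.grading X₂.grading X₃.grading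
    fun a b c x y z hx hy hz => ?_)
  change Grading.assocLin η Y₁.grading Y₂.grading Y₃.grading
      ((lin f₁ x ⊗ₜ lin f₂ y) ⊗ₜ lin f₃ z) =
    TensorProduct.map (lin f₁) (TensorProduct.map (lin f₂) (lin f₃))
      (Grading.assocLin η X₁.grading X₂.grading X₃.grading ((x ⊗ₜ y) ⊗ₜ z))
  rw [Grading.assocLin_tmul _ _ _ _ hx hy hz, Grading.assocLin_tmul _ _ _ _
    ((isHom_lin f₁).homog hx) ((isHom_lin f₂).homog hy) ((isHom_lin f₃).homog hz), map_smul]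
  rfl

theorem scale_nat {X Y : Vect η} (s : H → ℂˣ) (f : X ⟶ Y) :
    (scaleIso s X).hom ≫ f = f ≫ (scaleIso s Y).hom := by
  refine hom_ext (Grading.lin_ext X.grading fun a x hx => ?_)
  change lin f (Grading.scale s X.grading x) = Grading.scale s Y.grading (lin f x)
  rw [Grading.scale_homog _ _ hx, Grading.scale_homog _ _ ((isHom_lin f).homog hx), map_smul]

theorem lid_nat {X Y : Vect η} (f : X ⟶ Y) :
    tensorMap (𝟙 (unit η)) f ≫ (lid Y).hom = (lid X).hom ≫ f := by
  refine hom_ext (TensorProduct.ext' fun c x => ?_)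
  exact ((lin f).map_smul c x).symm

theorem rid_nat {X Y : Vect η} (f : X ⟶ Y) :
    tensorMap f (𝟙 (unit η)) ≫ (rid Y).hom = (rid X).hom ≫ f := by
  refine hom_ext (TensorProduct.ext' fun x c => ?_)
  exact ((lin f).map_smul c x).symm

theorem pentagon_eq (W X Y Z : Vect η) :
    tensorMap (assoc W X Y).hom (𝟙 Z) ≫ (assoc W (tensor X Y) Z).hom ≫
        tensorMap (𝟙 W) (assoc X Y Z).hom =
      (assoc (tensor W X) Y Z).hom ≫ (assoc W X (tensor Y Z)).hom := by
  refine hom_ext (TensorProduct.ext (Grading.tensor_ext_left W.grading X.grading Y.grading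
    fun a b c w x y hw hx hy => Z.grading.lin_ext fun d z hz => ?_))
  change TensorProduct.map LinearMap.id (Grading.assocLin η X.grading Y.grading Z.grading)
      (Grading.assocLin η W.grading (X.grading.tensor Y.grading) Z.grading
        ((Grading.assocLin η W.grading X.grading Y.grading ((w ⊗ₜ x) ⊗ₜ y)) ⊗ₜ z)) =
    Grading.assocLin η W.grading X.grading (Y.grading.tensor Z.grading)
      (Grading.assocLin η (W.grading.tensor X.grading) Y.grading Z.grading
        (((w ⊗ₜ x) ⊗ₜ y) ⊗ₜ z))
  rw [Grading.assocLin_tmul _ _ _ _ hw hx hy, ← TensorProduct.smul_tmul', map_smul, map_smul,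
    Grading.assocLin_tmul _ _ _ _ hw (Grading.tensor_homog _ _ hx hy) hz, map_smul,
    TensorProduct.map_tmul, Grading.assocLin_tmul _ _ _ _ hx hy hz,
    Grading.assocLin_tmul _ _ _ _ (Grading.tensor_homog _ _ hw hx) hy hz, map_smul,
    Grading.assocLin_tmul _ _ _ _ hw hx (Grading.tensor_homog _ _ hy hz),
    TensorProduct.tmul_smul, smul_smul, smul_smul, smul_smul]
  have h := η.cocycle a b c d
  rw [← Units.val_mul, ← Units.val_mul, ← Units.val_mul, ← h]
  simp only [LinearMap.id_apply]
  congr 2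
  ac_rfl

theorem triangle_eq (X Y : Vect η) :
    (assoc X (unit η) Y).hom ≫
        tensorMap (𝟙 X) (lid Y ≪≫ scaleIso (fun a => (η 1 1 a)⁻¹) Y).hom =
      tensorMap (rid X ≪≫ scaleIso (fun a => η a 1 1) X).hom (𝟙 Y) := by
  refine hom_ext (Grading.tensor_ext_left X.grading (Grading.unit H) Y.grading
    fun a b c x r y hx hr hy => ?_)
  by_cases hb : b = 1
  · subst hb
    change TensorProduct.map LinearMap.id (Grading.scale (fun a => (η 1 1 a)⁻¹) Y.grading ∘ₗ
          (TensorProduct.lid ℂ Y.V).toLinearMap)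
        (Grading.assocLin η X.grading (Grading.unit H) Y.grading ((x ⊗ₜ r) ⊗ₜ y)) =
      Grading.scale (fun a => η a 1 1) X.grading (r • x) ⊗ₜ y
    rw [Grading.assocLin_tmul _ _ _ _ hx hr hy, map_smul, TensorProduct.map_tmul,
      LinearMap.comp_apply, map_smul, Grading.scale_homog _ _ hx]
    simp only [LinearEquiv.coe_coe, TensorProduct.lid_tmul, map_smul, LinearMap.id_apply]
    rw [Grading.scale_homog _ _ hy, ← triangle_identity η a c]
    simp only [TensorProduct.tmul_smul, ← TensorProduct.smul_tmul', smul_smul, Units.val_mul]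
    congr 1
    ring
  · rw [Grading.unit_eq_zero hb hr, TensorProduct.tmul_zero, TensorProduct.zero_tmul, map_zero,
      map_zero]

theorem tensorMap_id (X Y : Vect η) : tensorMap (𝟙 X) (𝟙 Y) = 𝟙 (tensor X Y) :=
  hom_ext TensorProduct.map_id

theorem tensorMap_comp {X₁ Y₁ Z₁ X₂ Y₂ Z₂ : Vect η} (f₁ : X₁ ⟶ Y₁) (f₂ : X₂ ⟶ Y₂)
    (g₁ : Y₁ ⟶ Z₁) (g₂ : Y₂ ⟶ Z₂) :
    tensorMap f₁ f₂ ≫ tensorMap g₁ g₂ = tensorMap (f₁ ≫ g₁) (f₂ ≫ g₂) :=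
  hom_ext (TensorProduct.map_comp _ _ _ _).symm

instance : MonoidalCategory (Vect η) :=
  MonoidalCategory.ofTensorHom
    (id_tensorHom_id := tensorMap_id)
    (id_tensorHom := fun _ _ _ _ => rfl)
    (tensorHom_id := fun _ _ => rfl)
    (tensorHom_comp_tensorHom := tensorMap_comp)
    (associator_naturality := associator_nat)
    (leftUnitor_naturality := fun {X Y} f => by
      change tensorMap (𝟙 (unit η)) f ≫ (lid Y).hom ≫ (scaleIso _ Y).hom =
        ((lid X).hom ≫ (scaleIso _ X).hom) ≫ f
      rw [Category.assoc, scale_nat, ← Category.assoc, lid_nat, Category.assoc])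
    (rightUnitor_naturality := fun {X Y} f => by
      change tensorMap f (𝟙 (unit η)) ≫ (rid Y).hom ≫ (scaleIso _ Y).hom =
        ((rid X).hom ≫ (scaleIso _ X).hom) ≫ f
      rw [Category.assoc, scale_nat, ← Category.assoc, rid_nat, Category.assoc])
    (pentagon := pentagon_eq)
    (triangle := triangle_eq)

end

end Vect

/-! ## Pointed fusion categories -/

section

variable (C : Type u) [Category.{v} C] [Preadditive C] [Linear ℂ C] [MonoidalCategory C]

/-- Fusion categories over `ℂ`: abelian semisimple rigid `ℂ`-linear monoidal categories with
finite-dimensional spaces of morphisms, finitely many isomorphism classes of simple objects, and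
`End(𝟙) = ℂ`. -/
structure IsFusion : Prop where
  [monoidalPreadditive : MonoidalPreadditive C]
  [monoidalLinear : MonoidalLinear ℂ C]
  [hasFiniteBiproducts : HasFiniteBiproducts C]
  [hasKernels : HasKernels C]
  [hasCokernels : HasCokernels C]
  [normalMono : IsNormalMonoCategory C]
  [normalEpi : IsNormalEpiCategory C]
  finite_hom : ∀ X Y : C, FiniteDimensional ℂ (X ⟶ Y)
  semisimple : ∀ X : C, ∃ (n : ℕ) (S : Fin n → C),
    (∀ i, Simple (S i)) ∧ Nonempty (X ≅ ⨁ S)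
  finite_simple : ∃ (n : ℕ) (S : Fin n → C), ∀ X : C, Simple X → ∃ i, Nonempty (X ≅ S i)
  end_unit : Function.Bijective (fun c : ℂ => c • 𝟙 (𝟙_ C))
  right_dual : ∀ X : C, ∃ Y : C, Nonempty (ExactPairing X Y)
  left_dual : ∀ X : C, ∃ Y : C, Nonempty (ExactPairing Y X)

/-- Pointed fusion categories: all simple objects are invertible. -/
structure IsPointedFusion : Prop extends IsFusion C where
  invertible : ∀ X : C, Simple X → ∃ Y : C, Nonempty (X ⊗ Y ≅ 𝟙_ C) ∧ Nonempty (Y ⊗ X ≅ 𝟙_ C)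

variable {C}

/-- `d` is the squared dimension of the simple object `X`: for a two-sided dual `Y` of `X`, with
any choice of the two pairs of duality morphisms, it is the product of the scalars
`𝟙 → X ⊗ Y → 𝟙` and `𝟙 → Y ⊗ X → 𝟙`. -/
def IsSqDim (X : C) (d : ℂ) : Prop :=
  ∃ (Y : C) (p : ExactPairing X Y) (q : ExactPairing Y X),
    (p.coevaluation' ≫ q.evaluation') ≫ (q.coevaluation' ≫ p.evaluation') = d • 𝟙 (𝟙_ C)

variable (C)

/-- `d` is the global dimension of `C`: the sum of the squared dimensions of the simple objects,
one for each isomorphism class. -/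
def HasGlobalDim (d : ℂ) : Prop :=
  ∃ (n : ℕ) (S : Fin n → C) (δ : Fin n → ℂ), (∀ i, Simple (S i)) ∧
    (∀ X : C, Simple X → ∃! i, Nonempty (X ≅ S i)) ∧
    (∀ i, IsSqDim (S i) (δ i)) ∧ ∑ i, δ i = d

/-- Tensor equivalence: there is a `ℂ`-linear monoidal equivalence from `C` to `D`. -/
def TensorEquiv (D : Type u') [Category.{v'} D] [Preadditive D] [Linear ℂ D]
    [MonoidalCategory D] : Prop :=
  ∃ F : C ⥤ D, F.IsEquivalence ∧ Nonempty F.Monoidal ∧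
    ∃ _ : F.Additive, F.Linear ℂ

end

theorem TensorEquiv.refl (C : Type u) [Category.{v} C] [Preadditive C] [Linear ℂ C]
    [MonoidalCategory C] : TensorEquiv C C :=
  ⟨𝟭 C, inferInstance, ⟨inferInstance⟩, inferInstance, inferInstance⟩

theorem TensorEquiv.symm {C : Type u} [Category.{v} C] [Preadditive C] [Linear ℂ C]
    [MonoidalCategory C] {D : Type u'} [Category.{v'} D] [Preadditive D] [Linear ℂ D]
    [MonoidalCategory D] (h : TensorEquiv C D) : TensorEquiv D C := by
  obtain ⟨F, hF, ⟨hM⟩, hA, hL⟩ := h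
  have : F.asEquivalence.functor.Monoidal := hM
  have : F.asEquivalence.functor.Additive := hA
  have : F.asEquivalence.functor.Linear ℂ := hL
  exact ⟨F.asEquivalence.inverse, inferInstance, ⟨F.asEquivalence.inverseMonoidal⟩,
    inferInstance, inferInstance⟩

theorem TensorEquiv.trans {C : Type u} [Category.{v} C] [Preadditive C] [Linear ℂ C]
    [MonoidalCategory C] {D : Type u'} [Category.{v'} D] [Preadditive D] [Linear ℂ D]
    [MonoidalCategory D] {E : Type*} [Category* E] [Preadditive E] [Linear ℂ E]
    [MonoidalCategory E] (h : TensorEquiv C D) (h' : TensorEquiv D E) : TensorEquiv C E := by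
  obtain ⟨F, hF, ⟨hM⟩, hA, hL⟩ := h
  obtain ⟨G, hG, ⟨hM'⟩, hA', hL'⟩ := h'
  exact ⟨F ⋙ G, inferInstance, ⟨inferInstance⟩, inferInstance, inferInstance⟩

/-- Pointed fusion categories of global dimension `d`. -/
structure PointedFusionCat (d : ℂ) where
  C : Type u
  [category : Category.{v} C]
  [preadditive : Preadditive C]
  [linear : Linear ℂ C]
  [monoidal : MonoidalCategory C]
  isPointedFusion : IsPointedFusion C
  hasGlobalDim : HasGlobalDim C d

attribute [instance] PointedFusionCat.category PointedFusionCat.preadditive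
  PointedFusionCat.linear PointedFusionCat.monoidal

/-- Tensor equivalence of pointed fusion categories of global dimension `d`. -/
instance tensorSetoid (d : ℂ) : Setoid (PointedFusionCat.{v, u} d) where
  r X Y := TensorEquiv X.C Y.C
  iseqv := ⟨fun X => TensorEquiv.refl X.C, TensorEquiv.symm, TensorEquiv.trans⟩

/-- The equivalence classes of pointed fusion categories of global dimension `d`. -/
abbrev PointedFusionClasses (d : ℂ) : Type (max (u + 1) (v + 1)) :=
  Quotient (tensorSetoid.{v, u} d)

/-! ## The groups of order 8 and explicit models of their cohomology -/

/-- `(ℤ/2)³`. -/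
abbrev Z2Cubed : Type := Multiplicative (Fin 3 → ZMod 2)

/-- `ℤ/4 × ℤ/2`. -/
abbrev Z4Z2 : Type := Multiplicative (ZMod 4 × ZMod 2)

/-- `ℤ/8`. -/
abbrev Z8 : Type := Multiplicative (ZMod 8)

/-- The dihedral group of order 8. -/
abbrev D8 : Type := DihedralGroup 4

/-- The quaternion group of order 8. -/
abbrev Q8 : Type := QuaternionGroup 2

/-- The polynomial ring `𝔽₂[x, y, z]`. -/
abbrev Poly : Type := MvPolynomial (Fin 3) (ZMod 2)

/-- The Steenrod square `Sq¹` on `𝔽₂[x, y, z] = H^*((ℤ/2)³, 𝔽₂)`: the derivation with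
`Sq¹ x = x²`, `Sq¹ y = y²`, `Sq¹ z = z²`. -/
def sq1 : Derivation (ZMod 2) Poly Poly :=
  MvPolynomial.mkDerivation (ZMod 2) (fun i => MvPolynomial.X i ^ 2)

/-- The kernel of `Sq¹` on the homogeneous polynomials of degree 4. -/
def kerSq1 : Submodule (ZMod 2) Poly :=
  MvPolynomial.homogeneousSubmodule (Fin 3) (ZMod 2) 4 ⊓ LinearMap.ker sq1.toLinearMap

/-- The linear substitution on `𝔽₂[x, y, z]` induced by an automorphism `φ` of `(ℤ/2)³`, where
`x, y, z` are the coordinate functions: a coordinate function `l` is sent to `l ∘ φ`. -/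
def linSubst (φ : Z2Cubed ≃* Z2Cubed) : Poly →ₐ[ZMod 2] Poly :=
  MvPolynomial.aeval (fun i => ∑ j : Fin 3,
    MvPolynomial.C ((φ (Multiplicative.ofAdd (Pi.single j 1))).toAdd i) * MvPolynomial.X j)

/-- Representatives of the orbits for `(ℤ/2)³`. -/
def repsZ2Cubed : Fin 10 → Poly :=
  let x : Poly := MvPolynomial.X 0
  let y : Poly := MvPolynomial.X 1
  let z : Poly := MvPolynomial.X 2
  let m : Poly := x ^ 2 * y * z + x * y ^ 2 * z + x * y * z ^ 2
  ![0,
    x ^ 4,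
    x ^ 2 * y ^ 2,
    x ^ 4 + y ^ 2 * z ^ 2,
    x ^ 4 + y ^ 4 + x ^ 2 * y ^ 2,
    x ^ 4 + m,
    x ^ 4 + m + y ^ 2 * z ^ 2,
    m + x ^ 2 * y ^ 2 + x ^ 2 * z ^ 2 + y ^ 2 * z ^ 2,
    m,
    x ^ 4 + y ^ 4 + z ^ 4 + m + x ^ 2 * y ^ 2 + x ^ 2 * z ^ 2 + y ^ 2 * z ^ 2]

/-- The orbits for `ℤ/4 × ℤ/2`; `(i, j, k)` stands for `i u² + j uv + k v²`. -/
def orbitsZ4Z2 : Set (Set (ZMod 4 × ZMod 2 × ZMod 2)) :=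
  {{(1, 0, 0), (1, 0, 1)},
   {(0, 0, 1)},
   {(0, 1, 0), (2, 1, 1), (2, 1, 0), (0, 1, 1)},
   {(1, 1, 0), (3, 1, 0)},
   {(3, 0, 0), (3, 0, 1)},
   {(1, 1, 1), (3, 1, 1)},
   {(2, 0, 0)},
   {(2, 0, 1)},
   {(0, 0, 0)}}

/-- The orbits for `D₈`; `(i, j, k)` stands for `i γ + j α + k β`. -/
def orbitsD8 : Set (Set (ZMod 4 × ZMod 2 × ZMod 2)) :=
  {{(0, 0, 0)}, {(1, 0, 0)}, {(2, 0, 0)}, {(3, 0, 0)},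
   {(0, 1, 0)}, {(0, 0, 1), (0, 1, 1)}, {(1, 0, 1), (1, 1, 1)},
   {(2, 0, 1), (2, 1, 1)}, {(3, 0, 1), (3, 1, 1)},
   {(1, 1, 0)}, {(2, 1, 0)}, {(3, 1, 0)}}

end PointedFusion

end

open PointedFusion

/-! In a pointed fusion category the tensor product of two simple objects is simple, so the
isomorphism classes of simple objects form a finite group `H`. Chosen isomorphisms `S (ab) ≅ S a ⊗ S
b` are associative up to scalars `η a b c`, and the pentagon axiom says that `η` is a 3-cocycle
(`pentagon_scalars`, `IsPointedFusion.exists_pointedData`). The functor sending `X` to the graded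
space with components `Hom(S h, X)` is then a tensor equivalence onto `Vect η`
(`PointedData.tensorEquiv`). A tensor equivalence permutes the simple objects and changes the chosen
isomorphisms by scalars, so precisely the group up to isomorphism and the class of `η` are
invariants (`PointedData.exists_mulEquiv`, `tensorEquiv_vect_iff`). Invertible objects have squared
dimension 1, hence global dimension 8 means that `H` has order 8. The classification thus becomes
the determination of the orbits of `Aut(H)` on `H³(H, ℂ^*)` for the five groups of order 8.

The cohomology is squeezed between two bounds. From above: a subgroup `N` of index 2 gives short
exact sequences `A → Coind A → A_sgn` and `A_sgn → Coind A → A`. By the Shapiro lemma and the long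
exact sequences, the order of `H³(G)` is at most the product of those of `H³(N)`, `H²(N)` and
`H¹(G)`; a nontrivial transfer from `N` to `G` saves a factor 2. Starting from cyclic groups this
gives the bounds 128, 16, 16 and 8 for `(ℤ/2)³`, `ℤ/4 × ℤ/2`, `D₈` and `Q₈`, while `ℤ/8` is cyclic
itself. From below: explicit cocycles are told apart by evaluating them on 3-cycles, and as many
classes as the bound allows are found (`bijective_of_card`).

The cycles `∑ [g | gⁱ | g]` are natural in the group, so a class becomes a function on the group and
automorphisms act by precomposition (`exists_equiv_of_invariants`). What remains is a finite
computation. For `(ℤ/2)³` the classes become arbitrary functions on the seven nonzero vectors, that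
is, subsets of the Fano plane, and the orbits are separated by numbers of points and lines;
evaluation of polynomials identifies these functions with the kernel of `Sq¹`. For `Q₈` elements do
not suffice, and a cycle attached to a pair of generators is used.

The comparison with `H⁴(H, ℤ)` is the connecting map of the exponential sequence, an isomorphism
because the cohomology with coefficients in `ℂ` vanishes in positive degrees. -/

namespace PointedFusion

/-! ### Cohomology classes represented by explicit inhomogeneous cochains -/

section CochainDescription

open groupCohomology

variable {k G : Type u} [CommRing k] [Group G]

/-- The cohomology class of an explicit cocycle. -/
noncomputable def cohMk (A : Rep.{u} k G) {n : ℕ} (f : (Fin n → G) → A)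
    (hf : inhomogeneousCochains.d A n f = 0) : groupCohomology A n :=
  π A n (cocyclesMk f hf)

theorem exists_cohMk {A : Rep.{u} k G} {n : ℕ} (c : groupCohomology A n) :
    ∃ f hf, c = cohMk A (n := n) f hf := by
  induction c using groupCohomology_induction_on with
  | h x =>
    have hx : inhomogeneousCochains.d A n (iCocycles A n x) = 0 := by
      have h := (inhomogeneousCochains A).iCycles_d n (n + 1)
      rw [inhomogeneousCochains.d_def] at h
      exact congrArg (fun m => m.hom x) h
    refine ⟨iCocycles A n x, hx, congrArg (π A n) ?_⟩
    apply (ModuleCat.mono_iff_injective (iCocycles A n)).1 inferInstance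
    exact (iCocycles_mk _ hx).symm

theorem cohMk_add {A : Rep.{u} k G} {n : ℕ} (f g : (Fin n → G) → A)
    (hf : inhomogeneousCochains.d A n f = 0) (hg : inhomogeneousCochains.d A n g = 0)
    (hfg : inhomogeneousCochains.d A n (f + g) = 0) :
    cohMk A (f + g) hfg = cohMk A f hf + cohMk A g hg := by
  rw [cohMk, cohMk, cohMk, ← map_add]
  congr 1
  apply (ModuleCat.mono_iff_injective (iCocycles A n)).1 inferInstance
  rw [map_add, iCocycles_mk, iCocycles_mk, iCocycles_mk]

/-- The projection from cocycles to cohomology is the cokernel of the coboundary map into the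
cocycles, so exactness there turns a vanishing class into a coboundary. -/
theorem cohMk_eq_zero_iff {A : Rep.{u} k G} {n : ℕ} (f : (Fin (n + 1) → G) → A)
    (hf : inhomogeneousCochains.d A (n + 1) f = 0) :
    cohMk A f hf = 0 ↔ ∃ h, inhomogeneousCochains.d A n h = f := by
  have hex : (ShortComplex.mk ((inhomogeneousCochains A).toCycles n (n + 1))
      ((inhomogeneousCochains A).homologyπ (n + 1)) (by simp)).Exact :=
    ShortComplex.exact_of_g_is_cokernel _
      ((inhomogeneousCochains A).homologyIsCokernel n (n + 1) (by simp))
  have hto : ∀ h, iCocycles A (n + 1) (toCocycles A n (n + 1) h) =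
      inhomogeneousCochains.d A n h := by
    intro h
    have h' := (inhomogeneousCochains A).toCycles_i n (n + 1)
    rw [inhomogeneousCochains.d_def] at h'
    exact congrArg (fun m => m.hom h) h'
  rw [ShortComplex.moduleCat_exact_iff] at hex
  constructor
  · intro h0
    obtain ⟨h, hh⟩ := hex _ h0
    refine ⟨h, ?_⟩
    rw [← hto]
    exact (congrArg (iCocycles A (n + 1)) hh).trans (iCocycles_mk _ _)
  · rintro ⟨h, rfl⟩
    have h1 : cocyclesMk (inhomogeneousCochains.d A n h) hf = toCocycles A n (n + 1) h := by
      apply (ModuleCat.mono_iff_injective (iCocycles A (n + 1))).1 inferInstance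
      rw [iCocycles_mk, hto]
    rw [cohMk, h1]
    have h' := (inhomogeneousCochains A).toCycles_comp_homologyπ n (n + 1)
    exact congrArg (fun m => m.hom h) h'

theorem cohMk_eq_iff {A : Rep.{u} k G} {n : ℕ} (f g : (Fin (n + 1) → G) → A)
    (hf : inhomogeneousCochains.d A (n + 1) f = 0)
    (hg : inhomogeneousCochains.d A (n + 1) g = 0) :
    cohMk A f hf = cohMk A g hg ↔ ∃ h, f = g + inhomogeneousCochains.d A n h := by
  have hfg : inhomogeneousCochains.d A (n + 1) (f - g) = 0 := by
    rw [map_sub, hf, hg, sub_zero]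
  have h1 := cohMk_add (f - g) g hfg hg (by rw [sub_add_cancel, hf])
  simp only [sub_add_cancel] at h1
  rw [h1, add_eq_right, cohMk_eq_zero_iff]
  constructor
  · rintro ⟨h, hh⟩
    exact ⟨h, by rw [hh, add_sub_cancel]⟩
  · rintro ⟨h, hh⟩
    exact ⟨h, by rw [hh, add_sub_cancel_left]⟩

theorem map_cohMk {H : Type u} [Group H] {A : Rep.{u} k H} {B : Rep.{u} k G} (φ : G →* H)
    (t : Rep.res φ A ⟶ B) {n : ℕ} (f : (Fin n → H) → A)
    (hf : inhomogeneousCochains.d A n f = 0)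
    (hf' : inhomogeneousCochains.d B n (fun g => t.hom (f (fun i => φ (g i)))) = 0) :
    groupCohomology.map φ t n (cohMk A f hf) =
      cohMk B (fun g => t.hom (f (fun i => φ (g i)))) hf' := by
  have h := π_map φ t n
  refine (congrArg (fun m => m.hom (cocyclesMk f hf)) h).trans ?_
  refine congrArg (π B n) ?_
  apply (ModuleCat.mono_iff_injective (iCocycles B n)).1 inferInstance
  rw [iCocycles_mk]
  have h2 := HomologicalComplex.cyclesMap_i (cochainsMap φ t) n
  refine (congrArg (fun m => m.hom (cocyclesMk f hf)) h2).trans ?_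
  change (cochainsMap φ t).f n (iCocycles A n (cocyclesMk f hf)) = _
  rw [iCocycles_mk]
  rfl

theorem d_map_eq_zero {H : Type u} [Group H] {A : Rep.{u} k H} {B : Rep.{u} k G} (φ : G →* H)
    (t : Rep.res φ A ⟶ B) {n : ℕ} (f : (Fin n → H) → A)
    (hf : inhomogeneousCochains.d A n f = 0) :
    inhomogeneousCochains.d B n (fun g => t.hom (f (fun i => φ (g i)))) = 0 := by
  have h := (cochainsMap φ t).comm n (n + 1)
  rw [inhomogeneousCochains.d_def, inhomogeneousCochains.d_def] at h
  refine (congrArg (fun m => m.hom f) h).trans ?_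
  exact (congrArg ((cochainsMap φ t).f (n + 1)) hf).trans (map_zero _)

end CochainDescription

/-! ### Trivial coefficients: formulas in low degree and 3-cocycles with values in `ℂ^*` -/

section Trivial

variable {G H : Type} [Group G] [Group H]

theorem cohPullback_cohMk (A : Type) [AddCommGroup A] (n : ℕ) (φ : G →* H)
    (f : (Fin n → H) → A) (hf : inhomogeneousCochains.d (Rep.trivial ℤ H A) n f = 0) :
    ∃ hf', cohPullback A n φ (cohMk (Rep.trivial ℤ H A) f hf) =
      cohMk (Rep.trivial ℤ G A) (fun g => f (fun i => φ (g i))) hf' := by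
  refine ⟨?_, map_cohMk (A := Rep.trivial ℤ H A) (B := Rep.trivial ℤ G A) φ
    (Rep.ofHom ⟨LinearMap.id, fun _ => rfl⟩) f hf ?_⟩
  all_goals
    exact d_map_eq_zero (A := Rep.trivial ℤ H A) (B := Rep.trivial ℤ G A) φ
      (Rep.ofHom ⟨LinearMap.id, fun _ => rfl⟩) f hf

theorem d_two_apply {A : Type} [AddCommGroup A] (h : (Fin 2 → G) → A) (g : Fin 3 → G) :
    inhomogeneousCochains.d (Rep.trivial ℤ G A) 2 h g =
      h ![g 1, g 2] - h ![g 0 * g 1, g 2] + h ![g 0, g 1 * g 2] - h ![g 0, g 1] := by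
  change h (fun i => g i.succ) + ∑ j : Fin 3, (-1 : ℤ) ^ ((j : ℕ) + 1) •
    h (Fin.contractNth j (· * ·) g) = _
  have e0 : (fun i : Fin 2 => g i.succ) = ![g 1, g 2] := by
    funext i; fin_cases i <;> rfl
  have e1 : Fin.contractNth 0 (· * ·) g = ![g 0 * g 1, g 2] := by
    funext i; fin_cases i <;> rfl
  have e2 : Fin.contractNth 1 (· * ·) g = ![g 0, g 1 * g 2] := by
    funext i; fin_cases i <;> rfl
  have e3 : Fin.contractNth 2 (· * ·) g = ![g 0, g 1] := by
    funext i; fin_cases i <;> rfl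
  rw [Fin.sum_univ_three, e0, e1, e2, e3]
  norm_num
  abel

theorem d_three_apply {A : Type} [AddCommGroup A] (f : (Fin 3 → G) → A) (g : Fin 4 → G) :
    inhomogeneousCochains.d (Rep.trivial ℤ G A) 3 f g =
      f ![g 1, g 2, g 3] - f ![g 0 * g 1, g 2, g 3] + f ![g 0, g 1 * g 2, g 3]
        - f ![g 0, g 1, g 2 * g 3] + f ![g 0, g 1, g 2] := by
  change f (fun i => g i.succ) + ∑ j : Fin 4, (-1 : ℤ) ^ ((j : ℕ) + 1) •
    f (Fin.contractNth j (· * ·) g) = _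
  have e0 : (fun i : Fin 3 => g i.succ) = ![g 1, g 2, g 3] := by
    funext i; fin_cases i <;> rfl
  have e1 : Fin.contractNth 0 (· * ·) g = ![g 0 * g 1, g 2, g 3] := by
    funext i; fin_cases i <;> rfl
  have e2 : Fin.contractNth 1 (· * ·) g = ![g 0, g 1 * g 2, g 3] := by
    funext i; fin_cases i <;> rfl
  have e3 : Fin.contractNth 2 (· * ·) g = ![g 0, g 1, g 2 * g 3] := by
    funext i; fin_cases i <;> rfl
  have e4 : Fin.contractNth 3 (· * ·) g = ![g 0, g 1, g 2] := by
    funext i; fin_cases i <;> rfl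
  rw [Fin.sum_univ_four, e0, e1, e2, e3, e4]
  norm_num
  abel

theorem vec3_eta {α : Type*} (g : Fin 3 → α) : ![g 0, g 1, g 2] = g := by
  funext i; fin_cases i <;> rfl

theorem Cocycle3.exists_cls_eq (c : H3 G) : ∃ η : Cocycle3 G, η.cls = c := by
  obtain ⟨f, hf, rfl⟩ := exists_cohMk c
  change (Fin 3 → G) → Additive ℂˣ at f
  refine ⟨⟨fun a b c => (f ![a, b, c]).toMul, fun a b c d => ?_⟩, ?_⟩
  · have h := congrFun hf ![a, b, c, d]
    have h' := (d_three_apply f ![a, b, c, d]).symm.trans h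
    apply Additive.ofMul.injective
    simp only [ofMul_mul]
    change f ![b, c, d] - f ![a * b, c, d] + f ![a, b * c, d] - f ![a, b, c * d] +
      f ![a, b, c] = 0 at h'
    change f ![b, c, d] + f ![a, b * c, d] + f ![a, b, c] =
      f ![a * b, c, d] + f ![a, b, c * d]
    rw [← sub_eq_zero, ← h']
    abel
  · refine congrArg (groupCohomology.π _ 3) ?_
    congr 1
    funext g
    exact congrArg f (vec3_eta g)

/-- `h` is the 2-cochain with coboundary `η / η'`; terms are moved across so that no inverses occur.
This is the relation produced by rescaling isomorphisms `S (ab) ≅ S a ⊗ S b`. -/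
theorem Cocycle3.cls_eq_iff (η η' : Cocycle3 G) :
    η.cls = η'.cls ↔ ∃ h : G → G → ℂˣ, ∀ a b c,
      η a b c * (h (a * b) c * h a b) = η' a b c * (h b c * h a (b * c)) := by
  refine (cohMk_eq_iff (A := Rep.trivial ℤ G (Additive ℂˣ)) _ _ η.d_eq_zero η'.d_eq_zero).trans ?_
  constructor
  · rintro ⟨h, hh⟩
    change (Fin 2 → G) → Additive ℂˣ at h
    refine ⟨fun a b => (h ![a, b]).toMul, fun a b c => ?_⟩
    have h1 := congrFun hh ![a, b, c]
    have h2 := h1.trans (congrArg (Additive.ofMul (η' a b c) + ·) (d_two_apply h ![a, b, c]))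
    apply Additive.ofMul.injective
    simp only [ofMul_mul]
    change Additive.ofMul (η a b c) = Additive.ofMul (η' a b c) + (h ![b, c] -
      h ![a * b, c] + h ![a, b * c] - h ![a, b]) at h2
    rw [h2]
    simp only [ofMul_toMul]
    abel
  · rintro ⟨h, hh⟩
    refine ⟨fun g => Additive.ofMul (h (g 0) (g 1)), funext fun g => ?_⟩
    refine Eq.trans ?_ (congrArg (Additive.ofMul (η' (g 0) (g 1) (g 2)) + ·) (d_two_apply
      (fun g : Fin 2 → G => Additive.ofMul (h (g 0) (g 1))) g).symm)
    have h1 := congrArg Additive.ofMul (hh (g 0) (g 1) (g 2))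
    simp only [ofMul_mul] at h1
    change Additive.ofMul (η (g 0) (g 1) (g 2)) = Additive.ofMul (η' (g 0) (g 1) (g 2)) +
      (Additive.ofMul (h (g 1) (g 2)) - Additive.ofMul (h (g 0 * g 1) (g 2)) +
        Additive.ofMul (h (g 0) (g 1 * g 2)) - Additive.ofMul (h (g 0) (g 1)))
    rw [← sub_eq_zero] at h1 ⊢
    rw [← h1]
    abel

/-- The pullback of a 3-cocycle along a homomorphism. -/
def Cocycle3.comap (φ : G →* H) (η : Cocycle3 H) : Cocycle3 G where
  toFun a b c := η (φ a) (φ b) (φ c)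
  cocycle a b c d := by simpa using η.cocycle (φ a) (φ b) (φ c) (φ d)

theorem Cocycle3.cls_comap (φ : G →* H) (η : Cocycle3 H) :
    (η.comap φ).cls = cohPullback (Additive ℂˣ) 3 φ η.cls := by
  obtain ⟨hf', h⟩ := cohPullback_cohMk (Additive ℂˣ) 3 φ _ η.d_eq_zero
  exact h.symm

/-- The product of two 3-cocycles. -/
instance : Mul (Cocycle3 G) where
  mul η η' := ⟨fun a b c => η a b c * η' a b c, fun a b c d => by
    have h := congrArg₂ (· * ·) (η.cocycle a b c d) (η'.cocycle a b c d)
    calc _ = _ := by ac_rfl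
      _ = _ := h
      _ = _ := by ac_rfl⟩

theorem Cocycle3.cls_mul (η η' : Cocycle3 G) : (η * η').cls = η.cls + η'.cls :=
  cohMk_add (A := Rep.trivial ℤ G (Additive ℂˣ)) _ _ η.d_eq_zero η'.d_eq_zero _

end Trivial

/-! ### The exponential sequence and the comparison of `H³(G, ℂ^*)` with `H⁴(G, ℤ)` -/

section ExponentialSequence

open groupCohomology

theorem rep_shortExact {k G : Type u} [CommRing k] [Group G] {X : ShortComplex (Rep.{u} k G)}
    (hf : Function.Injective X.f.hom) (hfg : ∀ y, X.g.hom y = 0 → ∃ x, X.f.hom x = y)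
    (hg : Function.Surjective X.g.hom) : X.ShortExact where
  exact := by
    rw [← ShortComplex.exact_map_iff_of_faithful X (forget₂ (Rep.{u} k G) (ModuleCat.{u} k)),
      ShortComplex.moduleCat_exact_iff]
    exact hfg
  mono_f := (Rep.mono_iff_injective X.f).2 hf
  epi_g := (Rep.epi_iff_surjective X.g).2 hg

theorem isZero_groupCohomology_of_retract {k G : Type u} [CommRing k] [Group G]
    {A B : Rep.{u} k G} (i : A ⟶ B) (p : B ⟶ A) (h : i ≫ p = 𝟙 A) (n : ℕ)
    (hB : IsZero (groupCohomology B n)) : IsZero (groupCohomology A n) := by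
  have h' : (functor k G n).map i ≫ (functor k G n).map p = 𝟙 _ := by
    rw [← Functor.map_comp, h, CategoryTheory.Functor.map_id]
  have h0 : (functor k G n).map i = 0 := IsZero.eq_zero_of_tgt hB _
  rw [IsZero.iff_id_eq_zero]
  refine h'.symm.trans ?_
  rw [h0, zero_comp]
  rfl

/-- The Shapiro lemma kills the cohomology of functions on the group. -/
theorem isZero_groupCohomology_coind_bot {k G : Type u} [CommRing k] [Group G]
    (A : Rep.{u} k (⊥ : Subgroup G)) (n : ℕ) :
    IsZero (groupCohomology (Rep.coind (⊥ : Subgroup G).subtype A) (n + 1)) :=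
  (isZero_groupCohomology_succ_of_subsingleton A n).of_iso (coindIso A (n + 1))

variable (G : Type) [Group G]

/-- The constant functions, as a map from `ℂ` to the functions on `G`. -/
noncomputable def constHom : Rep.trivial ℤ G ℂ ⟶
    Rep.coind (⊥ : Subgroup G).subtype (Rep.trivial ℤ (⊥ : Subgroup G) ℂ) :=
  Rep.ofHom
    { toFun := fun a => ⟨fun _ => a, fun _ _ => rfl⟩
      map_add' := fun _ _ => rfl
      map_smul' := fun _ _ => rfl
      isIntertwining' := fun _ => rfl }

/-- The average of a function on `G`. -/
noncomputable def averageHom [Finite G] :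
    Rep.coind (⊥ : Subgroup G).subtype (Rep.trivial ℤ (⊥ : Subgroup G) ℂ) ⟶
      Rep.trivial ℤ G ℂ :=
  Rep.ofHom
    { toFun := fun f => (Nat.card G : ℂ)⁻¹ * ∑ᶠ h, f.1 h
      map_add' := fun f g => by
        rw [← mul_add, ← finsum_add_distrib (Set.toFinite _) (Set.toFinite _)]
        rfl
      map_smul' := fun c f => by
        change (Nat.card G : ℂ)⁻¹ * ∑ᶠ h, c • f.1 h = c • ((Nat.card G : ℂ)⁻¹ * ∑ᶠ h, f.1 h)
        rw [← smul_finsum, mul_smul_comm]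
      isIntertwining' := fun g => by
        refine LinearMap.ext fun f => ?_
        change (Nat.card G : ℂ)⁻¹ * ∑ᶠ h, f.1 (h * g) = (Nat.card G : ℂ)⁻¹ * ∑ᶠ h, f.1 h
        exact congrArg _ (finsum_comp_equiv (f := fun h => f.1 h) (Equiv.mulRight g)) }

theorem constHom_averageHom [Finite G] : constHom G ≫ averageHom G = 𝟙 _ := by
  apply Rep.hom_ext
  refine Representation.IntertwiningMap.ext (LinearMap.ext fun a => ?_)
  change (Nat.card G : ℂ)⁻¹ * ∑ᶠ _ : G, a = a
  have := Fintype.ofFinite G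
  rw [finsum_eq_sum_of_fintype, Finset.sum_const, Finset.card_univ, ← Nat.card_eq_fintype_card,
    nsmul_eq_mul, inv_mul_cancel_left₀]
  exact_mod_cast Nat.card_pos.ne'

/-- Constants and averages make `ℂ` a retract of the functions on `G`, since the order of `G` is
invertible in `ℂ`; the latter form a coinduced module without cohomology in positive degrees. -/
theorem isZero_groupCohomology_complex [Finite G] (n : ℕ) :
    IsZero (groupCohomology (Rep.trivial ℤ G ℂ) (n + 1)) :=
  isZero_groupCohomology_of_retract _ _ (constHom_averageHom G) _
    (isZero_groupCohomology_coind_bot _ n)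

/-- The map `z ↦ exp(2πiz)`. -/
noncomputable def expUnit (z : ℂ) : ℂˣ :=
  Units.mk0 (Complex.exp (2 * Real.pi * Complex.I * z)) (Complex.exp_ne_zero _)

theorem expUnit_add (z w : ℂ) : expUnit (z + w) = expUnit z * expUnit w := by
  ext
  simp [expUnit, mul_add, Complex.exp_add]

theorem expUnit_eq_one_iff {z : ℂ} : expUnit z = 1 ↔ ∃ n : ℤ, z = n := by
  have h2 : (2 * Real.pi * Complex.I : ℂ) ≠ 0 := Complex.two_pi_I_ne_zero
  rw [← Units.val_inj]
  change Complex.exp _ = 1 ↔ _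
  rw [Complex.exp_eq_one_iff]
  refine exists_congr fun n => ?_
  rw [mul_comm]
  exact mul_left_inj' h2

theorem expUnit_surjective : Function.Surjective expUnit := by
  intro u
  refine ⟨Complex.log u / (2 * Real.pi * Complex.I), ?_⟩
  ext
  change Complex.exp _ = _
  rw [mul_div_cancel₀ _ Complex.two_pi_I_ne_zero, Complex.exp_log u.ne_zero]

/-- The additive homomorphism `z ↦ exp(2πiz)`. -/
noncomputable def expHom : ℂ →+ Additive ℂˣ where
  toFun z := Additive.ofMul (expUnit z)
  map_zero' := congrArg Additive.ofMul (expUnit_eq_one_iff.2 ⟨0, by simp⟩)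
  map_add' z w := congrArg Additive.ofMul (expUnit_add z w)

/-- A homomorphism of abelian groups as a map of trivial representations. -/
noncomputable def trivialHom {A B : Type} [AddCommGroup A] [AddCommGroup B] (f : A →+ B) :
    Rep.trivial ℤ G A ⟶ Rep.trivial ℤ G B :=
  Rep.ofHom ⟨f.toIntLinearMap, fun _ => rfl⟩

/-- The exponential sequence `ℤ → ℂ → ℂ^*`. -/
noncomputable def expSequence : ShortComplex (Rep ℤ G) where
  X₁ := Rep.trivial ℤ G ℤ
  X₂ := Rep.trivial ℤ G ℂ
  X₃ := Rep.trivial ℤ G (Additive ℂˣ)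
  f := trivialHom G (Int.castAddHom ℂ)
  g := trivialHom G expHom
  zero := by
    apply Rep.hom_ext
    refine Representation.IntertwiningMap.ext (LinearMap.ext fun a => ?_)
    exact congrArg Additive.ofMul (expUnit_eq_one_iff.2 ⟨a, rfl⟩)

theorem expSequence_shortExact : (expSequence G).ShortExact := by
  refine rep_shortExact ?_ ?_ ?_
  · exact fun a b h => Int.cast_injective (α := ℂ) h
  · intro z hz
    obtain ⟨n, hn⟩ := expUnit_eq_one_iff.1 (congrArg Additive.toMul hz)
    exact ⟨n, hn.symm⟩
  · intro u
    obtain ⟨z, hz⟩ := expUnit_surjective u.toMul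
    exact ⟨z, congrArg Additive.ofMul hz⟩

/-- The connecting homomorphism `H³(G, ℂ^*) → H⁴(G, ℤ)`, on cocycles. -/
theorem δ_expSequence_cohMk (f : (Fin 3 → G) → Additive ℂˣ)
    (hf : inhomogeneousCochains.d (Rep.trivial ℤ G (Additive ℂˣ)) 3 f = 0)
    (y : (Fin 3 → G) → ℂ) (hy : ∀ g, expHom (y g) = f g) (x : (Fin 4 → G) → ℤ)
    (hx : ∀ g, (x g : ℂ) = inhomogeneousCochains.d (Rep.trivial ℤ G ℂ) 3 y g)
    (hx' : inhomogeneousCochains.d (Rep.trivial ℤ G ℤ) 4 x = 0) :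
    δ (expSequence_shortExact G) 3 4 rfl (cohMk (Rep.trivial ℤ G (Additive ℂˣ)) f hf) =
      cohMk (Rep.trivial ℤ G ℤ) x hx' := by
  have h := δ_apply (expSequence_shortExact G) (i := 3) (j := 4) rfl f
    (by rw [inhomogeneousCochains.d_def]; exact hf) y (funext hy) x
    (by rw [inhomogeneousCochains.d_def]; exact funext hx)
  exact h

/-- The connecting map lifts a cocycle through the exponential and takes the coboundary. The lift
`y` and its integral coboundary `x` may both be precomposed with `φ`, which gives valid choices for
the pulled back class. -/
theorem δ_expSequence_natural (φ : G ≃* G) (c : H3 G) :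
    δ (expSequence_shortExact G) 3 4 rfl (cohPullback (Additive ℂˣ) 3 φ.toMonoidHom c) =
      cohPullback ℤ 4 φ.toMonoidHom (δ (expSequence_shortExact G) 3 4 rfl c) := by
  obtain ⟨f, hf, rfl⟩ := exists_cohMk c
  change (Fin 3 → G) → Additive ℂˣ at f
  choose y hy using fun g => expUnit_surjective (f g).toMul
  have hy' : ∀ g, expHom (y g) = f g := fun g => congrArg Additive.ofMul (hy g)
  -- The exponential of the coboundary of `y` is the coboundary of `f`, which is trivial; hence the
  -- coboundary of `y` takes integral values.
  have hexp : ∀ g, expHom (inhomogeneousCochains.d (Rep.trivial ℤ G ℂ) 3 y g) = 0 := by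
    intro g
    have h1 := congrFun hf g
    refine Eq.trans ?_ ((d_three_apply f g).symm.trans h1)
    refine (congrArg expHom (d_three_apply y g)).trans ?_
    simp only [map_add, map_sub, hy']
  choose x hx using fun g => expUnit_eq_one_iff.1 (congrArg Additive.toMul (hexp g))
  -- After the injection `ℤ → ℂ` the cochain `x` is a coboundary, hence a cocycle.
  have hx' : inhomogeneousCochains.d (Rep.trivial ℤ G ℤ) 4 x = 0 := by
    have h1 : inhomogeneousCochains.d (Rep.trivial ℤ G ℂ) 4
        (inhomogeneousCochains.d (Rep.trivial ℤ G ℂ) 3 y) = 0 :=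
      congrArg (fun m => m.hom y)
        (inhomogeneousCochains.d_comp_d (A := Rep.trivial ℤ G ℂ) (n := 3))
    refine funext fun g => Int.cast_injective (α := ℂ) ?_
    have h3 : inhomogeneousCochains.d (Rep.trivial ℤ G ℂ) 4 (fun g => (x g : ℂ)) = 0 := by
      rw [← h1]
      congr 1
      exact funext fun g => (hx g).symm
    refine Eq.trans ?_ ((congrFun h3 g).trans Int.cast_zero.symm)
    have h4 := (cochainsMap (A := Rep.trivial ℤ G ℤ) (B := Rep.trivial ℤ G ℂ) (MonoidHom.id G)
      (trivialHom G (Int.castAddHom ℂ))).comm 4 5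
    rw [inhomogeneousCochains.d_def, inhomogeneousCochains.d_def] at h4
    exact (congrFun (congrArg (fun m => m.hom x) h4) g).symm
  obtain ⟨hf1, h1⟩ := cohPullback_cohMk (Additive ℂˣ) 3 φ.toMonoidHom f hf
  obtain ⟨hx1, h2⟩ := cohPullback_cohMk ℤ 4 φ.toMonoidHom x hx'
  have h3 := δ_expSequence_cohMk G f hf y hy' x (fun g => (hx g).symm) hx'
  refine (congrArg _ h1).trans (Eq.trans ?_ (congrArg (cohPullback ℤ 4 φ.toMonoidHom) h3.symm))
  refine Eq.trans ?_ h2.symm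
  refine δ_expSequence_cohMk G _ hf1 (fun g => y (fun i => φ (g i))) (fun g => hy' _) _
    (fun g => ?_) hx1
  refine ((hx _).symm).trans ?_
  have h4 := (cochainsMap φ.toMonoidHom (Rep.ofHom ⟨LinearMap.id, fun _ => rfl⟩ :
    Rep.res φ.toMonoidHom (Rep.trivial ℤ G ℂ) ⟶ Rep.trivial ℤ G ℂ)).comm 3 4
  rw [inhomogeneousCochains.d_def] at h4
  exact (congrFun (congrArg (fun m => m.hom y) h4) g).symm

/-- In the long exact sequence the connecting map lies between `H³(G, ℂ)` and `H⁴(G, ℂ)`, which both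
vanish. -/
theorem exists_H3_equiv_H4 [Finite G] : ∃ e : H3 G ≃+ H4 G, ∀ (φ : G ≃* G) (c : H3 G),
    e (cohPullback (Additive ℂˣ) 3 φ.toMonoidHom c) = cohPullback ℤ 4 φ.toMonoidHom (e c) := by
  have : IsIso (δ (expSequence_shortExact G) 3 4 rfl) :=
    isIso_δ_of_isZero _ 3 (isZero_groupCohomology_complex G 2)
      (isZero_groupCohomology_complex G 3)
  exact ⟨(asIso (δ (expSequence_shortExact G) 3 4 rfl)).toLinearEquiv.toAddEquiv,
    δ_expSequence_natural G⟩

end ExponentialSequence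

/-! ### Counting in exact sequences; coinduction from a subgroup of index two -/

section IndexTwo

open groupCohomology

/-- The type is finite with at most `n` elements. -/
def CardLE (X : Type*) (n : ℕ) : Prop := Finite X ∧ Nat.card X ≤ n

theorem CardLE.of_injective {X Y : Type*} {n : ℕ} (f : X → Y) (hf : Function.Injective f)
    (h : CardLE Y n) : CardLE X n := by
  have := h.1
  exact ⟨Finite.of_injective f hf, (Nat.card_le_card_of_injective f hf).trans h.2⟩

theorem CardLE.of_surjective {X Y : Type*} {n : ℕ} (f : X → Y) (hf : Function.Surjective f)
    (h : CardLE X n) : CardLE Y n := by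
  have := h.1
  exact ⟨Finite.of_surjective f hf, (Nat.card_le_card_of_surjective f hf).trans h.2⟩

/-- The order of `Y` is the product of those of the images of `f` and `g`, and the image of `f` has
the order of `X` divided by that of the kernel. A lower bound `k` for the kernel therefore improves
the estimate. -/
theorem cardLE_of_exact {X Y Z : Type*} [AddCommGroup X] [AddCommGroup Y] [AddCommGroup Z]
    (f : X →+ Y) (g : Y →+ Z) (hfg : ∀ y, g y = 0 → ∃ x, f x = y) {a b k : ℕ}
    (hX : CardLE X (k * a)) (hk : k ≤ Nat.card f.ker) (hk0 : 0 < k) (hZ : CardLE Z b) :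
    CardLE Y (a * b) := by
  have := hX.1
  have := hZ.1
  have hr : Nat.card f.range ≤ a := by
    have h1 := AddSubgroup.card_eq_card_quotient_mul_card_addSubgroup f.ker
    rw [Nat.card_congr (QuotientAddGroup.quotientKerEquivRange f).toEquiv] at h1
    have h2 : k * Nat.card f.range ≤ k * a := by
      calc k * Nat.card f.range ≤ Nat.card f.ker * Nat.card f.range :=
            Nat.mul_le_mul_right _ hk
        _ = Nat.card X := by rw [h1, mul_comm]
        _ ≤ k * a := hX.2
    exact Nat.le_of_mul_le_mul_left h2 hk0
  choose s hs using fun z : g.range => z.2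
  have hmem : ∀ y, y - s ⟨g y, y, rfl⟩ ∈ f.range := fun y => by
    obtain ⟨x, hx⟩ := hfg (y - s ⟨g y, y, rfl⟩) (by rw [map_sub, hs, sub_self])
    exact ⟨x, hx⟩
  refine CardLE.of_injective (Y := f.range × g.range)
    (fun y => (⟨_, hmem y⟩, ⟨g y, y, rfl⟩)) (fun y y' h => ?_) ⟨?_, ?_⟩
  · rw [Prod.mk.injEq, Subtype.mk.injEq] at h
    obtain ⟨h1, h2⟩ := h
    rwa [h2, sub_left_inj] at h1
  · have : Finite f.range := Finite.of_surjective _ f.rangeRestrict_surjective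
    have : Finite g.range := Finite.of_injective _ Subtype.val_injective
    infer_instance
  · rw [Nat.card_prod]
    exact Nat.mul_le_mul hr ((Nat.card_le_card_of_injective _ Subtype.val_injective).trans hZ.2)

/-- Isomorphic groups have isomorphic cohomology. -/
noncomputable def cohEquiv {G H : Type} [Group G] [Group H] (A : Type) [AddCommGroup A] (n : ℕ)
    (φ : G ≃* H) : Coh H A n ≃+ Coh G A n where
  toFun := cohPullback A n φ.toMonoidHom
  invFun := cohPullback A n φ.symm.toMonoidHom
  left_inv c := by
    rw [← cohPullback_comp]
    convert cohPullback_id A n c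
    ext x
    simp
  right_inv c := by
    rw [← cohPullback_comp]
    convert cohPullback_id A n c
    ext x
    simp
  map_add' := map_add _

variable {G : Type} [Group G] {A : Type} [AddCommGroup A]

/-- For a subgroup `N` of index 2, a representation `X₁` on `A` on which `N` acts trivially and
its complement by `ε = ±1`, and a representation `X₃` on which the complement acts by `-ε`: the
exact sequence `X₁ → Coind_N^G A → X₃`. -/
noncomputable def indexTwoSequence (N : Subgroup G) (t : G) (hN : N.index = 2) (ht : t ∉ N)
    (ε : ℤ) (hε : ε * ε = 1) (ρ₁ ρ₃ : Representation ℤ G A)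
    (h₁ : ∀ g ∈ N, ∀ a, ρ₁ g a = a) (h₁' : ∀ g ∉ N, ∀ a, ρ₁ g a = ε • a)
    (h₃ : ∀ g ∈ N, ∀ a, ρ₃ g a = a) (h₃' : ∀ g ∉ N, ∀ a, ρ₃ g a = -(ε • a)) :
    ShortComplex (Rep ℤ G) where
  X₁ := Rep.of ρ₁
  X₂ := Rep.coind N.subtype (Rep.trivial ℤ N A)
  X₃ := Rep.of ρ₃
  f := Rep.ofHom
    { toFun := fun a => ⟨fun h => ρ₁ h a, fun n h => by
        change ρ₁ (n * h) a = ρ₁ h a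
        rw [map_mul]
        exact h₁ n n.2 _⟩
      map_add' := fun a b => Subtype.ext (funext fun h => map_add (ρ₁ h) a b)
      map_smul' := fun c a => Subtype.ext (funext fun h => map_smul (ρ₁ h) c a)
      isIntertwining' := fun g => LinearMap.ext fun a => Subtype.ext (funext fun h => by
        change ρ₁ h (ρ₁ g a) = ρ₁ (h * g) a
        rw [map_mul]
        rfl) }
  g := Rep.ofHom
    { toFun := fun F => F.1 1 - ε • F.1 t
      map_add' := fun F F' => by
        change F.1 1 + F'.1 1 - ε • (F.1 t + F'.1 t) = _
        rw [smul_add]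
        abel
      map_smul' := fun c F => by
        change c • F.1 1 - ε • (c • F.1 t) = c • (F.1 1 - ε • F.1 t)
        rw [smul_sub, smul_comm]
      isIntertwining' := fun g => LinearMap.ext fun F => by
        change F.1 (1 * g) - ε • F.1 (t * g) = ρ₃ g (F.1 1 - ε • F.1 t)
        have hmul := fun x y => Subgroup.mul_mem_iff_of_index_two hN (a := x) (b := y)
        have hF : ∀ n ∈ N, ∀ h, F.1 (n * h) = F.1 h := fun n hn h => F.2 ⟨n, hn⟩ h
        rw [one_mul]
        by_cases hg : g ∈ N
        · have e1 : F.1 g = F.1 1 := by simpa using hF g hg 1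
          have htg : t * g * t⁻¹ ∈ N := by simp [hmul, hg, ht]
          have e2 : F.1 (t * g) = F.1 t := by simpa using hF _ htg t
          rw [e1, e2, h₃ g hg]
        · have e2 : F.1 (t * g) = F.1 1 := by
            simpa using hF (t * g) (by simp [hmul, hg, ht]) 1
          have e1 : F.1 g = F.1 t := by
            have h1 : g * t⁻¹ ∈ N := by simp [hmul, hg, ht]
            simpa using hF _ h1 t
          rw [e1, e2, h₃' g hg, smul_sub, smul_smul, hε, one_smul]
          abel }
  zero := by
    apply Rep.hom_ext
    refine Representation.IntertwiningMap.ext (LinearMap.ext fun a => ?_)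
    change ρ₁ 1 a - ε • ρ₁ t a = 0
    rw [h₁' t ht, smul_smul, hε, one_smul, map_one]
    exact sub_self a

-- An element of the coinduced module is constant on the cosets `N` and `N t`, so it is a pair of
-- values at `1` and `t`. The condition `F 1 = ε F t` singles out the functions coming from `ρ₁`,
-- and functions supported on `N` show surjectivity.
open Classical in
theorem indexTwoSequence_shortExact (N : Subgroup G) (t : G) (hN : N.index = 2) (ht : t ∉ N)
    (ε : ℤ) (hε : ε * ε = 1) (ρ₁ ρ₃ : Representation ℤ G A)
    (h₁ : ∀ g ∈ N, ∀ a, ρ₁ g a = a) (h₁' : ∀ g ∉ N, ∀ a, ρ₁ g a = ε • a)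
    (h₃ : ∀ g ∈ N, ∀ a, ρ₃ g a = a) (h₃' : ∀ g ∉ N, ∀ a, ρ₃ g a = -(ε • a)) :
    (indexTwoSequence N t hN ht ε hε ρ₁ ρ₃ h₁ h₁' h₃ h₃').ShortExact := by
  refine rep_shortExact ?_ ?_ ?_
  · intro a b hab
    have h := congrFun (congrArg Subtype.val hab) 1
    change ρ₁ 1 a = ρ₁ 1 b at h
    rwa [map_one] at h
  · intro F hF
    change F.1 1 - ε • F.1 t = 0 at hF
    rw [sub_eq_zero] at hF
    refine ⟨F.1 1, Subtype.ext (funext fun g => ?_)⟩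
    change ρ₁ g (F.1 1) = F.1 g
    have hF' : ∀ n ∈ N, ∀ h, F.1 (n * h) = F.1 h := fun n hn h => F.2 ⟨n, hn⟩ h
    by_cases hg : g ∈ N
    · rw [h₁ g hg]
      simpa using (hF' g hg 1).symm
    · rw [h₁' g hg, hF, smul_smul, hε, one_smul]
      have hmul := fun x y => Subgroup.mul_mem_iff_of_index_two hN (a := x) (b := y)
      simpa using (hF' (g * t⁻¹) (by simp [hmul, hg, ht]) t).symm
  · intro a
    refine ⟨⟨fun h => if h ∈ N then a else 0, fun n h => ?_⟩, ?_⟩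
    · change (if (n : G) * h ∈ N then a else 0) = if h ∈ N then a else 0
      rw [N.mul_mem_cancel_left n.2]
    · change (if (1 : G) ∈ N then a else 0) - ε • (if t ∈ N then a else 0) = a
      rw [if_pos N.one_mem, if_neg ht, smul_zero, sub_zero]

end IndexTwo

/-! ### Bounds for `H²` and `H³` from a subgroup of index two -/

section IndexTwoBounds

open groupCohomology

variable {G : Type} [Group G] (A : Type) [AddCommGroup A]

open Classical in
/-- The sign representation on `A` of a group with a subgroup of index 2. -/
noncomputable def signRep (N : Subgroup G) (hN : N.index = 2) : Representation ℤ G A where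
  toFun g := if g ∈ N then LinearMap.id else -LinearMap.id
  map_one' := if_pos N.one_mem
  map_mul' x y := by
    rw [Subgroup.mul_mem_iff_of_index_two hN]
    refine LinearMap.ext fun a => ?_
    by_cases hx : x ∈ N <;> by_cases hy : y ∈ N <;> simp [hx, hy]

theorem signRep_of_mem {N : Subgroup G} (hN : N.index = 2) {g : G} (hg : g ∈ N) (a : A) :
    signRep A N hN g a = a := by
  simp [signRep, hg]

theorem signRep_of_notMem {N : Subgroup G} (hN : N.index = 2) {g : G} (hg : g ∉ N) (a : A) :
    signRep A N hN g a = -a := by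
  simp [signRep, hg]

/-- The case `ε = 1`: `A` embeds as the constant functions, with the sign module as quotient. -/
theorem signSequence_shortExact {N : Subgroup G} (hN : N.index = 2) {t : G} (ht : t ∉ N) :
    (indexTwoSequence N t hN ht 1 (by norm_num) (Representation.trivial ℤ G A) (signRep A N hN)
      (fun _ _ _ => rfl) (fun _ _ _ => (one_smul _ _).symm)
      (fun _ hg => signRep_of_mem A hN hg)
      (fun _ hg a => by rw [signRep_of_notMem A hN hg, one_smul])).ShortExact :=
  indexTwoSequence_shortExact ..

/-- The case `ε = -1`: the sign module embeds, and the quotient map adds the values on the two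
cosets, so that it induces the transfer in cohomology. -/
theorem sumSequence_shortExact {N : Subgroup G} (hN : N.index = 2) {t : G} (ht : t ∉ N) :
    (indexTwoSequence N t hN ht (-1) (by norm_num) (signRep A N hN)
      (Representation.trivial ℤ G A) (fun _ hg => signRep_of_mem A hN hg)
      (fun _ hg a => by rw [signRep_of_notMem A hN hg, neg_one_smul])
      (fun _ _ _ => rfl)
      (fun _ _ a => by rw [neg_one_smul, neg_neg]; rfl)).ShortExact :=
  indexTwoSequence_shortExact ..

variable {A}

theorem cardLE_coind {N : Subgroup G} {n b : ℕ} (h : CardLE (Coh N A n) b) :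
    CardLE (groupCohomology (Rep.coind N.subtype (Rep.trivial ℤ N A)) n) b :=
  h.of_injective (coindIso (Rep.trivial ℤ N A) n).toLinearEquiv
    (coindIso (Rep.trivial ℤ N A) n).toLinearEquiv.injective

theorem cardLE_of_shortExact {X : ShortComplex (Rep ℤ G)} (hX : X.ShortExact) {i j : ℕ}
    (hij : i + 1 = j) {a b k : ℕ} (h₃ : CardLE (groupCohomology X.X₃ i) (k * a))
    (hk : k ≤ Nat.card (δ hX i j hij).hom.toAddMonoidHom.ker) (hk0 : 0 < k)
    (h₂ : CardLE (groupCohomology X.X₂ j) b) : CardLE (groupCohomology X.X₁ j) (a * b) := by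
  refine cardLE_of_exact (δ hX i j hij).hom.toAddMonoidHom
    (groupCohomology.map (MonoidHom.id G) X.f j).hom.toAddMonoidHom ?_ h₃ hk hk0 h₂
  have h := mapShortComplex₁_exact hX hij
  rw [ShortComplex.moduleCat_exact_iff] at h
  exact h

theorem one_le_card_ker {X Y : Type} [AddCommGroup X] [AddCommGroup Y] (f : X →+ Y) {n : ℕ}
    (h : CardLE X n) : 1 ≤ Nat.card f.ker := by
  have := h.1
  exact Nat.card_pos

theorem CardLE.one_mul {X : Type*} {n : ℕ} (h : CardLE X n) : CardLE X (1 * n) := by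
  rwa [_root_.one_mul]

/-- The segment `H¹(G, A) → H²(G, A_sgn) → H²(N, A)` of the sum sequence, with the Shapiro lemma for
its last term. -/
theorem cardLE_H2_sign {N : Subgroup G} (hN : N.index = 2) {t : G} (ht : t ∉ N) {b c k : ℕ}
    (h2 : CardLE (Coh N A 2) b) (h1 : CardLE (Coh G A 1) (k * c))
    (hk : k ≤ Nat.card (δ (sumSequence_shortExact A hN ht) 1 2 rfl).hom.toAddMonoidHom.ker)
    (hk0 : 0 < k) :
    CardLE (groupCohomology (Rep.of (signRep A N hN)) 2) (c * b) :=
  cardLE_of_shortExact (sumSequence_shortExact A hN ht) rfl h1 hk hk0 (cardLE_coind h2)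

/-- The segment `H²(G, A_sgn) → H³(G, A) → H³(N, A)` of the sign sequence. -/
theorem cardLE_H3_of_sign {N : Subgroup G} (hN : N.index = 2) {t : G} (ht : t ∉ N) {a b : ℕ}
    (h3 : CardLE (Coh N A 3) a) (h2 : CardLE (groupCohomology (Rep.of (signRep A N hN)) 2) b) :
    CardLE (Coh G A 3) (b * a) := by
  exact cardLE_of_shortExact (signSequence_shortExact A hN ht) rfl (k := 1)
    h2.one_mul (one_le_card_ker _ h2) one_pos (cardLE_coind h3)

/-- The bound for a subgroup of index 2. -/
theorem cardLE_H3 {N : Subgroup G} (hN : N.index = 2) {a b c : ℕ}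
    (h3 : CardLE (Coh N A 3) a) (h2 : CardLE (Coh N A 2) b) (h1 : CardLE (Coh G A 1) c) :
    CardLE (Coh G A 3) (c * b * a) := by
  obtain ⟨t, ht⟩ : ∃ t, t ∉ N := by
    by_contra! h
    rw [(Subgroup.eq_top_iff' N).2 h] at hN
    simp at hN
  exact cardLE_H3_of_sign hN ht h3 (cardLE_H2_sign hN ht (k := 1) h2
    h1.one_mul (one_le_card_ker _ h1) one_pos)

/-- The homomorphism `V` that is the transfer of `λ : N → A` is in the image of
`H¹(G, Coind) → H¹(G, A)`. Here `L` extends `λ`, with `L (n * x) = L n + L x` for `n ∈ N`. -/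
theorem two_le_card_ker_of_transfer {N : Subgroup G} (hN : N.index = 2) {t : G} (ht : t ∉ N)
    [Finite (Coh G A 1)] (L : G → A) (hL : ∀ n ∈ N, ∀ x, L (n * x) = L n + L x)
    (ht2 : L (t * t) ≠ 0) :
    2 ≤ Nat.card (δ (sumSequence_shortExact A hN ht) 1 2 rfl).hom.toAddMonoidHom.ker := by
  have hmul := fun x y => Subgroup.mul_mem_iff_of_index_two hN (a := x) (b := y)
  have hL1 : L 1 = 0 := by simpa using hL 1 N.one_mem 1
  -- The sum over the coset representatives `1` and `t` of the increments of `L` under right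
  -- translation by `g`; this is the transfer of `λ`, and its value at `t` is `L (t * t)`.
  let V : G → A := fun g => L g - L 1 + (L (t * g) - L t)
  have hV : ∀ x y, V (x * y) = V x + V y := by
    intro x y
    by_cases hx : x ∈ N
    · have h1 : L (t * (x * y)) = L (t * x * t⁻¹) + L (t * y) := by
        rw [← hL _ (by simp [hmul, hx, ht])]; congr 1; group
      have h2 : L (t * x) = L (t * x * t⁻¹) + L t := by
        rw [← hL _ (by simp [hmul, hx, ht])]; congr 1; group
      simp only [V, h1, h2, hL x hx, hL1]
      abel
    · have h1 : L (t * (x * y)) = L (t * x) + L y := by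
        rw [← hL _ (by simp [hmul, hx, ht])]; congr 1; group
      have h2 : L (x * y) = L (x * t⁻¹) + L (t * y) := by
        rw [← hL _ (by simp [hmul, hx, ht])]; congr 1; group
      have h3 : L x = L (x * t⁻¹) + L t := by
        rw [← hL _ (by simp [hmul, hx, ht])]; congr 1; group
      simp only [V, h1, h2, h3, hL1]
      abel
  let z : cocycles₁ (Rep.trivial ℤ G A) := ⟨V, (mem_cocycles₁_iff _).2 fun x y => by
    change V (x * y) = V y + V x
    rw [hV, add_comm]⟩
  have hz : H1π _ z ≠ 0 := by
    rw [Ne, H1π_eq_zero_iff, coboundaries₁_eq_bot_of_isTrivial]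
    intro h0
    refine ht2 ?_
    have h1 : V t = 0 := congrFun ((Submodule.mem_bot ℤ).1 h0) t
    simpa [V, hL1] using h1
  -- A lift of `V` to the coinduced module. It is the coboundary of `L` among all functions on `G`,
  -- hence a cocycle, although `L` itself need not be invariant under `N`. So the connecting map
  -- kills `V`.
  let y : G → Rep.coind N.subtype (Rep.trivial ℤ N A) := fun g =>
    ⟨fun h => L (h * g) - L h, fun n h => by
      change L (n * h * g) - L (n * h) = L (h * g) - L h
      rw [mul_assoc, hL n n.2, hL n n.2]
      abel⟩
  have hδ : δ (sumSequence_shortExact A hN ht) 1 2 rfl (H1π _ z) = 0 := by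
    refine (δ₁_apply (sumSequence_shortExact A hN ht) z y (funext fun g => ?_) 0
      (funext fun g => Subtype.ext (funext fun h => ?_))).trans ?_
    · change L (1 * g) - L 1 - (-1 : ℤ) • (L (t * g) - L t) = V g
      rw [one_mul, neg_one_smul, sub_neg_eq_add]
    · change (signRep A N hN) h 0 = (L (h * g.1 * g.2) - L (h * g.1)) -
        (L (h * (g.1 * g.2)) - L h) + (L (h * g.1) - L h)
      rw [map_zero, mul_assoc]
      abel
    · exact map_zero (H2π _).hom
  have : Finite (groupCohomology (Rep.of (Representation.trivial ℤ G A)) 1) :=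
    inferInstanceAs (Finite (Coh G A 1))
  have hfin : Finite (δ (sumSequence_shortExact A hN ht) 1 2 rfl).hom.toAddMonoidHom.ker :=
    Finite.of_injective (β := Coh G A 1) _ Subtype.val_injective
  have : Nontrivial (δ (sumSequence_shortExact A hN ht) 1 2 rfl).hom.toAddMonoidHom.ker :=
    ⟨⟨⟨H1π _ z, hδ⟩, 0, fun h => hz (congrArg Subtype.val h)⟩⟩
  exact Finite.one_lt_card

/-- The refined bound, when some character `λ` of `N` has a nontrivial transfer. -/
theorem cardLE_H3_of_transfer {N : Subgroup G} (hN : N.index = 2) {t : G} (ht : t ∉ N) {a b c : ℕ}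
    (h3 : CardLE (Coh N A 3) a) (h2 : CardLE (Coh N A 2) b) (h1 : CardLE (Coh G A 1) (2 * c))
    (L : G → A) (hL : ∀ n ∈ N, ∀ x, L (n * x) = L n + L x) (ht2 : L (t * t) ≠ 0) :
    CardLE (Coh G A 3) (c * b * a) := by
  have := h1.1
  exact cardLE_H3_of_sign hN ht h3 (cardLE_H2_sign hN ht h2 h1
    (two_le_card_ker_of_transfer hN ht L hL ht2) two_pos)

theorem cardLE_H2_of_sign {N : Subgroup G} (hN : N.index = 2) {a b : ℕ}
    (h2 : CardLE (Coh N A 2) a) (h1 : CardLE (groupCohomology (Rep.of (signRep A N hN)) 1) b) :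
    CardLE (Coh G A 2) (b * a) := by
  obtain ⟨t, ht⟩ : ∃ t, t ∉ N := by
    by_contra! h
    rw [(Subgroup.eq_top_iff' N).2 h] at hN
    simp at hN
  exact cardLE_of_shortExact (signSequence_shortExact A hN ht) rfl (k := 1)
    h1.one_mul (one_le_card_ker _ h1) one_pos (cardLE_coind h2)

end IndexTwoBounds

/-! ### Upper bounds for the groups that occur -/

section SmallGroupBounds

open groupCohomology

theorem exists_pow_eq_unit (n : ℕ) (hn : n ≠ 0) (a : ℂˣ) : ∃ b : ℂˣ, b ^ n = a := by
  obtain ⟨b, hb⟩ := IsAlgClosed.exists_pow_nat_eq (a : ℂ) (Nat.pos_of_ne_zero hn)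
  have hb0 : b ≠ 0 := by
    rintro rfl
    rw [zero_pow hn] at hb
    exact a.ne_zero hb.symm
  exact ⟨Units.mk0 b hb0, Units.ext hb⟩

theorem cardLE_rootsOfUnity (n : ℕ) [NeZero n] : CardLE (rootsOfUnity n ℂ) n :=
  ⟨inferInstance, card_rootsOfUnity ℂ n⟩

section Cyclic

variable {G : Type} [CommGroup G] [Fintype G] (g : G) (hg : ∀ x, x ∈ Subgroup.zpowers g)

theorem norm_trivial_apply (A : Type) [AddCommGroup A] (a : A) :
    (Rep.trivial ℤ G A).norm.hom a = Fintype.card G • a := by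
  change (∑ _ : G, (LinearMap.id : A →ₗ[ℤ] A)) a = _
  simp

include hg

/-- For a cyclic group `H²` is invariants modulo norms. On `ℂ^*` with trivial action the norm is the
power map with exponent the group order, which is surjective. -/
theorem cardLE_H2_cyclic : CardLE (Coh G (Additive ℂˣ) 2) 1 := by
  have hπ : Function.Surjective (Rep.FiniteCyclicGroup.groupCohomologyπEven
      (Rep.trivial ℤ G (Additive ℂˣ)) g hg 2 even_two) :=
    (ModuleCat.epi_iff_surjective _).1
      (epi_comp' (@IsIso.epi_of_iso _ _ _ _ _ (Iso.isIso_inv _)) (epi_comp' inferInstance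
        (@IsIso.epi_of_iso _ _ _ _ _ (Iso.isIso_inv _))))
  have h0 : ∀ c : Coh G (Additive ℂˣ) 2, c = 0 := by
    intro c
    obtain ⟨x, rfl⟩ := hπ c
    rw [Rep.FiniteCyclicGroup.groupCohomologyπEven_eq_zero_iff]
    obtain ⟨b, hb⟩ := exists_pow_eq_unit (Fintype.card G) Fintype.card_ne_zero
      (Additive.toMul x.1)
    refine ⟨Additive.ofMul b, ?_⟩
    exact (norm_trivial_apply _ _).trans (congrArg Additive.ofMul hb)
  have : Subsingleton (Coh G (Additive ℂˣ) 2) := ⟨fun a b => (h0 a).trans (h0 b).symm⟩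
  exact ⟨inferInstance, by rw [Nat.card_of_subsingleton (0 : Coh G (Additive ℂˣ) 2)]⟩

/-- Odd cohomology of a cyclic group is a quotient of the kernel of the norm, here a group of roots
of unity. -/
theorem cardLE_H3_cyclic : CardLE (H3 G) (Fintype.card G) := by
  have hπ : Function.Surjective (Rep.FiniteCyclicGroup.groupCohomologyπOdd
      (Rep.trivial ℤ G (Additive ℂˣ)) g hg 3 (by decide)) :=
    (ModuleCat.epi_iff_surjective _).1
      (epi_comp' (@IsIso.epi_of_iso _ _ _ _ _ (Iso.isIso_inv _)) (epi_comp' inferInstance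
        (@IsIso.epi_of_iso _ _ _ _ _ (Iso.isIso_inv _))))
  refine CardLE.of_surjective _ hπ ((cardLE_rootsOfUnity (Fintype.card G)).of_injective
    (fun x => ⟨Additive.toMul (α := ℂˣ) x.1, congrArg Additive.toMul
      ((norm_trivial_apply (Additive ℂˣ) _).symm.trans x.2)⟩) ?_)
  intro x y h
  have h' := Subtype.ext_iff.1 h
  exact Subtype.ext (Additive.toMul.injective h')

end Cyclic

/-- A bound on `H¹(G, ℂ^*) = Hom(G, ℂ^*)` from generators and their orders in the
abelianization. -/
theorem cardLE_H1 {G : Type} [Group G] {k : ℕ} (s : Fin k → G) (n : Fin k → ℕ)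
    (hn : ∀ i, n i ≠ 0) (hs : Subgroup.closure (Set.range s) = ⊤)
    (hns : ∀ (f : G →* ℂˣ) i, f (s i) ^ n i = 1) :
    CardLE (Coh G (Additive ℂˣ) 1) (∏ i, n i) := by
  have := fun i => NeZero.mk (hn i)
  have h1 : CardLE (∀ i, rootsOfUnity (n i) ℂ) (∏ i, n i) := by
    refine ⟨inferInstance, ?_⟩
    rw [Nat.card_pi]
    exact Finset.prod_le_prod' fun i _ => (cardLE_rootsOfUnity (n i)).2
  refine CardLE.of_injective (H1IsoOfIsTrivial (Rep.trivial ℤ G (Additive ℂˣ))).toLinearEquiv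
    (LinearEquiv.injective _) (h1.of_injective (fun f : Additive G →+ Additive ℂˣ => fun i =>
      ⟨AddMonoidHom.toMultiplicative f (s i), hns _ i⟩) ?_)
  intro f f' h
  refine AddMonoidHom.toMultiplicative.injective (MonoidHom.eq_of_eqOn_dense hs ?_)
  rintro _ ⟨i, rfl⟩
  exact congrArg Subtype.val (congrFun h i)

/-- A subgroup of index 2 given as the image of an injective homomorphism. -/
theorem index_range_eq_two {K G : Type} [Group K] [Group G] [Finite G] (i : K →* G)
    (hi : Function.Injective i) (h : Nat.card G = 2 * Nat.card K) : i.range.index = 2 := by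
  have h1 := i.range.index_mul_card
  rw [← Nat.card_congr (MonoidHom.ofInjective hi).toEquiv, h] at h1
  have : Finite K := Finite.of_injective i hi
  exact Nat.eq_of_mul_eq_mul_right Nat.card_pos h1

theorem CardLE.range {K G : Type} [Group K] [Group G] {i : K →* G} {n b : ℕ}
    (h : CardLE (Coh K (Additive ℂˣ) n) b) (hi : Function.Injective i) :
    CardLE (Coh i.range (Additive ℂˣ) n) b :=
  h.of_injective (cohEquiv _ n (MonoidHom.ofInjective hi))
    (cohEquiv _ n (MonoidHom.ofInjective hi)).injective

/-! ### The individual groups and their chosen subgroups of index two -/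

section Concrete

theorem zmod_zpowers (n : ℕ) [NeZero n] (x : Multiplicative (ZMod n)) :
    x ∈ Subgroup.zpowers (Multiplicative.ofAdd (1 : ZMod n)) := by
  refine ⟨(x.toAdd.val : ℤ), ?_⟩
  change Multiplicative.ofAdd ((x.toAdd.val : ℤ) • (1 : ZMod n)) = x
  simp

theorem cardLE_H2_zmod (n : ℕ) [NeZero n] :
    CardLE (Coh (Multiplicative (ZMod n)) (Additive ℂˣ) 2) 1 :=
  cardLE_H2_cyclic _ (zmod_zpowers n)

theorem cardLE_H3_zmod (n : ℕ) [NeZero n] : CardLE (H3 (Multiplicative (ZMod n))) n := by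
  have h := cardLE_H3_cyclic _ (zmod_zpowers n)
  rwa [Fintype.card_multiplicative, ZMod.card] at h

/-- The character `x ↦ exp(2πix/n)` of `ℤ/n`. -/
noncomputable def zroot (n : ℕ) [NeZero n] : ZMod n →+ Additive ℂˣ where
  toFun x := Additive.ofMul (Circle.toUnits (ZMod.toCircle x))
  map_zero' := by simp
  map_add' x y := by rw [AddChar.map_add_eq_mul, map_mul, ofMul_mul]

theorem zroot_injective (n : ℕ) [NeZero n] : Function.Injective (zroot n) := by
  intro x y h
  have h1 : Circle.toUnits (ZMod.toCircle x) = Circle.toUnits (ZMod.toCircle y) := h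
  refine ZMod.injective_toCircle (Subtype.ext ?_)
  exact congrArg Units.val h1

/-- The inclusion of a factor. -/
def inlHom (m n : ℕ) : Multiplicative (ZMod m) →* Multiplicative (ZMod m × ZMod n) :=
  AddMonoidHom.toMultiplicative (AddMonoidHom.inl _ _)

theorem inlHom_injective (m n : ℕ) : Function.Injective (inlHom m n) := fun _ _ h =>
  congrArg Prod.fst h

theorem mem_range_inlHom {m n : ℕ} {x : Multiplicative (ZMod m × ZMod n)} :
    x ∈ (inlHom m n).range ↔ x.toAdd.2 = 0 :=
  ⟨fun ⟨_, h⟩ => h ▸ rfl, fun h => ⟨x.toAdd.1, Prod.ext rfl h.symm⟩⟩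

theorem cardLE_H1_prod (m n : ℕ) [NeZero m] [NeZero n] :
    CardLE (Coh (Multiplicative (ZMod m × ZMod n)) (Additive ℂˣ) 1) (m * n) := by
  have h := cardLE_H1 (G := Multiplicative (ZMod m × ZMod n))
    ![Multiplicative.ofAdd (1, 0), Multiplicative.ofAdd (0, 1)] ![m, n]
    (by intro i; fin_cases i; exacts [NeZero.ne m, NeZero.ne n]) ?_ ?_
  · simpa using h
  · rw [Subgroup.eq_top_iff']
    intro x
    have hx : x = Multiplicative.ofAdd ((1, 0) : ZMod m × ZMod n) ^ x.toAdd.1.val *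
        Multiplicative.ofAdd ((0, 1) : ZMod m × ZMod n) ^ x.toAdd.2.val := by
      apply Multiplicative.toAdd.injective
      simp
    rw [hx]
    exact Subgroup.mul_mem _
      (Subgroup.pow_mem _ (Subgroup.subset_closure (Set.mem_range.2 ⟨0, rfl⟩)) _)
      (Subgroup.pow_mem _ (Subgroup.subset_closure (Set.mem_range.2 ⟨1, rfl⟩)) _)
  · intro f i
    rw [← map_pow]
    fin_cases i
    · convert map_one f
      apply Multiplicative.toAdd.injective
      simp
    · convert map_one f
      apply Multiplicative.toAdd.injective
      simp

theorem cardLE_H3_Z4Z2 : CardLE (H3 Z4Z2) 16 := by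
  have hi := inlHom_injective 4 2
  -- `L` extends the faithful character of `ℤ/4`. The square of `t = (1, 1)` is `(2, 0)`, where the
  -- character is `-1`, whereas `(0, 1)` would have trivial square. The bound 8 for `H¹` is used as
  -- `2 * 4`, and the transfer removes the factor 2.
  refine cardLE_H3_of_transfer (A := Additive ℂˣ) (a := 4) (b := 1) (c := 4)
    (index_range_eq_two _ hi (by simp)) (t := Multiplicative.ofAdd (1, 1))
    (by rw [mem_range_inlHom]; decide) ((cardLE_H3_zmod 4).range hi)
    ((cardLE_H2_zmod 4).range hi) (cardLE_H1_prod 4 2) (fun x => zroot 4 x.toAdd.1) ?_ ?_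
  · intro n _ x
    exact map_add (zroot 4) _ _
  · intro h
    exact absurd (zroot_injective 4 (h.trans (map_zero _).symm)) (by decide)

/-- The rotations of the dihedral group. -/
def rotHom : Multiplicative (ZMod 4) →* D8 where
  toFun x := DihedralGroup.r x.toAdd
  map_one' := rfl
  map_mul' _ _ := rfl

theorem rotHom_injective : Function.Injective rotHom := fun _ _ h => by
  injection h

theorem closure_D8 :
    Subgroup.closure (Set.range ![(DihedralGroup.r 1 : D8), DihedralGroup.sr 0]) = ⊤ := by
  rw [Subgroup.eq_top_iff']
  have hr : ∀ i, (DihedralGroup.r i : D8) ∈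
      Subgroup.closure (Set.range ![(DihedralGroup.r 1 : D8), DihedralGroup.sr 0]) := fun i => by
    have h : (DihedralGroup.r i : D8) = DihedralGroup.r 1 ^ i.val := by simp
    rw [h]
    exact Subgroup.pow_mem _ (Subgroup.subset_closure (Set.mem_range.2 ⟨0, rfl⟩)) _
  rintro (i | i)
  · exact hr i
  · have h : (DihedralGroup.sr i : D8) = DihedralGroup.sr 0 * DihedralGroup.r i := by simp
    rw [h]
    exact Subgroup.mul_mem _ (Subgroup.subset_closure (Set.mem_range.2 ⟨1, rfl⟩)) (hr i)

theorem cardLE_H1_D8 : CardLE (Coh D8 (Additive ℂˣ) 1) 4 := by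
  have h := cardLE_H1 ![(DihedralGroup.r 1 : D8), DihedralGroup.sr 0] ![2, 2] (by decide)
    closure_D8 ?_
  · simpa using h
  · intro f i
    fin_cases i
    -- Conjugation by a reflection inverts the rotation, so its image in a commutative group squares
    -- to 1.
    · have h1 : (DihedralGroup.r 1 : D8) * (DihedralGroup.sr 0 * DihedralGroup.r 1 *
        DihedralGroup.sr 0) = 1 := by decide
      have h2 : (DihedralGroup.sr 0 : D8) * DihedralGroup.sr 0 = 1 := by decide
      have h3 := congrArg f h1
      have h4 := congrArg f h2
      simp only [map_mul, map_one] at h3 h4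
      change f (DihedralGroup.r 1) ^ 2 = 1
      calc _ = f (DihedralGroup.r 1) * (f (DihedralGroup.sr 0) * f (DihedralGroup.r 1) *
            f (DihedralGroup.sr 0)) := by rw [mul_right_comm, h4, one_mul, sq]
        _ = 1 := h3
    · change f (DihedralGroup.sr 0) ^ 2 = 1
      rw [← map_pow]
      exact (congrArg f (by decide : (DihedralGroup.sr 0 : D8) ^ 2 = 1)).trans (map_one f)

theorem cardLE_H3_D8 : CardLE (H3 D8) 16 :=
  cardLE_H3 (A := Additive ℂˣ) (a := 4) (b := 1) (c := 4)
    (index_range_eq_two _ rotHom_injective (by simp [Nat.card_eq_fintype_card, DihedralGroup.card]))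
    ((cardLE_H3_zmod 4).range rotHom_injective)
    ((cardLE_H2_zmod 4).range rotHom_injective) cardLE_H1_D8

/-- The cyclic subgroup of order 4 of the quaternion group. -/
def quatHom : Multiplicative (ZMod 4) →* Q8 where
  toFun x := QuaternionGroup.a x.toAdd
  map_one' := rfl
  map_mul' _ _ := rfl

theorem quatHom_injective : Function.Injective quatHom := fun _ _ h => by
  injection h

theorem closure_Q8 :
    Subgroup.closure (Set.range ![(QuaternionGroup.a 1 : Q8), QuaternionGroup.xa 0]) = ⊤ := by
  rw [Subgroup.eq_top_iff']
  have hr : ∀ i, (QuaternionGroup.a i : Q8) ∈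
      Subgroup.closure (Set.range ![(QuaternionGroup.a 1 : Q8), QuaternionGroup.xa 0]) :=
      fun i => by
    have h : (QuaternionGroup.a i : Q8) = QuaternionGroup.a 1 ^ i.val := by
      rw [QuaternionGroup.a_one_pow, ZMod.natCast_zmod_val]
    rw [h]
    exact Subgroup.pow_mem _ (Subgroup.subset_closure (Set.mem_range.2 ⟨0, rfl⟩)) _
  rintro (i | i)
  · exact hr i
  · have h : (QuaternionGroup.xa i : Q8) = QuaternionGroup.xa 0 * QuaternionGroup.a i := by simp
    rw [h]
    exact Subgroup.mul_mem _ (Subgroup.subset_closure (Set.mem_range.2 ⟨1, rfl⟩)) (hr i)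

theorem cardLE_H1_Q8 : CardLE (Coh Q8 (Additive ℂˣ) 1) 4 := by
  have h := cardLE_H1 ![(QuaternionGroup.a 1 : Q8), QuaternionGroup.xa 0] ![2, 2] (by decide)
    closure_Q8 ?_
  · simpa using h
  · intro f i
    have h1 : (QuaternionGroup.a 1 : Q8) * (QuaternionGroup.xa 0 * QuaternionGroup.a 1) =
      QuaternionGroup.xa 0 := by decide
    have h2 := congrArg f h1
    simp only [map_mul] at h2
    have h3 : f (QuaternionGroup.a 1) ^ 2 = 1 := by
      rw [mul_left_comm] at h2
      rw [sq]
      exact mul_eq_left.1 h2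
    fin_cases i
    · exact h3
    · change f (QuaternionGroup.xa 0) ^ 2 = 1
      rw [← map_pow] at h3 ⊢
      exact (congrArg f (by decide : (QuaternionGroup.xa 0 : Q8) ^ 2 =
        QuaternionGroup.a 1 ^ 2)).trans h3

theorem cardLE_H3_Q8 : CardLE (H3 Q8) 8 := by
  have hi := quatHom_injective
  -- The rule `a n * xa i = xa (i - n)` forces the sign of `L` on the second coset. The square of
  -- `xa 0` is `a 2`, where the character is `-1`; without the transfer the bound would be 16.
  refine cardLE_H3_of_transfer (A := Additive ℂˣ) (a := 4) (b := 1) (c := 2)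
    (index_range_eq_two _ hi (by simp [Nat.card_eq_fintype_card, QuaternionGroup.card]))
    (t := QuaternionGroup.xa 0)
    ?_ ((cardLE_H3_zmod 4).range hi)
    ((cardLE_H2_zmod 4).range hi) cardLE_H1_Q8
    (fun x => match x with
      | QuaternionGroup.a i => zroot 4 i
      | QuaternionGroup.xa i => zroot 4 (-i)) ?_ ?_
  · rintro ⟨x, hx⟩
    cases hx
  · rintro _ ⟨n, rfl⟩ (i | i)
    · exact map_add (zroot 4) _ _
    · change zroot 4 (-(i - n.toAdd)) = zroot 4 n.toAdd + zroot 4 (-i)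
      rw [← map_add]
      congr 1
      abel
  · intro h
    change zroot 4 _ = 0 at h
    exact absurd (zroot_injective 4 (h.trans (map_zero _).symm)) (by decide)

/-- A crossed homomorphism for the sign action is determined up to coboundaries by its value at
a generator of `N`. -/
theorem cardLE_H1_sign :
    CardLE (groupCohomology (Rep.of (signRep (Additive ℂˣ) (inlHom 2 2).range
      (index_range_eq_two _ (inlHom_injective 2 2) (by simp)))) 1) 2 := by
  set N := (inlHom 2 2).range with hNdef
  have hN : N.index = 2 := index_range_eq_two _ (inlHom_injective 2 2) (by simp)
  set R := Rep.of (signRep (Additive ℂˣ) N hN)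
  let p : Multiplicative (ZMod 2 × ZMod 2) := Multiplicative.ofAdd (1, 0)
  let t : Multiplicative (ZMod 2 × ZMod 2) := Multiplicative.ofAdd (0, 1)
  have hp : p ∈ N := mem_range_inlHom.2 rfl
  have ht : t ∉ N := fun h => absurd (mem_range_inlHom.1 h) (by decide)
  have hmulN : ∀ f : cocycles₁ R, ∀ x ∈ N, ∀ y, f (x * y) = f y + f x := fun f x hx y =>
    ((mem_cocycles₁_iff f.1).1 f.2 x y).trans
      (congrArg (· + f x) (signRep_of_mem (Additive ℂˣ) hN hx (f y)))
  have hpp : ∀ f : cocycles₁ R, f p + f p = 0 := fun f => by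
    rw [← hmulN f p hp p]
    exact (congrArg f (by decide : p * p = 1)).trans (cocycles₁_map_one f)
  have hrep : ∀ c : groupCohomology R 1, ∃ f : cocycles₁ R, f t = 0 ∧ H1π R f = c := by
    intro c
    induction c using H1_induction_on with
    | h f =>
      -- The element `t` acts by inversion, so adding the coboundary of `b` lowers `f t` by `2 b`;
      -- divisibility of `ℂ^*` allows `f t` to be made zero.
      obtain ⟨b, hb⟩ := exists_pow_eq_unit 2 two_ne_zero (Additive.toMul (α := ℂˣ) (f t))
      have hb' : Additive.ofMul b + Additive.ofMul b = f t := by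
        rw [← ofMul_mul, ← sq, hb]
        rfl
      refine ⟨f + ⟨d₀₁ R (Additive.ofMul b), d₀₁_apply_mem_cocycles₁ _⟩, ?_, ?_⟩
      · change f t + (signRep (Additive ℂˣ) N hN t (Additive.ofMul b) - Additive.ofMul b) = 0
        rw [signRep_of_notMem _ hN ht, ← hb']
        abel
      · rw [H1π_eq_iff]
        exact ⟨Additive.ofMul b, (add_sub_cancel_left (f : _ → _) _).symm⟩
  choose s hs0 hs using hrep
  -- Once `f t = 0`, only the value at `p` is free, and it is a square root of unity because `p` has
  -- order 2 and acts trivially.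
  have hroot : ∀ c, Additive.toMul (α := ℂˣ) (s c p) ∈ rootsOfUnity 2 ℂ := fun c => by
    have h := hpp (s c)
    rw [← two_nsmul] at h
    exact congrArg Additive.toMul h
  refine (cardLE_rootsOfUnity 2).of_injective (fun c => ⟨_, hroot c⟩) ?_
  · intro c c' h
    have h' := Subtype.ext_iff.1 h
    have h1 : s c p = s c' p := Additive.toMul.injective h'
    rw [← hs c, ← hs c']
    congr 1
    apply cocycles₁_ext
    have hone : s c 1 = s c' 1 := (cocycles₁_map_one _).trans (cocycles₁_map_one _).symm
    have hpt : s c (p * t) = s c' (p * t) := by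
      rw [hmulN _ p hp, hmulN _ p hp, h1, hs0, hs0]
    have hall : ∀ g : Multiplicative (ZMod 2 × ZMod 2), g = 1 ∨ g = p ∨ g = t ∨ g = p * t := by
      decide
    intro g
    rcases hall g with rfl | rfl | rfl | rfl
    exacts [hone, h1, (hs0 c).trans (hs0 c').symm, hpt]

theorem cardLE_H2_Z2Sq :
    CardLE (Coh (Multiplicative (ZMod 2 × ZMod 2)) (Additive ℂˣ) 2) 2 :=
  cardLE_H2_of_sign (a := 1) (b := 2) (index_range_eq_two _ (inlHom_injective 2 2) (by simp))
    ((cardLE_H2_zmod 2).range (inlHom_injective 2 2)) cardLE_H1_sign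

theorem cardLE_H3_Z2Sq : CardLE (H3 (Multiplicative (ZMod 2 × ZMod 2))) 8 :=
  cardLE_H3 (A := Additive ℂˣ) (a := 2) (b := 1) (c := 4)
    (index_range_eq_two _ (inlHom_injective 2 2) (by simp))
    ((cardLE_H3_zmod 2).range (inlHom_injective 2 2))
    ((cardLE_H2_zmod 2).range (inlHom_injective 2 2)) (cardLE_H1_prod 2 2)

/-- The inclusion of a coordinate plane. -/
def planeHom : Multiplicative (ZMod 2 × ZMod 2) →* Z2Cubed where
  toFun x := Multiplicative.ofAdd ![x.toAdd.1, x.toAdd.2, 0]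
  map_one' := by decide
  map_mul' := by decide

theorem planeHom_injective : Function.Injective planeHom := fun _ _ h =>
  Prod.ext (congrFun h 0) (congrFun h 1)

theorem cardLE_H1_Z2Cubed : CardLE (Coh Z2Cubed (Additive ℂˣ) 1) 8 := by
  have h := cardLE_H1 (G := Z2Cubed) (fun i : Fin 3 => Multiplicative.ofAdd (Pi.single i 1))
    (fun _ => 2) (fun _ => two_ne_zero) ?_ ?_
  · simpa using h
  · rw [Subgroup.eq_top_iff']
    intro x
    have hx : x = ∏ i : Fin 3, Multiplicative.ofAdd (Pi.single i 1 : Fin 3 → ZMod 2) ^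
        (x.toAdd i).val := by
      revert x
      decide
    rw [hx]
    exact Subgroup.prod_mem _ fun i _ => Subgroup.pow_mem _
      (Subgroup.subset_closure (Set.mem_range_self i)) _
  · intro f i
    rw [← map_pow]
    convert map_one f
    revert i
    decide

/-- For a coordinate plane `N` the three factors are 8, 2 and 8. No transfer correction is needed:
the product is the true order, as the trilinear classes show. -/
theorem cardLE_H3_Z2Cubed : CardLE (H3 Z2Cubed) 128 :=
  cardLE_H3 (A := Additive ℂˣ) (a := 8) (b := 2) (c := 8)
    (index_range_eq_two _ planeHom_injective (by simp))
    (cardLE_H3_Z2Sq.range planeHom_injective)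
    (cardLE_H2_Z2Sq.range planeHom_injective) cardLE_H1_Z2Cubed

end Concrete

end SmallGroupBounds

/-! ### Evaluation of classes on 3-cycles, and classes of explicit cocycles -/

section CycleEvaluation

variable {G H : Type} [Group G] [Group H]

/-- The combination `∑ sᵢ [zᵢ]` of triples is a cycle: coboundaries of 2-cochains vanish on it. -/
def IsCycle {m : ℕ} (s : Fin m → ℤ) (z : Fin m → G × G × G) : Prop :=
  ∀ h : G → G → Additive ℂˣ, ∑ i, s i • (h (z i).2.1 (z i).2.2 - h ((z i).1 * (z i).2.1) (z i).2.2 +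
    h (z i).1 ((z i).2.1 * (z i).2.2) - h (z i).1 (z i).2.1) = 0

theorem Cocycle3.eval_eq_of_cls_eq {m : ℕ} {s : Fin m → ℤ} {z : Fin m → G × G × G}
    (hz : IsCycle s z) {η η' : Cocycle3 G} (h : η.cls = η'.cls) :
    ∑ i, s i • Additive.ofMul (η (z i).1 (z i).2.1 (z i).2.2) =
      ∑ i, s i • Additive.ofMul (η' (z i).1 (z i).2.1 (z i).2.2) := by
  obtain ⟨k, hk⟩ := (Cocycle3.cls_eq_iff η η').1 h
  rw [← sub_eq_zero, ← Finset.sum_sub_distrib, ← hz (fun a b => Additive.ofMul (k a b))]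
  refine Finset.sum_congr rfl fun i _ => ?_
  refine (zsmul_sub _ _ _).symm.trans ?_
  congr 1
  have h1 := congrArg Additive.ofMul (hk (z i).1 (z i).2.1 (z i).2.2)
  simp only [ofMul_mul] at h1
  rw [sub_eq_iff_eq_add]
  rw [← sub_eq_zero] at h1 ⊢
  rw [← h1]
  abel

/-- Evaluation of classes in `H³(G, ℂ^*)` on a cycle. -/
noncomputable def evalCycle {m : ℕ} {s : Fin m → ℤ} {z : Fin m → G × G × G} (hz : IsCycle s z) :
    H3 G →+ Additive ℂˣ :=
  AddMonoidHom.mk' (fun c => ∑ i, s i •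
    Additive.ofMul ((Cocycle3.exists_cls_eq c).choose (z i).1 (z i).2.1 (z i).2.2)) (fun c c' => by
      rw [← Finset.sum_add_distrib]
      refine (Cocycle3.eval_eq_of_cls_eq hz (η' := (Cocycle3.exists_cls_eq c).choose *
        (Cocycle3.exists_cls_eq c').choose) ?_).trans (Finset.sum_congr rfl fun i _ => ?_)
      · rw [Cocycle3.cls_mul, (Cocycle3.exists_cls_eq c).choose_spec,
          (Cocycle3.exists_cls_eq c').choose_spec, (Cocycle3.exists_cls_eq (c + c')).choose_spec]
      · exact zsmul_add _ _ _)

theorem evalCycle_cls {m : ℕ} {s : Fin m → ℤ} {z : Fin m → G × G × G} (hz : IsCycle s z)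
    (η : Cocycle3 G) :
    evalCycle hz η.cls = ∑ i, s i • Additive.ofMul (η (z i).1 (z i).2.1 (z i).2.2) :=
  Cocycle3.eval_eq_of_cls_eq hz (Cocycle3.exists_cls_eq η.cls).choose_spec

/-- The cycle `∑ [g | gⁱ | g]`, `i < n`, of an element with `gⁿ = 1`. -/
theorem isCycle_pow (g : G) (n : ℕ) (hg : g ^ n = 1) :
    IsCycle (fun _ : Fin n => 1) (fun i => (g, g ^ (i : ℕ), g)) := by
  intro h
  simp only [one_smul]
  rw [Fin.sum_univ_eq_sum_range (fun i => h (g ^ i) g - h (g * g ^ i) g + h g (g ^ i * g) -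
    h g (g ^ i)) n]
  -- The boundary telescopes: it consists of successive differences of `h g (gⁱ) - h (gⁱ) g`, whose
  -- values at `i = 0` and `i = n` agree.
  have h1 : ∀ i, h (g ^ i) g - h (g * g ^ i) g + h g (g ^ i * g) - h g (g ^ i) =
      (h g (g ^ (i + 1)) - h (g ^ (i + 1)) g) - (h g (g ^ i) - h (g ^ i) g) := fun i => by
    rw [← pow_succ, ← pow_succ']
    abel
  simp only [h1]
  exact (Finset.sum_range_sub (fun i => h g (g ^ i) - h (g ^ i) g) n).trans
    (by rw [hg, pow_zero, sub_self])

/-- The invariant `∏ η(g, gⁱ, g)`, `i < n`, of an element with `gⁿ = 1`. -/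
noncomputable def powInv (g : G) (n : ℕ) (hg : g ^ n = 1) : H3 G →+ Additive ℂˣ :=
  evalCycle (isCycle_pow g n hg)

theorem powInv_cls (g : G) (n : ℕ) (hg : g ^ n = 1) (η : Cocycle3 G) :
    powInv g n hg η.cls = ∑ i : Fin n, Additive.ofMul (η g (g ^ (i : ℕ)) g) := by
  rw [powInv, evalCycle_cls]
  simp only [one_smul]

/-- A homomorphism carries the cycle of `g` to the cycle of `φ g`; this is what makes automorphisms
act on the invariants by precomposition. -/
theorem powInv_pullback (φ : G →* H) (g : G) (n : ℕ) (hg : g ^ n = 1) (hg' : φ g ^ n = 1)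
    (c : H3 H) : powInv g n hg (cohPullback (Additive ℂˣ) 3 φ c) = powInv (φ g) n hg' c := by
  obtain ⟨η, rfl⟩ := Cocycle3.exists_cls_eq c
  rw [← Cocycle3.cls_comap, powInv_cls, powInv_cls]
  refine Finset.sum_congr rfl fun i _ => ?_
  rw [← map_pow]
  rfl

/-- The cocycle condition for functions with values in an additive group. -/
def IsAddCocycle {A : Type} [AddCommGroup A] (F : G → G → G → A) : Prop :=
  ∀ a b c d, F b c d + F a (b * c) d + F a b c = F (a * b) c d + F a b (c * d)

/-- The 3-cocycles `exp(2πi k F / n)`. -/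
noncomputable def zCocycle {n : ℕ} [NeZero n] {F : G → G → G → ZMod n} (hF : IsAddCocycle F)
    (k : ZMod n) : Cocycle3 G where
  toFun a b c := (zroot n (k * F a b c)).toMul
  cocycle a b c d := by
    apply Additive.ofMul.injective
    simp only [ofMul_mul, ofMul_toMul]
    simp only [← map_add, ← mul_add]
    rw [hF]

/-- The classes of the 3-cocycles `exp(2πi k F / n)`. -/
noncomputable def zClass {n : ℕ} [NeZero n] {F : G → G → G → ZMod n} (hF : IsAddCocycle F) :
    ZMod n →+ H3 G :=
  AddMonoidHom.mk' (fun k => (zCocycle hF k).cls) fun k l => by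
    rw [← Cocycle3.cls_mul]
    congr 1
    have h : (zCocycle hF (k + l)).toFun = (zCocycle hF k * zCocycle hF l).toFun := by
      funext a b c
      change (zroot n ((k + l) * F a b c)).toMul =
        (zroot n (k * F a b c)).toMul * (zroot n (l * F a b c)).toMul
      rw [add_mul, map_add, toMul_add]
    cases h1 : zCocycle hF (k + l)
    cases h2 : zCocycle hF k * zCocycle hF l
    rw [h1, h2] at h
    congr

theorem evalCycle_zClass {m : ℕ} {s : Fin m → ℤ} {z : Fin m → G × G × G} (hz : IsCycle s z)
    {n : ℕ} [NeZero n] {F : G → G → G → ZMod n} (hF : IsAddCocycle F) (k : ZMod n) :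
    evalCycle hz (zClass hF k) =
      zroot n (k * ∑ i, s i * F (z i).1 (z i).2.1 (z i).2.2) := by
  refine (evalCycle_cls hz _).trans ?_
  rw [Finset.mul_sum, map_sum]
  refine Finset.sum_congr rfl fun i _ => ?_
  change s i • zroot n (k * F (z i).1 (z i).2.1 (z i).2.2) = _
  rw [← map_zsmul, zsmul_eq_mul]
  congr 1
  ring

theorem powInv_zClass (g : G) (m : ℕ) (hg : g ^ m = 1)
    {n : ℕ} [NeZero n] {F : G → G → G → ZMod n} (hF : IsAddCocycle F) (k : ZMod n) :
    powInv g m hg (zClass hF k) = zroot n (k * ∑ i : Fin m, F g (g ^ (i : ℕ)) g) := by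
  rw [powInv, evalCycle_zClass]
  simp

/-- An injection from a set of exactly `n` elements leaves no room in a set of at most `n`. This
turns the upper bounds on cohomology into computations. -/
theorem bijective_of_card {X Y : Type} {n : ℕ} (f : X → Y) (hf : Function.Injective f)
    (hY : CardLE Y n) (hX : Nat.card X = n) : Function.Bijective f := by
  have := hY.1
  have := Finite.of_injective f hf
  refine (Nat.bijective_iff_injective_and_card f).2 ⟨hf, ?_⟩
  exact le_antisymm (Nat.card_le_card_of_injective f hf) (hY.2.trans hX.ge)

end CycleEvaluation

/-! ### A cocycle of order four on the dihedral group -/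

section D8

/-- The coordinates of `sᴬrⁱ`. -/
def D8.refl : D8 → ℕ
  | DihedralGroup.r _ => 0
  | DihedralGroup.sr _ => 1

/-- The coordinates of `sᴬrⁱ`. -/
def D8.rot : D8 → ℕ
  | DihedralGroup.r i => i.val
  | DihedralGroup.sr i => i.val

/-- A generator of the direct summand of order 4. -/
def D8.gamma (x y z : D8) : ZMod 4 :=
  -- `t` is the rotation exponent of `y * z` before reduction modulo 4, and `t / 4`, rounded down,
  -- is the carry. Both the rotation coordinate and the carry are cocycles for the sign action of
  -- reflections, and `gamma` is their cup product, the sign coming from moving the first factor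
  -- past `y * z`.
  let t : ℤ := (-1) ^ z.refl * y.rot + z.rot
  (((-1) ^ (y.refl + z.refl) * x.rot * (t / 4) : ℤ) : ZMod 4)

theorem D8.isAddCocycle_gamma : IsAddCocycle D8.gamma := by
  unfold IsAddCocycle
  decide +kernel

end D8

/-! ### Orbits of automorphisms read off from the invariants of elements -/

section Orbits

/-- Signs are regarded as fourth roots of unity, so that invariants of classes of order 2 and 4 can
be added in `ZMod 4`. -/
theorem zroot_two (x : ZMod 2) : zroot 2 x = zroot 4 (2 * (x.val : ZMod 4)) := by
  have h : ∀ y : ZMod 2, y = 0 ∨ y = 1 := by decide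
  rcases h x with rfl | rfl
  · simp
  · have h1 : zroot 4 2 = zroot 2 1 := by
      apply Additive.toMul.injective
      ext
      change ((ZMod.toCircle (2 : ZMod 4) : Circle) : ℂ) = ((ZMod.toCircle (1 : ZMod 2) : Circle) : ℂ)
      have h2 := ZMod.toCircle_intCast (N := 4) 2
      have h3 := ZMod.toCircle_intCast (N := 2) 1
      push_cast at h2 h3
      rw [h2, h3]
      congr 1
      ring
    rw [← h1]
    congr 1

/-- An exponent of `g` in a group of exponent 4. -/
def exp4 {G : Type} [Group G] [DecidableEq G] (g : G) : ℕ := if g ^ 2 = 1 then 2 else 4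

theorem exp4_map {G : Type} [Group G] [DecidableEq G] (φ : G ≃* G) (g : G) :
    exp4 (φ g) = exp4 g := by
  simp only [exp4, ← map_pow, EmbeddingLike.map_eq_one_iff]

theorem pow_exp4 {G : Type} [Group G] [DecidableEq G] (h : ∀ g : G, g ^ 4 = 1) (g : G) :
    g ^ exp4 g = 1 := by
  unfold exp4
  split_ifs with h'
  exacts [h', h g]

/-- The orbits of `Aut(G)` on `H³(G, ℂ^*)` when the classes are separated by the invariants of
elements. -/
theorem exists_equiv_of_invariants {G X : Type} [Group G] [AddCommGroup X] {N m : ℕ} [NeZero N]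
    (n : G → ℕ) (hn : ∀ g, g ^ n g = 1) (hφ : ∀ (φ : G ≃* G) g, n (φ g) = n g)
    (B : X →+ H3 G) (T : X → G → ZMod N)
    (hT : ∀ x g, powInv g (n g) (hn g) (B x) = zroot N (T x g))
    (hinj : Function.Injective T) (hc : CardLE (H3 G) m) (hX : Nat.card X = m) :
    ∃ e : H3 G ≃+ X, (∀ c g, powInv g (n g) (hn g) c = zroot N (T (e c) g)) ∧
      (∀ (φ : G ≃* G) c g, T (e (cohPullback (Additive ℂˣ) 3 φ.toMonoidHom c)) g =
        T (e c) (φ g)) ∧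
      ∀ c d, SameOrbit c d ↔ ∃ φ : G ≃* G, ∀ g, T (e c) g = T (e d) (φ g) := by
  have hB : Function.Injective B := fun x y hxy => hinj (funext fun g =>
    zroot_injective N (by rw [← hT, ← hT, hxy]))
  have hbij := bijective_of_card B hB hc hX
  let e := (AddEquiv.ofBijective B hbij).symm
  have he : ∀ c, B (e c) = c := (AddEquiv.ofBijective B hbij).apply_symm_apply
  have h0 : ∀ c g, powInv g (n g) (hn g) c = zroot N (T (e c) g) := fun c g => by
    rw [← hT, he]
  have h1 : ∀ (φ : G ≃* G) c g, T (e (cohPullback (Additive ℂˣ) 3 φ.toMonoidHom c)) g =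
      T (e c) (φ g) := fun φ c g => by
    apply zroot_injective N
    rw [← h0, ← h0, powInv_pullback φ.toMonoidHom g _ _ (by rw [← map_pow, hn, map_one])]
    congr 1
    simp only [hφ]
    rfl
  refine ⟨e, h0, h1, fun c d => ⟨fun ⟨φ, h⟩ => ⟨φ, fun g => ?_⟩, fun ⟨φ, h⟩ => ⟨φ, ?_⟩⟩⟩
  · rw [← h, h1]
  · exact e.injective (hinj (funext fun g => by rw [h, h1]))

/-- The exponent of the invariant of `g` for the class `i [F₁] + j [F₂] + k [F₃]`. -/
def threeInv {G : Type} [Group G] [DecidableEq G] (F₁ : G → G → G → ZMod 4)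
    (F₂ F₃ : G → G → G → ZMod 2) (x : ZMod 4 × ZMod 2 × ZMod 2) (g : G) : ZMod 4 :=
  x.1 * (∑ i : Fin (exp4 g), F₁ g (g ^ (i : ℕ)) g) +
    (2 * ((x.2.1 * ∑ i : Fin (exp4 g), F₂ g (g ^ (i : ℕ)) g).val : ZMod 4) +
      2 * ((x.2.2 * ∑ i : Fin (exp4 g), F₃ g (g ^ (i : ℕ)) g).val : ZMod 4))

/-- The three cocycles span at most 16 classes; if the invariants separate all 16 combinations,
these exhaust `H³` by the bound `hc`. -/
theorem exists_equiv_of_three {G : Type} [Group G] [DecidableEq G] (h4 : ∀ g : G, g ^ 4 = 1)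
    {F₁ : G → G → G → ZMod 4} {F₂ F₃ : G → G → G → ZMod 2} (h₁ : IsAddCocycle F₁)
    (h₂ : IsAddCocycle F₂) (h₃ : IsAddCocycle F₃)
    (hinj : Function.Injective (threeInv F₁ F₂ F₃)) (hc : CardLE (H3 G) 16) :
    ∃ e : H3 G ≃+ ZMod 4 × ZMod 2 × ZMod 2, ∀ c d, SameOrbit c d ↔
      ∃ φ : G ≃* G, ∀ g, threeInv F₁ F₂ F₃ (e c) g = threeInv F₁ F₂ F₃ (e d) (φ g) := by
  obtain ⟨e, -, -, he⟩ := exists_equiv_of_invariants exp4 (pow_exp4 h4) exp4_map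
    ((zClass h₁).coprod ((zClass h₂).coprod (zClass h₃))) (threeInv F₁ F₂ F₃) (fun x g => by
      simp only [AddMonoidHom.coprod_apply, map_add, powInv_zClass, zroot_two, threeInv])
    hinj hc (by simp)
  exact ⟨e, he⟩

/-- The number of elements with a given exponent and a given invariant. -/
def countInv {G : Type} [Group G] [DecidableEq G] [Fintype G] (f : G → ZMod 4) (n : ℕ)
    (t : ZMod 4) : ℕ :=
  (Finset.univ.filter (fun g => exp4 g = n ∧ f g = t)).card

theorem countInv_eq {G : Type} [Group G] [DecidableEq G] [Fintype G] {f f' : G → ZMod 4}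
    (φ : G ≃* G) (h : ∀ g, f g = f' (φ g)) (n : ℕ) (t : ZMod 4) :
    countInv f n t = countInv f' n t := by
  refine Finset.card_bij (fun g _ => φ g) (fun g hg => ?_) (fun _ _ _ _ h => φ.injective h)
    fun g hg => ⟨φ.symm g, ?_, φ.apply_symm_apply g⟩
  · simpa [exp4_map, ← h] using hg
  · simp only [Finset.mem_filter, Finset.mem_univ, true_and] at hg ⊢
    rw [h, ← exp4_map φ, φ.apply_symm_apply]
    exact hg

theorem card_quotient_of_reps {α : Type} (s : Setoid α) {k : ℕ} (r : Fin k → α)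
    (h : ∀ a, ∃! i, s.r a (r i)) : Nat.card (Quotient s) = k := by
  have hb : Function.Bijective (fun i => (Quotient.mk s (r i))) := by
    refine ⟨fun i j hij => ?_, fun q => ?_⟩
    · exact (h (r i)).unique (s.refl _) (Quotient.exact hij)
    · induction q using Quotient.inductionOn with
      | h a => exact ⟨(h a).exists.choose, Quotient.sound (s.symm (h a).exists.choose_spec)⟩
  rw [← Nat.card_eq_of_bijective _ hb, Nat.card_fin]

theorem card_orbitSpace_of_reps {G X : Type} [Group G] [AddCommGroup X] (e : H3 G ≃+ X)
    {R : X → X → Prop} (he : ∀ c d : H3 G, SameOrbit c d ↔ R (e c) (e d)) {k : ℕ} (r : Fin k → X)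
    (h : ∀ x, ∃! i, R x (r i)) : Nat.card (OrbitSpace G (Additive ℂˣ) 3) = k :=
  card_quotient_of_reps _ (fun i => e.symm (r i)) fun c => by
    change ∃! i, SameOrbit c (e.symm (r i))
    simp only [he, e.apply_symm_apply]
    exact h (e c)

end Orbits

/-! ### Orbits for `ℤ/4 × ℤ/2` -/

section Z4Z2

/-- The cocycle `u²`. -/
def Z4Z2.uu (x y z : Z4Z2) : ZMod 4 :=
  x.toAdd.1 * (((y.toAdd.1.val + z.toAdd.1.val) / 4 : ℕ) : ZMod 4)

/-- The cocycle `uv`. -/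
def Z4Z2.uv (x y z : Z4Z2) : ZMod 2 :=
  x.toAdd.2 * (((y.toAdd.1.val + z.toAdd.1.val) / 4 : ℕ) : ZMod 2)

/-- The cocycle `v²`. -/
def Z4Z2.vv (x y z : Z4Z2) : ZMod 2 := x.toAdd.2 * y.toAdd.2 * z.toAdd.2

/-- Some automorphisms of `ℤ/4 × ℤ/2`. -/
def Z4Z2.aut (s t : Bool) : Z4Z2 ≃* Z4Z2 where
  toFun x := Multiplicative.ofAdd
    (x.toAdd.1 + if s then 2 * (x.toAdd.2.val : ZMod 4) else 0,
      x.toAdd.2 + if t then (x.toAdd.1.val : ZMod 2) else 0)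
  invFun x := Multiplicative.ofAdd
    (x.toAdd.1 + if s then 2 * ((x.toAdd.2 + if t then (x.toAdd.1.val : ZMod 2) else 0).val : ZMod 4)
      else 0, x.toAdd.2 + if t then (x.toAdd.1.val : ZMod 2) else 0)
  left_inv := by revert s t; unfold Function.LeftInverse; decide +kernel
  right_inv := by revert s t; unfold Function.RightInverse Function.LeftInverse; decide +kernel
  map_mul' := by revert s t; decide +kernel

/-- The orbits as lists. -/
def orbitsZ4Z2List : List (List (ZMod 4 × ZMod 2 × ZMod 2)) :=
  [[(1, 0, 0), (1, 0, 1)],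
    [(0, 0, 1)],
    [(0, 1, 0), (2, 1, 1), (2, 1, 0), (0, 1, 1)],
    [(1, 1, 0), (3, 1, 0)],
    [(3, 0, 0), (3, 0, 1)],
    [(1, 1, 1), (3, 1, 1)],
    [(2, 0, 0)],
    [(2, 0, 1)],
    [(0, 0, 0)]]

/-- A Boolean form of the orbit relation, in which both implications of the classification are
finite checks over pairs of classes. -/
theorem orbitsZ4Z2_iff (x y : ZMod 4 × ZMod 2 × ZMod 2) :
    (∃ O ∈ orbitsZ4Z2, x ∈ O ∧ y ∈ O) ↔
      (orbitsZ4Z2List.any fun O => decide (x ∈ O) && decide (y ∈ O)) = true := by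
  simp only [List.any_eq_true, Bool.and_eq_true, decide_eq_true_eq, orbitsZ4Z2, orbitsZ4Z2List, Set.mem_insert_iff, Set.mem_singleton_iff, exists_eq_or_imp,
    exists_eq_left, List.mem_cons, List.not_mem_nil, or_false]

theorem exists_equiv_orbitsZ4Z2 : ∃ e : H3 Z4Z2 ≃+ ZMod 4 × ZMod 2 × ZMod 2, ∀ c d : H3 Z4Z2,
    SameOrbit c d ↔ ∃ O ∈ orbitsZ4Z2, e c ∈ O ∧ e d ∈ O := by
  obtain ⟨e, he⟩ := exists_equiv_of_three (G := Z4Z2) (F₁ := Z4Z2.uu) (F₂ := Z4Z2.uv)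
    (F₃ := Z4Z2.vv) (by decide +kernel) (by unfold IsAddCocycle; decide +kernel)
    (by unfold IsAddCocycle; decide +kernel) (by unfold IsAddCocycle; decide +kernel)
    (by unfold Function.Injective; decide +kernel) cardLE_H3_Z4Z2
  refine ⟨e, fun c d => (he c d).trans (Iff.trans ?_ (orbitsZ4Z2_iff _ _).symm)⟩
  generalize e c = x
  generalize e d = y
  constructor
  · rintro ⟨φ, h⟩
    -- Classes in different listed orbits already differ in how many elements have a given exponent
    -- and invariant, so the automorphism can be forgotten.
    have h1 := countInv_eq φ h 2
    have h2 := countInv_eq φ h 4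
    clear h φ
    revert x y
    decide +kernel
  · intro h
    -- The four automorphisms `Z4Z2.aut s t` suffice to connect any two members of a listed orbit.
    have h' : ∃ s t, ∀ g, threeInv Z4Z2.uu Z4Z2.uv Z4Z2.vv x g =
        threeInv Z4Z2.uu Z4Z2.uv Z4Z2.vv y (Z4Z2.aut s t g) := by
      revert x y
      decide +kernel
    obtain ⟨s, t, h'⟩ := h'
    exact ⟨_, h'⟩

theorem card_orbitSpace_Z4Z2 : Nat.card (OrbitSpace Z4Z2 (Additive ℂˣ) 3) = 9 := by
  obtain ⟨e, he⟩ := exists_equiv_orbitsZ4Z2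
  refine card_orbitSpace_of_reps e (R := fun x y => ∃ O ∈ orbitsZ4Z2, x ∈ O ∧ y ∈ O) he
    ![(1, 0, 0), (0, 0, 1), (0, 1, 0), (1, 1, 0), (3, 0, 0), (1, 1, 1), (2, 0, 0), (2, 0, 1),
      (0, 0, 0)] ?_
  simp only [orbitsZ4Z2_iff, ExistsUnique]
  decide +kernel

end Z4Z2

/-! ### Orbits for `D₈` -/

section D8

/-- The cube of the homomorphism with kernel the rotations. -/
def D8.alpha (x y z : D8) : ZMod 2 := x.refl * y.refl * z.refl

/-- The product of the homomorphisms to `ℤ/2`. -/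
def D8.beta (x y z : D8) : ZMod 2 := x.refl * y.refl * z.rot

/-- The automorphism that exchanges the two classes of reflections. -/
def D8.aut : D8 ≃* D8 where
  toFun
    | DihedralGroup.r i => DihedralGroup.r i
    | DihedralGroup.sr i => DihedralGroup.sr (i + 1)
  invFun
    | DihedralGroup.r i => DihedralGroup.r i
    | DihedralGroup.sr i => DihedralGroup.sr (i - 1)
  left_inv := by unfold Function.LeftInverse; decide
  right_inv := by unfold Function.RightInverse Function.LeftInverse; decide
  map_mul' := by decide

/-- The orbits as lists. -/
def orbitsD8List : List (List (ZMod 4 × ZMod 2 × ZMod 2)) :=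
  [[(0, 0, 0)],
    [(1, 0, 0)],
    [(2, 0, 0)],
    [(3, 0, 0)],
    [(0, 1, 0)],
    [(0, 0, 1), (0, 1, 1)],
    [(1, 0, 1), (1, 1, 1)],
    [(2, 0, 1), (2, 1, 1)],
    [(3, 0, 1), (3, 1, 1)],
    [(1, 1, 0)],
    [(2, 1, 0)],
    [(3, 1, 0)]]

theorem orbitsD8_iff (x y : ZMod 4 × ZMod 2 × ZMod 2) :
    (∃ O ∈ orbitsD8, x ∈ O ∧ y ∈ O) ↔
      (orbitsD8List.any fun O => decide (x ∈ O) && decide (y ∈ O)) = true := by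
  simp only [List.any_eq_true, Bool.and_eq_true, decide_eq_true_eq, orbitsD8, orbitsD8List, Set.mem_insert_iff, Set.mem_singleton_iff, exists_eq_or_imp,
    exists_eq_left, List.mem_cons, List.not_mem_nil, or_false]

theorem exists_equiv_orbitsD8 : ∃ e : H3 D8 ≃+ ZMod 4 × ZMod 2 × ZMod 2, ∀ c d : H3 D8,
    SameOrbit c d ↔ ∃ O ∈ orbitsD8, e c ∈ O ∧ e d ∈ O := by
  obtain ⟨e, he⟩ := exists_equiv_of_three (G := D8) (F₁ := D8.gamma) (F₂ := D8.alpha)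
    (F₃ := D8.beta) (by decide +kernel) D8.isAddCocycle_gamma
    (by unfold IsAddCocycle; decide +kernel) (by unfold IsAddCocycle; decide +kernel)
    (by unfold Function.Injective; decide +kernel) cardLE_H3_D8
  refine ⟨e, fun c d => (he c d).trans (Iff.trans ?_ (orbitsD8_iff _ _).symm)⟩
  generalize e c = x
  generalize e d = y
  constructor
  · rintro ⟨φ, h⟩
    have h1 := countInv_eq φ h 2
    have h2 := countInv_eq φ h 4
    clear h φ
    revert x y
    decide +kernel
  · intro h
    -- Inner automorphisms act trivially on cohomology, and the outer automorphism group has order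
    -- 2, generated by the class of `D8.aut`. So the identity and `D8.aut` are the only candidates
    -- needed.
    have h' : (∀ g, threeInv D8.gamma D8.alpha D8.beta x g =
        threeInv D8.gamma D8.alpha D8.beta y (MulEquiv.refl _ g)) ∨
        (∀ g, threeInv D8.gamma D8.alpha D8.beta x g =
        threeInv D8.gamma D8.alpha D8.beta y (D8.aut g)) := by
      revert x y
      decide +kernel
    rcases h' with h' | h'
    exacts [⟨_, h'⟩, ⟨_, h'⟩]

theorem card_orbitSpace_D8 : Nat.card (OrbitSpace D8 (Additive ℂˣ) 3) = 12 := by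
  obtain ⟨e, he⟩ := exists_equiv_orbitsD8
  refine card_orbitSpace_of_reps e (R := fun x y => ∃ O ∈ orbitsD8, x ∈ O ∧ y ∈ O) he
    ![(0, 0, 0), (1, 0, 0), (2, 0, 0), (3, 0, 0), (0, 1, 0), (0, 0, 1), (1, 0, 1), (2, 0, 1),
      (3, 0, 1), (1, 1, 0), (2, 1, 0), (3, 1, 0)] ?_
  simp only [orbitsD8_iff, ExistsUnique]
  decide +kernel

end D8

/-! ### Orbits for `ℤ/8` -/

section Z8

/-- A generating cocycle. -/
def Z8.gen (x y z : Z8) : ZMod 8 :=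
  x.toAdd * (((y.toAdd.val + z.toAdd.val) / 8 : ℕ) : ZMod 8)

/-- The carries along the powers of `a` add up to `a`, so the class `k` has invariant `k a²` at `a`.
Odd squares are 1 modulo 8, hence automorphisms fix every class. -/
theorem exists_equiv_Z8 :
    ∃ _ : H3 Z8 ≃+ ZMod 8, ∀ c d : H3 Z8, SameOrbit c d ↔ c = d := by
  have hF : IsAddCocycle Z8.gen := by unfold IsAddCocycle; decide +kernel
  obtain ⟨e, -, -, he⟩ := exists_equiv_of_invariants (fun _ : Z8 => 8) (by decide +kernel)
    (fun _ _ => rfl) (zClass hF)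
    (fun x g => x * ∑ i : Fin 8, Z8.gen g (g ^ (i : ℕ)) g) (fun x g => powInv_zClass g 8 _ hF x)
    (by unfold Function.Injective; decide +kernel) (cardLE_H3_zmod 8) (by simp)
  refine ⟨e, fun c d => (he c d).trans ⟨?_, ?_⟩⟩
  · rintro ⟨φ, h⟩
    refine e.injective ?_
    obtain ⟨g, hg⟩ : ∃ g : Z8, φ g = (Multiplicative.ofAdd 1 : Z8) := φ.surjective _
    have h1 := h g
    rw [hg] at h1
    -- The preimage of the generator is a generator, so its coordinate is odd and has square 1.
    have hg2 : g ^ 4 ≠ 1 := fun h2 => by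
      have h3 : φ (g ^ 4) = φ 1 := congrArg φ h2
      rw [map_pow φ, hg, map_one φ] at h3
      exact absurd h3 (by decide)
    clear hg h
    revert h1 hg2
    generalize e c = x
    generalize e d = y
    clear c d φ he e
    revert x y g
    decide +kernel
  · rintro rfl
    exact ⟨MulEquiv.refl _, fun _ => rfl⟩

theorem card_orbitSpace_of_eq {G : Type} [Group G] {n : ℕ} (h : ∃ _ : H3 G ≃+ ZMod n,
    ∀ c d : H3 G, SameOrbit c d ↔ c = d) : Nat.card (OrbitSpace G (Additive ℂˣ) 3) = n := by
  obtain ⟨e, he⟩ := h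
  have hb : Function.Bijective (Quotient.mk (orbitSetoid G (Additive ℂˣ) 3)) :=
    ⟨fun c d hcd => (he c d).1 (Quotient.exact hcd), Quotient.mk_surjective⟩
  rw [← Nat.card_eq_of_bijective _ hb, Nat.card_congr e.toEquiv, Nat.card_zmod]

end Z8

/-! ### Orbits for `Q₈` -/

section Q8

/-- The coordinate `A` of `xᴬaⁱ`. -/
def Q8.refl : Q8 → ℕ
  | QuaternionGroup.a _ => 0
  | QuaternionGroup.xa _ => 1

/-- The coordinate `i` of `xᴬaⁱ`. -/
def Q8.rot : Q8 → ℕ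
  | QuaternionGroup.a i => ZMod.val (n := 4) i
  | QuaternionGroup.xa i => ZMod.val (n := 4) i

/-- The carry in the product of two elements. -/
def Q8.carry (x y : Q8) : ℤ := ((-1) ^ y.refl * x.rot + y.rot + 2 * (x.refl * y.refl)) / 4

/-- A generating cocycle. -/
def Q8.gen (x y z : Q8) : ZMod 8 :=
  (((-1) ^ (y.refl + z.refl) * x.rot * (2 * Q8.carry y z + 3 * (y.refl * z.refl)) +
    4 * (((x.refl + y.refl) % 2 : ℕ) * z.refl) * Q8.carry x y +
    6 * x.refl * Q8.carry y z : ℤ) : ZMod 8)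

theorem Q8.isAddCocycle_gen : IsAddCocycle Q8.gen := by
  unfold IsAddCocycle
  decide +kernel

/-- The fundamental cycle of a quaternion group generated by `x` and `y`. -/
theorem isCycle_quaternion {G : Type} [Group G] (x y : G) (h1 : y * y = x * x)
    (h2 : x * y * (x * y) = x * x) (h3 : x * y * x = y) :
    IsCycle ![1, -1, -1, -1] ![(x, x, x), (x, y, y), (x * y, x * y, x), (x * y, x, y)] := by
  intro h
  simp [Fin.sum_univ_four, h1, h2, h3]
  abel

theorem evalCycle_pullback {G H : Type} [Group G] [Group H] (φ : G →* H) {m : ℕ} {s : Fin m → ℤ}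
    {z : Fin m → G × G × G} (hz : IsCycle s z) {z' : Fin m → H × H × H} (hz' : IsCycle s z')
    (h : ∀ i, z' i = (φ (z i).1, φ (z i).2.1, φ (z i).2.2)) (c : H3 H) :
    evalCycle hz (cohPullback (Additive ℂˣ) 3 φ c) = evalCycle hz' c := by
  obtain ⟨η, rfl⟩ := Cocycle3.exists_cls_eq c
  rw [← Cocycle3.cls_comap, evalCycle_cls, evalCycle_cls]
  refine Finset.sum_congr rfl fun i _ => ?_
  rw [h]
  rfl

/-- The relations together with `x * x ≠ 1` describe the pairs of standard quaternion generators.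
That the value does not depend on the pair gives invariance under automorphisms; that 5 is a unit
modulo 8 gives a class of order 8. -/
theorem Q8.eval_gen : ∀ x y : Q8, y * y = x * x → x * y * (x * y) = x * x → x * y * x = y →
    x * x ≠ 1 → ∑ i, ((![1, -1, -1, -1] : Fin 4 → ℤ) i : ZMod 8) *
      Q8.gen ((![(x, x, x), (x, y, y), (x * y, x * y, x), (x * y, x, y)] :
        Fin 4 → Q8 × Q8 × Q8) i).1
      ((![(x, x, x), (x, y, y), (x * y, x * y, x), (x * y, x, y)] : Fin 4 → Q8 × Q8 × Q8) i).2.1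
      ((![(x, x, x), (x, y, y), (x * y, x * y, x), (x * y, x, y)] :
        Fin 4 → Q8 × Q8 × Q8) i).2.2 = 5 := by
  decide +kernel

/-- Elements of `Q₈` have order at most 4, so their invariants kill four times a generator and
cannot separate eight classes. The cycle of a generating pair detects all of them, and automorphisms
only permute such pairs. -/
theorem exists_equiv_Q8 :
    ∃ _ : H3 Q8 ≃+ ZMod 8, ∀ c d : H3 Q8, SameOrbit c d ↔ c = d := by
  have key : ∀ (x y : Q8) (h1 : y * y = x * x) (h2 : x * y * (x * y) = x * x)
      (h3 : x * y * x = y), x * x ≠ 1 → ∀ k, evalCycle (isCycle_quaternion x y h1 h2 h3)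
        (zClass Q8.isAddCocycle_gen k) = zroot 8 (k * 5) := fun x y h1 h2 h3 h4 k => by
    rw [evalCycle_zClass, Q8.eval_gen x y h1 h2 h3 h4]
  have h5 : ∀ k l : ZMod 8, k * 5 = l * 5 → k = l := by decide
  have g1 : (QuaternionGroup.xa 0 : Q8) * .xa 0 = .a 1 * .a 1 := by decide
  have g2 : (QuaternionGroup.a 1 : Q8) * .xa 0 * (.a 1 * .xa 0) = .a 1 * .a 1 := by decide
  have g3 : (QuaternionGroup.a 1 : Q8) * .xa 0 * .a 1 = .xa 0 := by decide
  have g4 : (QuaternionGroup.a 1 : Q8) * .a 1 ≠ 1 := by decide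
  have hinj : Function.Injective (zClass Q8.isAddCocycle_gen) := fun k l h =>
    h5 _ _ (zroot_injective 8 (by rw [← key _ _ g1 g2 g3 g4, ← key _ _ g1 g2 g3 g4, h]))
  have hb := bijective_of_card _ hinj cardLE_H3_Q8 (Nat.card_zmod 8)
  refine ⟨(AddEquiv.ofBijective _ hb).symm, fun c d => ⟨?_, ?_⟩⟩
  · rintro ⟨φ, h⟩
    obtain ⟨k, rfl⟩ := hb.2 c
    obtain ⟨l, rfl⟩ := hb.2 d
    congr 1
    apply h5
    apply zroot_injective 8
    rw [← key _ _ g1 g2 g3 g4, ← h]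
    -- The images of the two generators satisfy the same relations, so `key` applies to them with
    -- the same value.
    have k1 := congrArg φ g1
    have k2 := congrArg φ g2
    have k3 := congrArg φ g3
    have k4 := φ.injective.ne g4
    simp only [map_mul, map_one] at k1 k2 k3 k4
    rw [evalCycle_pullback φ.toMonoidHom _ (isCycle_quaternion _ _ k1 k2 k3), key _ _ k1 k2 k3 k4]
    have k5 : ∀ (x y : Q8) (i : Fin 4), (![(φ x, φ x, φ x), (φ x, φ y, φ y),
        (φ x * φ y, φ x * φ y, φ x), (φ x * φ y, φ x, φ y)] : Fin 4 → Q8 × Q8 × Q8) i =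
        (φ.toMonoidHom ((![(x, x, x), (x, y, y), (x * y, x * y, x), (x * y, x, y)] :
          Fin 4 → Q8 × Q8 × Q8) i).1, φ.toMonoidHom ((![(x, x, x), (x, y, y), (x * y, x * y, x),
          (x * y, x, y)] : Fin 4 → Q8 × Q8 × Q8) i).2.1, φ.toMonoidHom ((![(x, x, x), (x, y, y),
          (x * y, x * y, x), (x * y, x, y)] : Fin 4 → Q8 × Q8 × Q8) i).2.2) := by
      intro x y i
      fin_cases i <;> simp
    exact k5 _ _
  · rintro rfl
    exact ⟨MulEquiv.refl _, cohPullback_id _ _ _⟩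

end Q8

/-! ### Orbits for `(ℤ/2)³`: subsets of the Fano plane and the kernel of `Sq¹` -/

section Z2Cubed

theorem isAddCocycle_trilinear (i j k : Fin 3) :
    IsAddCocycle (fun x y z : Z2Cubed => x.toAdd i * y.toAdd j * z.toAdd k) := by
  intro a b c d
  simp only [toAdd_mul, Pi.add_apply]
  ring

/-- The functions on `𝔽₂³` that vanish at the origin, in terms of their coefficients. -/
def cubicForm (x : Fin 7 → ZMod 2) (p q r : ZMod 2) : ZMod 2 :=
  x 0 * p + x 1 * q + x 2 * r + x 3 * (p * q) + x 4 * (p * r) + x 5 * (q * r) + x 6 * (p * q * r)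

/-- The value of `cubicForm` at an element of `(ℤ/2)³`. -/
def cubicFun (x : Fin 7 → ZMod 2) (g : Z2Cubed) : ZMod 2 :=
  cubicForm x (g.toAdd 0) (g.toAdd 1) (g.toAdd 2)

theorem cubicFun_ofAdd (x : Fin 7 → ZMod 2) (p q r : ZMod 2) :
    cubicFun x (Multiplicative.ofAdd ![p, q, r]) = cubicForm x p q r := rfl

/-- Vectors with one, two and three nonzero coordinates determine in turn the coefficients of degree
one, two and three. -/
theorem cubicForm_injective {x y : Fin 7 → ZMod 2}
    (h : ∀ p q r, cubicForm x p q r = cubicForm y p q r) : x = y := by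
  have h0 := h 1 0 0
  have h1 := h 0 1 0
  have h2 := h 0 0 1
  have h3 := h 1 1 0
  have h4 := h 1 0 1
  have h5 := h 0 1 1
  have h6 := h 1 1 1
  simp [cubicForm] at h0 h1 h2
  simp [cubicForm, h0, h1, h2] at h3 h4 h5
  simp [cubicForm, h0, h1, h2, h3, h4, h5] at h6
  ext i
  fin_cases i <;> simp [*]

theorem cubicFun_injective : Function.Injective cubicFun := fun _ _ h =>
  cubicForm_injective fun p q r => congrFun h (Multiplicative.ofAdd ![p, q, r])

/-- The exponents of the trilinear forms. -/
def triIndex : Fin 7 → Fin 3 × Fin 3 × Fin 3 :=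
  ![(0, 0, 0), (1, 1, 1), (2, 2, 2), (0, 0, 1), (0, 0, 2), (1, 1, 2), (0, 1, 2)]

/-- The classes of the trilinear forms. -/
noncomputable def triClass : (Fin 7 → ZMod 2) →+ H3 Z2Cubed :=
  ∑ t, (zClass (isAddCocycle_trilinear (triIndex t).1 (triIndex t).2.1 (triIndex t).2.2)).comp
    (Pi.evalAddMonoidHom _ t)

theorem Z2Cubed.sq_eq_one (g : Z2Cubed) : g ^ 2 = 1 := by
  revert g
  decide

/-- Of the two terms `F(g, gⁱ, g)` the one with `i = 0` vanishes by trilinearity. The other is a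
cubic monomial in the coordinates of `g`, in which repeated factors collapse over `𝔽₂`. -/
theorem powInv_triClass (x : Fin 7 → ZMod 2) (g : Z2Cubed) :
    powInv g 2 (Z2Cubed.sq_eq_one g) (triClass x) = zroot 2 (cubicFun x g) := by
  have hsq : ∀ a : ZMod 2, a * a = a := by decide
  have hsq' : ∀ a b : ZMod 2, a * (a * b) = a * b := by decide
  simp only [triClass, AddMonoidHom.finsetSum_apply, map_sum, AddMonoidHom.comp_apply,
    powInv_zClass, Pi.evalAddMonoidHom_apply]
  rw [← map_sum]
  congr 1
  simp [Fin.sum_univ_two, Fin.sum_univ_seven, triIndex, cubicFun, cubicForm, hsq, hsq',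
    mul_assoc]

/-- The 128 functions vanishing at the origin match the bound on `H³`. A class is therefore the same
as a set of nonzero vectors, that is, of points of the Fano plane, compatibly with automorphisms. -/
theorem exists_equiv_cubicFun : ∃ e : H3 Z2Cubed ≃+ (Fin 7 → ZMod 2),
    (∀ (φ : Z2Cubed ≃* Z2Cubed) c g,
      cubicFun (e (cohPullback (Additive ℂˣ) 3 φ.toMonoidHom c)) g = cubicFun (e c) (φ g)) ∧
    ∀ c d, SameOrbit c d ↔ ∃ φ : Z2Cubed ≃* Z2Cubed, ∀ g, cubicFun (e c) g = cubicFun (e d) (φ g) := by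
  obtain ⟨e, -, h⟩ := exists_equiv_of_invariants (fun _ : Z2Cubed => 2) Z2Cubed.sq_eq_one
    (fun _ _ => rfl) triClass cubicFun powInv_triClass cubicFun_injective cardLE_H3_Z2Cubed
    (by simp)
  exact ⟨e, h⟩

/-- The polynomials in the kernel of `Sq¹`. -/
noncomputable def quartic : (Fin 7 → ZMod 2) →+ Poly :=
  AddMonoidHom.mk' (fun x =>
    let X0 : Poly := MvPolynomial.X 0
    let X1 : Poly := MvPolynomial.X 1
    let X2 : Poly := MvPolynomial.X 2
    MvPolynomial.C (x 0) * X0 ^ 4 + MvPolynomial.C (x 1) * X1 ^ 4 + MvPolynomial.C (x 2) * X2 ^ 4 +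
    MvPolynomial.C (x 3) * (X0 ^ 2 * X1 ^ 2) + MvPolynomial.C (x 4) * (X0 ^ 2 * X2 ^ 2) +
    MvPolynomial.C (x 5) * (X1 ^ 2 * X2 ^ 2) +
    MvPolynomial.C (x 6) * (X0 ^ 2 * X1 * X2 + X0 * X1 ^ 2 * X2 + X0 * X1 * X2 ^ 2))
    (fun _ _ => by
      simp only [Pi.add_apply, map_add]
      ring)

/-- On `𝔽₂`-points powers collapse and the three terms of `m` give `3pqr = pqr`. Evaluation at
points therefore determines an element of the kernel of `Sq¹`, and it links the polynomial model to
the cohomological invariants. -/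
theorem eval_quartic (x : Fin 7 → ZMod 2) (g : Z2Cubed) :
    MvPolynomial.eval g.toAdd (quartic x) = cubicFun x g := by
  have h : ∀ p q r : ZMod 2, p ^ 4 = p ∧ p ^ 2 = p ∧
      p * q * r + p * q * r + p * q * r = p * q * r := by decide
  simp only [quartic, AddMonoidHom.mk'_apply, map_add, map_mul, map_pow, MvPolynomial.eval_C,
    MvPolynomial.eval_X, cubicFun, cubicForm, fun p => (h p 0 0).1, fun p => (h p 0 0).2.1,
    fun p q r => (h p q r).2.2]

theorem quartic_injective : Function.Injective quartic := fun _ _ h =>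
  cubicFun_injective (funext fun g => by rw [← eval_quartic, h, eval_quartic])

theorem sq1_X (i : Fin 3) : sq1 (MvPolynomial.X i) = MvPolynomial.X i ^ 2 :=
  MvPolynomial.mkDerivation_X _ _ _

theorem sq1_C (a : ZMod 2) : sq1 (MvPolynomial.C a) = 0 :=
  MvPolynomial.derivation_C sq1 a

theorem sq1_X_pow (i : Fin 3) (n : ℕ) :
    sq1 (MvPolynomial.X i ^ n) = (n : Poly) * MvPolynomial.X i ^ (n + 1) := by
  rcases n with _ | n
  · simp
  · rw [Derivation.leibniz_pow, sq1_X]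
    simp only [Nat.add_sub_cancel, smul_eq_mul, nsmul_eq_mul]
    ring

theorem poly_two : (2 : Poly) = 0 := CharTwo.two_eq_zero

theorem quartic_mem (x : Fin 7 → ZMod 2) : quartic x ∈ kerSq1 := by
  refine ⟨?_, ?_⟩
  · have hX : ∀ i : Fin 3, (MvPolynomial.X i : Poly) ∈
        MvPolynomial.homogeneousSubmodule (Fin 3) (ZMod 2) 1 :=
      fun i => MvPolynomial.isHomogeneous_X _ i
    have hm : ∀ {a b : Poly} {m n k : ℕ}, a.IsHomogeneous m → b.IsHomogeneous n → m + n = k →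
        (a * b).IsHomogeneous k := fun ha hb h => h ▸ ha.mul hb
    have hC : ∀ (a : ZMod 2) {b : Poly}, b.IsHomogeneous 4 →
        (MvPolynomial.C a * b).IsHomogeneous 4 := fun a _ hb =>
      hm (MvPolynomial.isHomogeneous_C _ a) hb rfl
    have hp : ∀ (i : Fin 3) (n : ℕ), (MvPolynomial.X i ^ n : Poly).IsHomogeneous n := fun i n => by
      simpa using (MvPolynomial.isHomogeneous_X (ZMod 2) i).pow n
    have h1 := fun i => MvPolynomial.isHomogeneous_X (σ := Fin 3) (ZMod 2) i
    exact ((((((hC _ (hp 0 4)).add (hC _ (hp 1 4))).add (hC _ (hp 2 4))).add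
      (hC _ (hm (hp 0 2) (hp 1 2) rfl))).add (hC _ (hm (hp 0 2) (hp 2 2) rfl))).add
      (hC _ (hm (hp 1 2) (hp 2 2) rfl))).add (hC _ (((hm (hm (hp 0 2) (h1 1) rfl) (h1 2) rfl).add
        (hm (hm (h1 0) (hp 1 2) rfl) (h1 2) rfl)).add (hm (hm (h1 0) (h1 1) rfl) (hp 2 2) rfl)))
  · change sq1 (quartic x) = 0
    simp only [quartic, AddMonoidHom.mk'_apply, map_add, Derivation.leibniz, sq1_C, sq1_X_pow,
      sq1_X, smul_eq_mul]
    push_cast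
    have h4 : (4 : Poly) = 0 := by linear_combination 2 * poly_two
    rw [h4]
    generalize (MvPolynomial.X 0 : Poly) = X0
    generalize (MvPolynomial.X 1 : Poly) = X1
    generalize (MvPolynomial.X 2 : Poly) = X2
    linear_combination (MvPolynomial.C (x 3) * (X0 ^ 2 * X1 ^ 3 + X0 ^ 3 * X1 ^ 2) +
      MvPolynomial.C (x 4) * (X0 ^ 2 * X2 ^ 3 + X0 ^ 3 * X2 ^ 2) +
      MvPolynomial.C (x 5) * (X1 ^ 2 * X2 ^ 3 + X1 ^ 3 * X2 ^ 2) +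
      MvPolynomial.C (x 6) * (X0 * X1 * X2 ^ 3 + X0 * X1 ^ 2 * X2 ^ 2 + X0 * X1 ^ 3 * X2 +
        X0 ^ 2 * X1 * X2 ^ 2 + X0 ^ 2 * X1 ^ 2 * X2 + X0 ^ 3 * X1 * X2)) * poly_two

/-- The exponent vector `(a, b, c)`. -/
noncomputable def expVec (a b c : ℕ) : Fin 3 →₀ ℕ := Finsupp.equivFunOnFinite.symm ![a, b, c]

theorem expVec_eq_iff {a b c a' b' c' : ℕ} :
    expVec a b c = expVec a' b' c' ↔ a = a' ∧ b = b' ∧ c = c' := by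
  simp only [expVec, EmbeddingLike.apply_eq_iff_eq]
  constructor
  · intro h
    exact ⟨congrFun h 0, congrFun h 1, congrFun h 2⟩
  · rintro ⟨rfl, rfl, rfl⟩
    rfl

theorem eq_expVec (d : Fin 3 →₀ ℕ) : d = expVec (d 0) (d 1) (d 2) := by
  ext i
  fin_cases i <;> rfl

theorem monomial_expVec (a b c : ℕ) (r : ZMod 2) : MvPolynomial.monomial (expVec a b c) r =
    (MvPolynomial.C r * (MvPolynomial.X 0 ^ a * MvPolynomial.X 1 ^ b * MvPolynomial.X 2 ^ c) :
      Poly) := by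
  rw [MvPolynomial.monomial_eq, Finsupp.prod_fintype _ _ (fun _ => pow_zero _),
    Fin.prod_univ_three]
  rfl

theorem sq1_monomial (a b c : ℕ) (r : ZMod 2) : sq1 (MvPolynomial.monomial (expVec a b c) r) =
    MvPolynomial.monomial (expVec (a + 1) b c) (a * r) +
    MvPolynomial.monomial (expVec a (b + 1) c) (b * r) +
    MvPolynomial.monomial (expVec a b (c + 1)) (c * r) := by
  simp only [monomial_expVec, Derivation.leibniz, sq1_C, sq1_X_pow, smul_eq_mul, map_mul,
    map_natCast]
  ring

/-- Truncated subtraction is harmless: when an exponent is 0, the factor in front of the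
corresponding term is 0 as well. -/
theorem coeff_sq1 (p : Poly) (a b c : ℕ) : (sq1 p).coeff (expVec a b c) =
    ((a - 1 : ℕ) : ZMod 2) * p.coeff (expVec (a - 1) b c) +
    ((b - 1 : ℕ) : ZMod 2) * p.coeff (expVec a (b - 1) c) +
    ((c - 1 : ℕ) : ZMod 2) * p.coeff (expVec a b (c - 1)) := by
  induction p using MvPolynomial.induction_on' with
  | monomial d r =>
    rw [eq_expVec d, sq1_monomial]
    simp only [MvPolynomial.coeff_add, MvPolynomial.coeff_monomial, expVec_eq_iff]
    congr 1
    · congr 1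
      · rcases a with _ | a
        · simp
        · by_cases h : d 0 = a ∧ d 1 = b ∧ d 2 = c
          · simp [h.1, h.2.1, h.2.2]
          · simp [h]
      · rcases b with _ | b
        · simp
        · by_cases h : d 0 = a ∧ d 1 = b ∧ d 2 = c
          · simp [h.1, h.2.1, h.2.2]
          · simp [h]
    · rcases c with _ | c
      · simp
      · by_cases h : d 0 = a ∧ d 1 = b ∧ d 2 = c
        · simp [h.1, h.2.1, h.2.2]
        · simp [h]
  | add p q hp hq =>
    rw [map_add, MvPolynomial.coeff_add, hp, hq]
    simp only [MvPolynomial.coeff_add]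
    ring

theorem quartic_eq (x : Fin 7 → ZMod 2) : quartic x =
    MvPolynomial.monomial (expVec 4 0 0) (x 0) + MvPolynomial.monomial (expVec 0 4 0) (x 1) +
    MvPolynomial.monomial (expVec 0 0 4) (x 2) + MvPolynomial.monomial (expVec 2 2 0) (x 3) +
    MvPolynomial.monomial (expVec 2 0 2) (x 4) + MvPolynomial.monomial (expVec 0 2 2) (x 5) +
    (MvPolynomial.monomial (expVec 2 1 1) (x 6) + MvPolynomial.monomial (expVec 1 2 1) (x 6) +
      MvPolynomial.monomial (expVec 1 1 2) (x 6)) := by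
  simp only [monomial_expVec, quartic, AddMonoidHom.mk'_apply]
  ring

theorem exists_quartic_eq {p : Poly} (hp : p ∈ kerSq1) : ∃ x, quartic x = p := by
  obtain ⟨h1, h2⟩ := hp
  have h2 : sq1 p = 0 := h2
  have key : ∀ a b c, _ := fun a b c => (coeff_sq1 p a b c).symm.trans
    (by rw [h2, MvPolynomial.coeff_zero])
  have hz3 : ((3 : ℕ) : ZMod 2) = 1 := by decide
  -- The coefficients in degree 5 of `sq1 p`: `e1` to `e6` kill the six monomials with exponents 3
  -- and 1, while `e7` and `e8` force the three monomials of `m` to have equal coefficients.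
  have e1 := key 4 1 0
  have e2 := key 4 0 1
  have e3 := key 1 4 0
  have e4 := key 0 4 1
  have e5 := key 1 0 4
  have e6 := key 0 1 4
  have e7 := key 2 2 1
  have e8 := key 2 1 2
  simp [hz3, -Nat.cast_ofNat] at e1 e2 e3 e4 e5 e6 e7 e8
  have e7' : p.coeff (expVec 1 2 1) = p.coeff (expVec 2 1 1) := CharTwo.add_eq_zero.1 e7
  have e8' : p.coeff (expVec 1 1 2) = p.coeff (expVec 2 1 1) := CharTwo.add_eq_zero.1 e8
  refine ⟨![p.coeff (expVec 4 0 0), p.coeff (expVec 0 4 0), p.coeff (expVec 0 0 4),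
    p.coeff (expVec 2 2 0), p.coeff (expVec 2 0 2), p.coeff (expVec 0 2 2),
    p.coeff (expVec 2 1 1)], ?_⟩
  rw [quartic_eq]
  ext d
  rw [eq_expVec d]
  generalize d 0 = a
  generalize d 1 = b
  generalize d 2 = c
  simp only [MvPolynomial.coeff_add, MvPolynomial.coeff_monomial, expVec_eq_iff]
  by_cases h : a + b + c = 4
  · obtain ⟨rfl⟩ : c = 4 - a - b := by omega
    have ha : a ≤ 4 := by omega
    have hb : b ≤ 4 := by omega
    interval_cases a <;> interval_cases b <;> first | (exfalso; omega) | simp [*]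
  · have h0 : p.coeff (expVec a b c) = 0 := by
      by_contra h'
      apply h
      have := h1 h'
      rw [Finsupp.weight_apply, Finsupp.sum_fintype _ _ (by simp), Fin.sum_univ_three] at this
      simpa [expVec] using this
    rw [h0]
    have hne : ∀ x y z : ℕ, x + y + z = 4 → ¬(x = a ∧ y = b ∧ z = c) := by
      rintro x y z hxyz ⟨rfl, rfl, rfl⟩
      exact h hxyz
    simp [hne 4 0 0 rfl, hne 0 4 0 rfl, hne 0 0 4 rfl, hne 2 2 0 rfl, hne 2 0 2 rfl,
      hne 0 2 2 rfl, hne 2 1 1 rfl, hne 1 2 1 rfl, hne 1 1 2 rfl]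

/-- On linear forms `Sq¹` is squaring, which is additive in characteristic 2 and fixes coefficients
in `𝔽₂`. So it commutes with substitution on the variables, and the Leibniz rule gives the rest. -/
theorem sq1_linSubst (φ : Z2Cubed ≃* Z2Cubed) (p : Poly) :
    sq1 (linSubst φ p) = linSubst φ (sq1 p) := by
  induction p using MvPolynomial.induction_on with
  | C a => rw [linSubst, MvPolynomial.aeval_C, sq1_C, map_zero]; exact sq1_C a
  | add p q hp hq => simp only [map_add, hp, hq]
  | mul_X p i hp =>
    have h : sq1 (linSubst φ (MvPolynomial.X i)) = linSubst φ (MvPolynomial.X i) ^ 2 := by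
      have hsq : ∀ a : ZMod 2, a ^ 2 = a := by decide
      simp only [linSubst, MvPolynomial.aeval_X, map_sum, Derivation.leibniz, sq1_C, sq1_X,
        smul_eq_mul, mul_zero, add_zero]
      rw [CharTwo.sum_sq]
      refine Finset.sum_congr rfl fun j _ => ?_
      rw [mul_pow, ← map_pow, hsq]
    rw [map_mul, Derivation.leibniz, Derivation.leibniz, hp, h, sq1_X]
    simp only [smul_eq_mul, map_add, map_mul, map_pow]

theorem linSubst_mem {p : Poly} (φ : Z2Cubed ≃* Z2Cubed) (hp : p ∈ kerSq1) :
    linSubst φ p ∈ kerSq1 := by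
  refine ⟨?_, ?_⟩
  · have h1 : p.IsHomogeneous 4 := hp.1
    have h2 : (linSubst φ p).IsHomogeneous (1 * 4) := h1.aeval _ fun i =>
      MvPolynomial.IsHomogeneous.sum _ _ _ fun j _ => by
        simpa using (MvPolynomial.isHomogeneous_C (Fin 3) _).mul
          (MvPolynomial.isHomogeneous_X (ZMod 2) j)
    exact h2
  · change sq1 (linSubst φ p) = 0
    have h2 : sq1 p = 0 := hp.2
    rw [sq1_linSubst, h2, map_zero]

/-- Both sides are algebra homomorphisms in `p`, so only the variables matter; there the claim is
the expansion of the linear map `φ` in the standard basis. -/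
theorem eval_linSubst (φ : Z2Cubed ≃* Z2Cubed) (p : Poly) (g : Z2Cubed) :
    MvPolynomial.eval g.toAdd (linSubst φ p) = MvPolynomial.eval (φ g).toAdd p := by
  have h : (MvPolynomial.aeval g.toAdd).comp (linSubst φ) =
      (MvPolynomial.aeval (φ g).toAdd : Poly →ₐ[ZMod 2] ZMod 2) := by
    refine MvPolynomial.algHom_ext fun i => ?_
    simp only [AlgHom.comp_apply, linSubst, MvPolynomial.aeval_X, map_sum, map_mul,
      MvPolynomial.aeval_C, Algebra.algebraMap_self, RingHom.id_apply]
    let f₀ : (Fin 3 → ZMod 2) →+ (Fin 3 → ZMod 2) :=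
      AddMonoidHom.mk' (fun v => (φ (Multiplicative.ofAdd v)).toAdd) fun v w => by
        rw [ofAdd_add, map_mul, toAdd_mul]
    let f : (Fin 3 → ZMod 2) →ₗ[ZMod 2] (Fin 3 → ZMod 2) := f₀.toZModLinearMap 2
    have hf := congrFun (f.pi_apply_eq_sum_univ g.toAdd) i
    rw [Finset.sum_apply] at hf
    refine Eq.trans (Finset.sum_congr rfl fun j _ => ?_)
      (hf.symm : _ = (φ g).toAdd i)
    rw [mul_comm, Pi.smul_apply, smul_eq_mul]
    congr 1
    change (φ (Multiplicative.ofAdd (Pi.single j 1))).toAdd i =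
      (φ (Multiplicative.ofAdd (fun k => if j = k then 1 else 0))).toAdd i
    have hs : (Pi.single j 1 : Fin 3 → ZMod 2) = fun k => if j = k then 1 else 0 := by
      funext k
      simp [Pi.single_apply, eq_comm]
    rw [hs]
  exact congrArg (fun f : Poly →ₐ[ZMod 2] ZMod 2 => f p) h

/-- The endomorphism with the given matrix. -/
def matHom (M : Fin 3 → Fin 3 → ZMod 2) : Z2Cubed →* Z2Cubed :=
  AddMonoidHom.toMultiplicative (AddMonoidHom.mk' (fun v => fun i => ∑ j, M i j * v j)
    (fun v w => by ext i; simp [mul_add, Finset.sum_add_distrib]))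

theorem matHom_apply (M : Fin 3 → Fin 3 → ZMod 2) (v : Z2Cubed) (i : Fin 3) :
    (matHom M v).toAdd i = M i 0 * v.toAdd 0 + M i 1 * v.toAdd 1 + M i 2 * v.toAdd 2 :=
  Fin.sum_univ_three (fun j => M i j * v.toAdd j)

/-- The coefficients of the representatives of the orbits. -/
def repsBool : Fin 10 → Fin 7 → Bool :=
  ![![false, false, false, false, false, false, false],
    ![true, false, false, false, false, false, false],
    ![false, false, false, true, false, false, false],
    ![true, false, false, false, false, true, false],
    ![true, true, false, true, false, false, false],
    ![true, false, false, false, false, false, true],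
    ![true, false, false, false, false, true, true],
    ![false, false, false, true, true, true, true],
    ![false, false, false, false, false, false, true],
    ![true, true, true, true, true, true, true]]

/-- The bijection of `Bool` with `𝔽₂`. -/
def ofBool (b : Bool) : ZMod 2 := cond b 1 0

/-- The coefficients of the representatives of the orbits. -/
def repsCoeff (i : Fin 10) (t : Fin 7) : ZMod 2 := ofBool (repsBool i t)

theorem quartic_repsCoeff (i : Fin 10) : quartic (repsCoeff i) = repsZ2Cubed i := by
  fin_cases i <;> simp [quartic, repsCoeff, repsBool, ofBool, repsZ2Cubed] <;> ring

/-- The numbers of points and of collinear triples in the support. -/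
def pointLineCount (f : Z2Cubed → ZMod 2) : ℕ × ℕ :=
  ((Finset.univ.filter fun g => f g = 1).card,
    (Finset.univ.filter fun p : Z2Cubed × Z2Cubed =>
      f p.1 = 1 ∧ f p.2 = 1 ∧ f (p.1 * p.2) = 1).card)

theorem pointLineCount_comp (f : Z2Cubed → ZMod 2) (φ : Z2Cubed ≃* Z2Cubed) :
    pointLineCount (fun g => f (φ g)) = pointLineCount f := by
  unfold pointLineCount
  refine Prod.ext ?_ ?_ <;> dsimp only
  · refine Finset.card_equiv φ.toEquiv fun g => ?_
    rw [Finset.mem_filter_univ, Finset.mem_filter_univ]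
    rfl
  · refine Finset.card_equiv (φ.toEquiv.prodCongr φ.toEquiv) fun p => ?_
    rw [Finset.mem_filter_univ, Finset.mem_filter_univ, map_mul]
    rfl

/-- The function `cubicForm` in terms of Boolean operations. -/
def cubicBool (x : Fin 7 → Bool) (p q r : Bool) : Bool :=
  (x 0 && p) ^^ (x 1 && q) ^^ (x 2 && r) ^^ (x 3 && (p && q)) ^^ (x 4 && (p && r)) ^^
    (x 5 && (q && r)) ^^ (x 6 && (p && q && r))

/-- A linear form in terms of Boolean operations. -/
def linBool (a b c p q r : Bool) : Bool := (a && p) ^^ (b && q) ^^ (c && r)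

theorem ofBool_xor (a b : Bool) : ofBool (a ^^ b) = ofBool a + ofBool b := by
  revert a b
  decide

theorem ofBool_and (a b : Bool) : ofBool (a && b) = ofBool a * ofBool b := by
  revert a b
  decide

theorem exists_ofBool (a : ZMod 2) : ∃ b, a = ofBool b := by
  revert a
  decide

theorem ofBool_cubicBool (x : Fin 7 → Bool) (p q r : Bool) : ofBool (cubicBool x p q r) =
    cubicForm (fun t => ofBool (x t)) (ofBool p) (ofBool q) (ofBool r) := by
  simp only [cubicBool, cubicForm, ofBool_xor, ofBool_and]

theorem ofBool_linBool (a b c p q r : Bool) : ofBool (linBool a b c p q r) =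
    ofBool a * ofBool p + ofBool b * ofBool q + ofBool c * ofBool r := by
  simp only [linBool, ofBool_xor, ofBool_and]

/-- Conjunction over the two Booleans. -/
def allBool (f : Bool → Bool) : Bool := f false && f true

/-- Disjunction over the two Booleans. -/
def anyBool (f : Bool → Bool) : Bool := f false || f true

theorem allBool_iff (f : Bool → Bool) : allBool f = true ↔ ∀ b, f b = true := by
  simp [allBool]

theorem anyBool_iff (f : Bool → Bool) : anyBool f = true ↔ ∃ b, f b = true := by
  simp [anyBool]

/-- The number of points in the support. -/
def countBool (x : Fin 7 → Bool) : ℕ :=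
  (cubicBool x true false false).toNat + (cubicBool x false true false).toNat +
  (cubicBool x false false true).toNat + (cubicBool x true true false).toNat +
  (cubicBool x true false true).toNat + (cubicBool x false true true).toNat +
  (cubicBool x true true true).toNat

/-- Some invertible linear substitution takes the function with coefficients `y` to that with
coefficients `x`. -/
def substTakes (x y : Fin 7 → Bool) : Bool :=
  anyBool fun a => anyBool fun b => anyBool fun c => anyBool fun d => anyBool fun e =>
  anyBool fun f => anyBool fun g => anyBool fun h => anyBool fun k =>
    (allBool fun p => allBool fun q => allBool fun r =>
      (cubicBool x p q r == cubicBool y (linBool a b c p q r) (linBool d e f p q r)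
        (linBool g h k p q r))) &&
    -- The three linear forms vanish together only at the origin, so the matrix is invertible.
    (allBool fun p => allBool fun q => allBool fun r =>
      linBool a b c p q r || linBool d e f p q r || linBool g h k p q r || !(p || q || r))

/-- Every subset of the Fano plane is moved to one of ten by a collineation. The number of points is
preserved, so comparing it first discards most representatives before the search over matrices. -/
theorem exists_substTakes : ∀ x0 x1 x2 x3 x4 x5 x6 : Bool, ∃ i : Fin 10,
    (countBool ![x0, x1, x2, x3, x4, x5, x6] == countBool (repsBool i) &&
      substTakes ![x0, x1, x2, x3, x4, x5, x6] (repsBool i)) = true := by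
  decide +kernel

/-- The second number counts ordered pairs of support points whose product is in the support. The
functions vanish at the identity, so the two points are distinct and each line inside the support
contributes 6. -/
theorem pointLineCount_reps : ∀ i : Fin 10, pointLineCount (cubicFun (repsCoeff i)) =
    ![(0, 0), (4, 0), (2, 0), (4, 6), (6, 24), (3, 0), (5, 12), (3, 6), (1, 0), (7, 42)] i := by
  decide +kernel

theorem pointLineCount_reps_injective (i j : Fin 10)
    (h : pointLineCount (cubicFun (repsCoeff i)) = pointLineCount (cubicFun (repsCoeff j))) :
    i = j := by
  rw [pointLineCount_reps, pointLineCount_reps] at h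
  revert i j
  decide

theorem exists_rep (x : Fin 7 → ZMod 2) : ∃ (i : Fin 10) (φ : Z2Cubed ≃* Z2Cubed),
    ∀ g, cubicFun x g = cubicFun (repsCoeff i) (φ g) := by
  choose y hy using fun t => exists_ofBool (x t)
  obtain rfl : x = fun t => ofBool (y t) := funext hy
  obtain ⟨i, hi⟩ := exists_substTakes (y 0) (y 1) (y 2) (y 3) (y 4) (y 5) (y 6)
  have hx : ![y 0, y 1, y 2, y 3, y 4, y 5, y 6] = y := by
    ext t
    fin_cases t <;> rfl
  rw [hx, Bool.and_eq_true] at hi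
  have h2 := hi.2
  simp only [substTakes, anyBool_iff, allBool_iff, Bool.and_eq_true, beq_iff_eq] at h2
  obtain ⟨a, b, c, d, e, f, g, h, k, h1, h2⟩ := h2
  let ψ := matHom (fun s t => ofBool (![![a, b, c], ![d, e, f], ![g, h, k]] s t))
  have hψ : ∀ p q r : Bool, ψ (Multiplicative.ofAdd ![ofBool p, ofBool q, ofBool r]) =
      Multiplicative.ofAdd ![ofBool (linBool a b c p q r), ofBool (linBool d e f p q r),
        ofBool (linBool g h k p q r)] := fun p q r => by
    apply Multiplicative.toAdd.injective
    funext t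
    refine (matHom_apply _ _ _).trans ?_
    simp only [ofBool_linBool]
    fin_cases t <;> rfl
  have hv : ∀ v : Z2Cubed, ∃ p q r : Bool,
      v = Multiplicative.ofAdd ![ofBool p, ofBool q, ofBool r] := fun v => by
    obtain ⟨p, hp⟩ := exists_ofBool (v.toAdd 0)
    obtain ⟨q, hq⟩ := exists_ofBool (v.toAdd 1)
    obtain ⟨r, hr⟩ := exists_ofBool (v.toAdd 2)
    refine ⟨p, q, r, ?_⟩
    rw [← hp, ← hq, ← hr]
    apply Multiplicative.toAdd.injective
    funext t
    fin_cases t <;> rfl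
  have hinj : Function.Injective ψ := by
    rw [injective_iff_map_eq_one]
    intro v hv'
    obtain ⟨p, q, r, rfl⟩ := hv v
    rw [hψ] at hv'
    have h0 : ∀ z, ofBool z = 0 → z = false := by decide
    have e0 := h0 _ (congrFun hv' 0)
    have e1 := h0 _ (congrFun hv' 1)
    have e2 := h0 _ (congrFun hv' 2)
    have e3 := h2 p q r
    simp only [e0, e1, e2, Bool.false_or, Bool.not_eq_true', Bool.or_eq_false_iff] at e3
    obtain ⟨⟨rfl, rfl⟩, rfl⟩ := e3
    decide
  refine ⟨i, MulEquiv.ofBijective ψ (Finite.injective_iff_bijective.1 hinj), fun v => ?_⟩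
  obtain ⟨p, q, r, rfl⟩ := hv v
  change _ = cubicFun _ (ψ _)
  rw [hψ, cubicFun_ofAdd, cubicFun_ofAdd]
  change cubicForm (fun t => ofBool (y t)) _ _ _ = cubicForm (fun t => ofBool (repsBool i t)) _ _ _
  rw [← ofBool_cubicBool, ← ofBool_cubicBool, h1]

theorem existsUnique_rep (x : Fin 7 → ZMod 2) : ∃! i, ∃ φ : Z2Cubed ≃* Z2Cubed,
    ∀ g, cubicFun x g = cubicFun (repsCoeff i) (φ g) := by
  obtain ⟨i, φ, hφ⟩ := exists_rep x
  refine ⟨i, ⟨φ, hφ⟩, ?_⟩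
  rintro j ⟨φ', hφ'⟩
  apply pointLineCount_reps_injective
  rw [← pointLineCount_comp (cubicFun (repsCoeff j)) φ',
    ← pointLineCount_comp (cubicFun (repsCoeff i)) φ, ← funext hφ, ← funext hφ']

theorem exists_equiv_kerSq1 : ∃ e : H3 Z2Cubed ≃+ kerSq1,
    (∀ (φ : Z2Cubed ≃* Z2Cubed) (c : H3 Z2Cubed),
      (e (cohPullback (Additive ℂˣ) 3 φ.toMonoidHom c) : Poly) = linSubst φ (e c)) ∧
    (∀ i, ∃ c : H3 Z2Cubed, (e c : Poly) = repsZ2Cubed i) ∧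
    ∀ c : H3 Z2Cubed, ∃! i, ∃ d : H3 Z2Cubed, SameOrbit c d ∧ (e d : Poly) = repsZ2Cubed i := by
  obtain ⟨e, h1, h2⟩ := exists_equiv_cubicFun
  let q : (Fin 7 → ZMod 2) →+ kerSq1 := quartic.codRestrict kerSq1.toAddSubgroup quartic_mem
  have hq : Function.Bijective q := by
    refine ⟨fun x y h => quartic_injective (congrArg Subtype.val h), fun p => ?_⟩
    obtain ⟨x, hx⟩ := exists_quartic_eq p.2
    exact ⟨x, Subtype.ext hx⟩
  refine ⟨e.trans (AddEquiv.ofBijective q hq), fun φ c => ?_, fun i => ?_, fun c => ?_⟩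
  · obtain ⟨y, hy⟩ := exists_quartic_eq (linSubst_mem φ (quartic_mem (e c)))
    refine Eq.trans (congrArg quartic ?_) hy
    apply cubicFun_injective
    funext g
    refine (h1 φ c g).trans ?_
    rw [← eval_quartic, ← eval_quartic, hy, eval_linSubst]
  · exact ⟨e.symm (repsCoeff i), (congrArg quartic (e.apply_symm_apply _)).trans
      (quartic_repsCoeff i)⟩
  · obtain ⟨i, hi, hu⟩ := existsUnique_rep (e c)
    refine ⟨i, ⟨e.symm (repsCoeff i), (h2 _ _).2 ?_, (congrArg quartic
      (e.apply_symm_apply _)).trans (quartic_repsCoeff i)⟩, ?_⟩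
    · rw [e.apply_symm_apply]
      exact hi
    · rintro j ⟨d, hd, hj⟩
      have hd' : e d = repsCoeff j := quartic_injective (hj.trans (quartic_repsCoeff j).symm)
      exact hu j (by simpa only [hd'] using (h2 _ _).1 hd)

theorem card_orbitSpace_Z2Cubed : Nat.card (OrbitSpace Z2Cubed (Additive ℂˣ) 3) = 10 := by
  obtain ⟨e, -, h⟩ := exists_equiv_cubicFun
  exact card_orbitSpace_of_reps e (R := fun x y => ∃ φ : Z2Cubed ≃* Z2Cubed,
    ∀ g, cubicFun x g = cubicFun y (φ g)) h repsCoeff existsUnique_rep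

end Z2Cubed

/-! ### Kernels and normality from quasi-inverses -/

section VonNeumannRegular

variable {C : Type u} [Category.{v} C] [Preadditive C]

/-- Every morphism has a quasi-inverse. -/
def IsRegularCategory (C : Type u) [Category.{v} C] : Prop :=
  ∀ {X Y : C} (f : X ⟶ Y), ∃ g : Y ⟶ X, f ≫ g ≫ f = f

/-- If `f ≫ g ≫ f = f`, then `𝟙 X - f ≫ g` is an idempotent, and splitting it yields the kernel of
`f`. -/
theorem IsRegularCategory.hasKernels [IsIdempotentComplete C] (h : IsRegularCategory C) :
    HasKernels C where
  has_limit {X Y} f := by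
    obtain ⟨g, hg⟩ := h f
    obtain ⟨K, i, p, hip, hpi⟩ := IsIdempotentComplete.idempotents_split X (𝟙 X - f ≫ g) (by
      simp [reassoc_of% hg])
    have h0 : i ≫ f = 0 := by
      have h1 : i ≫ (p ≫ i) ≫ f = i ≫ f := by rw [Category.assoc, reassoc_of% hip]
      rw [← h1, hpi]
      simp [hg]
    refine HasLimit.mk ⟨KernelFork.ofι i h0, KernelFork.IsLimit.ofι i h0 (fun k _ => k ≫ p)
      (fun k hk => ?_) fun k hk m hm => ?_⟩
    · rw [Category.assoc, hpi]
      simp [reassoc_of% hk]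
    · rw [← hm, Category.assoc, hip, Category.comp_id]

theorem IsRegularCategory.hasCokernels [IsIdempotentComplete C] (h : IsRegularCategory C) :
    HasCokernels C where
  has_colimit {X Y} f := by
    obtain ⟨g, hg⟩ := h f
    obtain ⟨Q, j, q, hjq, hqj⟩ := IsIdempotentComplete.idempotents_split Y (𝟙 Y - g ≫ f) (by
      simp [hg])
    have h0 : f ≫ q = 0 := by
      have h1 : (f ≫ q ≫ j) ≫ q = f ≫ q := by simp only [Category.assoc, hjq, Category.comp_id]
      rw [← h1, hqj]
      simp [hg]
    refine HasColimit.mk ⟨CokernelCofork.ofπ q h0, CokernelCofork.IsColimit.ofπ q h0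
      (fun k _ => j ≫ k) (fun k hk => ?_) fun k hk m hm => ?_⟩
    · rw [reassoc_of% hqj]
      simp [hk]
    · rw [← hm, reassoc_of% hjq]

/-- Cancelling a monomorphism `f` in `f ≫ g ≫ f = f` splits it, and a split `f` is the kernel of `𝟙
Y - g ≫ f`. -/
theorem IsRegularCategory.isNormalMonoCategory (h : IsRegularCategory C) :
    IsNormalMonoCategory C where
  normalMonoOfMono {X Y} f _ := by
    obtain ⟨g, hg⟩ := h f
    have h1 : f ≫ g = 𝟙 X := by
      rw [← cancel_mono f, Category.assoc, hg, Category.id_comp]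
    have h0 : f ≫ (𝟙 Y - g ≫ f) = 0 := by simp [hg]
    refine ⟨⟨Y, 𝟙 Y - g ≫ f, h0, KernelFork.IsLimit.ofι f h0 (fun k _ => k ≫ g)
      (fun k hk => ?_) fun k hk m hm => ?_⟩⟩
    · rw [Preadditive.comp_sub, Category.comp_id, sub_eq_zero] at hk
      rw [Category.assoc, ← hk]
    · rw [← hm, Category.assoc, h1, Category.comp_id]

theorem IsRegularCategory.isNormalEpiCategory (h : IsRegularCategory C) :
    IsNormalEpiCategory C where
  normalEpiOfEpi {X Y} f _ := by
    obtain ⟨g, hg⟩ := h f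
    have h1 : g ≫ f = 𝟙 Y := by
      rw [← cancel_epi f, hg, Category.comp_id]
    have h0 : (𝟙 X - f ≫ g) ≫ f = 0 := by simp [hg]
    refine ⟨⟨X, 𝟙 X - f ≫ g, h0, CokernelCofork.IsColimit.ofπ f h0 (fun k _ => g ≫ k)
      (fun k hk => ?_) fun k hk m hm => ?_⟩⟩
    · rw [Preadditive.sub_comp, Category.id_comp, sub_eq_zero, Category.assoc] at hk
      exact hk.symm
    · rw [← hm, reassoc_of% h1]

end VonNeumannRegular

/-! ### Finite direct sum decompositions -/

section Decomposition

variable {C : Type u} [Category.{v} C] [Preadditive C]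

/-- `X` is a direct sum of the objects `S i`. -/
structure Decomposition {J : Type} [Fintype J] (X : C) (S : J → C) where
  ι : ∀ i, S i ⟶ X
  π : ∀ i, X ⟶ S i
  ι_π : ∀ i, ι i ≫ π i = 𝟙 (S i)
  ι_π_ne : ∀ i j, i ≠ j → ι i ≫ π j = 0
  total : ∑ i, π i ≫ ι i = 𝟙 X

variable {J K : Type} [Fintype J] [Fintype K]

/-- Change of the index set of a decomposition. -/
def Decomposition.reindex {X : C} {S : J → C} (D : Decomposition X S) (e : K ≃ J) :
    Decomposition X (fun k => S (e k)) where
  ι k := D.ι (e k)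
  π k := D.π (e k)
  ι_π k := D.ι_π (e k)
  ι_π_ne _ _ h := D.ι_π_ne _ _ (e.injective.ne h)
  total := (e.sum_comp (fun j => D.π j ≫ D.ι j)).trans D.total

open Classical in
theorem Decomposition.nonempty_iso {X : C} {S : J → C} (D : Decomposition X S)
    [HasBiproduct S] : Nonempty (X ≅ ⨁ S) :=
  ⟨biproduct.uniqueUpToIso S (isBilimitOfTotal
    ({ pt := X
       π := D.π
       ι := D.ι
       ι_π := fun i j => by
        split_ifs with h
        · subst h
          simpa using D.ι_π i
        · exact D.ι_π_ne i j h } : Bicone S) D.total)⟩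

/-- The decomposition given by an isomorphism with a direct sum. -/
noncomputable def Decomposition.ofIso {X : C} {S : J → C} [HasBiproduct S]
    (e : X ≅ ⨁ S) : Decomposition X S where
  ι i := biproduct.ι S i ≫ e.inv
  π i := e.hom ≫ biproduct.π S i
  ι_π i := by simp
  ι_π_ne i j h := by simp [biproduct.ι_π_ne _ h]
  total := by
    classical
    have h := biproduct.total (f := S)
    calc ∑ i, (e.hom ≫ biproduct.π S i) ≫ biproduct.ι S i ≫ e.inv
        = e.hom ≫ (∑ i, biproduct.π S i ≫ biproduct.ι S i) ≫ e.inv := by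
          simp only [Preadditive.sum_comp, Preadditive.comp_sum, Category.assoc]
      _ = 𝟙 X := by rw [h]; simp

theorem Decomposition.hom_ext {X Y : C} {S : J → C} (D : Decomposition X S) {f g : X ⟶ Y}
    (h : ∀ i, D.ι i ≫ f = D.ι i ≫ g) : f = g := by
  rw [← Category.id_comp f, ← Category.id_comp g, ← D.total]
  simp only [Preadditive.sum_comp, Category.assoc, h]

end Decomposition

/-! ### Objects with only scalar endomorphisms -/

section Brick

variable {C : Type u} [Category.{v} C] [Preadditive C] [Linear ℂ C]

/-- Objects whose endomorphisms are the scalars. -/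
def IsBrick (X : C) : Prop := Function.Bijective (fun c : ℂ => c • 𝟙 X)

theorem IsBrick.id_ne_zero {X : C} (h : IsBrick X) : 𝟙 X ≠ 0 := fun h0 =>
  one_ne_zero (h.1 (by simp [h0] : (1 : ℂ) • 𝟙 X = (0 : ℂ) • 𝟙 X))

theorem IsBrick.exists_smul {X : C} (h : IsBrick X) (f : X ⟶ X) : ∃ c : ℂ, f = c • 𝟙 X :=
  ⟨_, (h.2 f).choose_spec.symm⟩

theorem IsBrick.eq_of_smul {X : C} (h : IsBrick X) {c d : ℂ} (hcd : c • 𝟙 X = d • 𝟙 X) : c = d :=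
  h.1 hcd

theorem IsBrick.of_iso {X Y : C} (e : X ≅ Y) (h : IsBrick X) : IsBrick Y := by
  refine ⟨fun c d hcd => h.1 ?_, fun f => ?_⟩
  · have h1 : e.hom ≫ (c • 𝟙 Y) ≫ e.inv = e.hom ≫ (d • 𝟙 Y) ≫ e.inv := by
      rw [show c • 𝟙 Y = d • 𝟙 Y from hcd]
    simpa using h1
  · obtain ⟨c, hc⟩ := h.2 (e.hom ≫ f ≫ e.inv)
    refine ⟨c, ?_⟩
    have h1 : e.inv ≫ (c • 𝟙 X) ≫ e.hom = e.inv ≫ (e.hom ≫ f ≫ e.inv) ≫ e.hom := by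
      rw [← hc]
    simpa using h1

theorem isBrick_of_simple [HasKernels C] (X : C) [Simple X] [FiniteDimensional ℂ (X ⟶ X)] :
    IsBrick X := by
  refine ⟨fun c d h => ?_, fun f => endomorphism_simple_eq_smul_id ℂ f⟩
  have h1 : (c - d) • 𝟙 X = 0 := by
    rw [sub_smul, sub_eq_zero]
    exact h
  rcases smul_eq_zero.1 h1 with h2 | h2
  · exact sub_eq_zero.1 h2
  · exact absurd h2 (id_nonzero X)

/-- A nonzero idempotent of a brick is the identity. -/
theorem IsBrick.eq_id_of_idem {X : C} (h : IsBrick X) {e : X ⟶ X} (he : e ≫ e = e) (h0 : e ≠ 0) :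
    e = 𝟙 X := by
  obtain ⟨c, rfl⟩ := h.exists_smul e
  have h1 : (c * c) • 𝟙 X = c • 𝟙 X := by simpa [smul_smul] using he
  have hc : c ≠ 0 := by
    rintro rfl
    simp at h0
  rw [mul_left_cancel₀ hc ((h.eq_of_smul h1).trans (mul_one c).symm), one_smul]

/-- A nonzero monomorphism `f` into a brick has a quasi-inverse `g` which is a retraction, and `g ≫
f` is a nonzero idempotent of the brick, hence the identity. -/
theorem IsBrick.simple (hr : IsRegularCategory C) {X : C} (h : IsBrick X) : Simple X where
  mono_isIso_iff_nonzero {Y} f _ := by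
    constructor
    · intro hf h0
      apply h.id_ne_zero
      rw [← IsIso.inv_hom_id f]
      exact (congrArg (inv f ≫ ·) h0).trans comp_zero
    · intro h0
      obtain ⟨g, hg⟩ := hr f
      have h1 : f ≫ g = 𝟙 Y := by
        rw [← cancel_mono f, Category.assoc, hg, Category.id_comp]
      refine ⟨g, h1, h.eq_id_of_idem (by simp [hg]) fun h2 => h0 ?_⟩
      rw [← hg, h2, comp_zero]

end Brick

/-! ### Invertible objects and their squared dimension -/

section Invertible

variable {C : Type u} [Category.{v} C] [MonoidalCategory C]

/-- `X` is invertible for the tensor product. -/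
def IsInvertible (X : C) : Prop := ∃ Y : C, Nonempty (X ⊗ Y ≅ 𝟙_ C) ∧ Nonempty (Y ⊗ X ≅ 𝟙_ C)

theorem IsInvertible.isEquivalence {X : C} (h : IsInvertible X) :
    (tensorLeft X).IsEquivalence := by
  obtain ⟨Y, ⟨e⟩, ⟨e'⟩⟩ := h
  refine (CategoryTheory.Equivalence.mk (tensorLeft X) (tensorLeft Y) ?_ ?_).isEquivalence_functor
  · exact (leftUnitorNatIso C).symm ≪≫ (tensoringLeft C).mapIso e'.symm ≪≫ tensorLeftTensor Y X
  · exact (tensorLeftTensor X Y).symm ≪≫ (tensoringLeft C).mapIso e ≪≫ leftUnitorNatIso C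

/-- When tensoring with `X` is an equivalence, unit and counit of the duality adjunction are
isomorphisms; at the unit object they are the coevaluation and the evaluation up to unitors. -/
theorem isIso_coevaluation {X Y : C} (p : ExactPairing X Y) (h : (tensorLeft X).IsEquivalence) :
    IsIso p.coevaluation' ∧ IsIso p.evaluation' := by
  have hY := (tensorLeftAdjunction X Y).isEquivalence_left_of_isEquivalence_right
  have h1 : IsIso ((tensorLeftAdjunction X Y).unit.app (𝟙_ C)) := inferInstance
  have h2 : IsIso ((tensorLeftAdjunction X Y).counit.app (𝟙_ C)) := inferInstance
  have e1 : (tensorLeftAdjunction X Y).unit.app (𝟙_ C) =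
      p.coevaluation' ≫ X ◁ (ρ_ Y).inv := by
    change _ ≫ p.coevaluation' ▷ _ ≫ _ ≫ _ = _
    simp [← MonoidalCategory.unitors_equal]
  have e2 : (tensorLeftAdjunction X Y).counit.app (𝟙_ C) =
      Y ◁ (ρ_ X).hom ≫ p.evaluation' := by
    change _ ≫ _ ≫ p.evaluation' ▷ _ ≫ _ = _
    simp [MonoidalCategory.unitors_equal]
  rw [e1] at h1
  rw [e2] at h2
  exact ⟨IsIso.of_isIso_comp_right _ (X ◁ (ρ_ Y).inv), IsIso.of_isIso_comp_left (Y ◁ (ρ_ X).hom) _⟩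

variable [Preadditive C] [Linear ℂ C] [MonoidalPreadditive C] [MonoidalLinear ℂ C]

/-- The evaluation and coevaluation of `q` are multiples, by `c` and `d`, of the inverses of the
coevaluation and evaluation of `p`. A triangle identity of `q` is then `c d` times the inverse of
one of `p`, whence `c d = 1`. -/
theorem IsInvertible.sqDim_eq_one {X : C} (h : IsInvertible X) (hX : 𝟙 X ≠ 0)
    (h1 : IsBrick (𝟙_ C)) {Y : C} (p : ExactPairing X Y) (q : ExactPairing Y X) :
    (p.coevaluation' ≫ q.evaluation') ≫ (q.coevaluation' ≫ p.evaluation') = 𝟙 (𝟙_ C) := by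
  obtain ⟨hp, hp'⟩ := isIso_coevaluation p h.isEquivalence
  obtain ⟨c, hc⟩ := h1.exists_smul (p.coevaluation' ≫ q.evaluation')
  obtain ⟨d, hd⟩ := h1.exists_smul (q.coevaluation' ≫ p.evaluation')
  have hq : q.evaluation' = c • inv p.coevaluation' := by
    rw [← cancel_epi p.coevaluation', hc]
    simp
  have hq' : q.coevaluation' = d • inv p.evaluation' := by
    rw [← cancel_mono p.evaluation', hd]
    simp
  have e1 := p.evaluation_coevaluation'
  have e2 := q.coevaluation_evaluation'
  have e3 : inv (p.coevaluation' ▷ X ≫ (α_ _ _ _).hom ≫ X ◁ p.evaluation') =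
      (ρ_ X).hom ≫ (λ_ X).inv := by
    apply IsIso.inv_eq_of_hom_inv_id
    rw [e1]
    simp
  rw [hq, hq'] at e2
  have e4 : (c * d) • ((ρ_ X).hom ≫ (λ_ X).inv) = (ρ_ X).hom ≫ (λ_ X).inv := by
    rw [← e3, ← smul_smul]
    refine Eq.trans ?_ (e2.trans e3.symm)
    simp [IsIso.inv_comp, smul_smul]
  rw [hc, hd]
  have e5 : (c * d) • 𝟙 X = (1 : ℂ) • 𝟙 X := by
    have := congrArg (fun t => (ρ_ X).inv ≫ t ≫ (λ_ X).hom) e4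
    simpa using this
  have e6 : c * d = 1 := by
    have h2 : (c * d - 1) • 𝟙 X = 0 := by rw [sub_smul, e5, sub_self]
    exact sub_eq_zero.1 ((smul_eq_zero.1 h2).resolve_right hX)
  simp [smul_smul, mul_comm d c, e6]

end Invertible

/-! ### Duals of direct sums -/

section SumPairing

variable {C : Type u} [Category.{v} C] [MonoidalCategory C] [Preadditive C] [MonoidalPreadditive C]
  {J : Type} [Fintype J] {X Y : C} {S T : J → C}

/-- The coevaluation of a direct sum. -/
def sumCoev (D : Decomposition X S) (E : Decomposition Y T) (p : ∀ i, ExactPairing (S i) (T i)) :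
    𝟙_ C ⟶ X ⊗ Y := ∑ i, (p i).coevaluation' ≫ (D.ι i ⊗ₘ E.ι i)

/-- The evaluation of a direct sum. -/
def sumEv (D : Decomposition X S) (E : Decomposition Y T) (p : ∀ i, ExactPairing (S i) (T i)) :
    Y ⊗ X ⟶ 𝟙_ C := ∑ i, (E.π i ⊗ₘ D.π i) ≫ (p i).evaluation'

variable (D : Decomposition X S) (E : Decomposition Y T) (p : ∀ i, ExactPairing (S i) (T i)) (j : J)

/-- Projecting to a summand leaves one term of the coevaluation. This and the three companions
reduce the triangle identities of the sum to those of the summands. -/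
theorem sumCoev_comp_left : sumCoev D E p ≫ D.π j ▷ Y = (p j).coevaluation' ≫ S j ◁ E.ι j := by
  rw [sumCoev, Preadditive.sum_comp, Finset.sum_eq_single j]
  · simp [MonoidalCategory.tensorHom_def', D.ι_π, ← comp_whiskerRight]
  · intro i _ h
    simp [MonoidalCategory.tensorHom_def', D.ι_π_ne i j h, ← comp_whiskerRight]
  · simp

theorem sumCoev_comp_right : sumCoev D E p ≫ X ◁ E.π j = (p j).coevaluation' ≫ D.ι j ▷ T j := by
  rw [sumCoev, Preadditive.sum_comp, Finset.sum_eq_single j]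
  · simp [MonoidalCategory.tensorHom_def, E.ι_π, ← whiskerLeft_comp]
  · intro i _ h
    simp [MonoidalCategory.tensorHom_def, E.ι_π_ne i j h, ← whiskerLeft_comp]
  · simp

theorem comp_sumEv_left : E.ι j ▷ X ≫ sumEv D E p = T j ◁ D.π j ≫ (p j).evaluation' := by
  rw [sumEv, Preadditive.comp_sum, Finset.sum_eq_single j]
  · simp [MonoidalCategory.tensorHom_def, E.ι_π, ← comp_whiskerRight_assoc]
  · intro i _ h
    simp [MonoidalCategory.tensorHom_def, E.ι_π_ne j i h.symm, ← comp_whiskerRight_assoc]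
  · simp

theorem comp_sumEv_right : Y ◁ D.ι j ≫ sumEv D E p = E.π j ▷ S j ≫ (p j).evaluation' := by
  rw [sumEv, Preadditive.comp_sum, Finset.sum_eq_single j]
  · simp [MonoidalCategory.tensorHom_def', D.ι_π, ← whiskerLeft_comp_assoc]
  · intro i _ h
    simp [MonoidalCategory.tensorHom_def', D.ι_π_ne j i h.symm, ← whiskerLeft_comp_assoc]
  · simp

/-- A direct sum of dual objects is dual to the direct sum. -/
@[reducible] def sumPairing : ExactPairing X Y where
  coevaluation' := sumCoev D E p
  evaluation' := sumEv D E p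
  coevaluation_evaluation' := by
    have h : ∀ j, E.ι j ▷ 𝟙_ C ≫ Y ◁ sumCoev D E p ≫ (α_ Y X Y).inv ≫ sumEv D E p ▷ Y =
        E.ι j ▷ 𝟙_ C ≫ (ρ_ Y).hom ≫ (λ_ Y).inv := fun j => by
      calc _ = T j ◁ sumCoev D E p ≫ (α_ _ _ _).inv ≫ (E.ι j ▷ X ≫ sumEv D E p) ▷ Y := by
              rw [← whisker_exchange_assoc]
              simp
        _ = T j ◁ (sumCoev D E p ≫ D.π j ▷ Y) ≫ (α_ _ _ _).inv ≫ (p j).evaluation' ▷ Y := by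
              rw [comp_sumEv_left]
              simp
        _ = (T j ◁ (p j).coevaluation' ≫ (α_ _ _ _).inv ≫ (p j).evaluation' ▷ T j) ≫
              𝟙_ C ◁ E.ι j := by
              rw [sumCoev_comp_left]
              simp only [MonoidalCategory.whiskerLeft_comp, Category.assoc,
                associator_inv_naturality_right_assoc, whisker_exchange]
        _ = _ := by
              rw [(p j).coevaluation_evaluation']
              simp
    rw [← Category.id_comp (Y ◁ sumCoev D E p ≫ _), ← Category.id_comp ((ρ_ Y).hom ≫ _),
      ← id_whiskerRight, ← E.total]
    simp only [sum_whiskerRight, Preadditive.sum_comp, comp_whiskerRight,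
      Category.assoc, h]
  evaluation_coevaluation' := by
    have h : ∀ j, 𝟙_ C ◁ D.ι j ≫ sumCoev D E p ▷ X ≫ (α_ X Y X).hom ≫ X ◁ sumEv D E p =
        𝟙_ C ◁ D.ι j ≫ (λ_ X).hom ≫ (ρ_ X).inv := fun j => by
      calc _ = sumCoev D E p ▷ S j ≫ (α_ _ _ _).hom ≫ X ◁ (Y ◁ D.ι j ≫ sumEv D E p) := by
              rw [whisker_exchange_assoc]
              simp
        _ = (sumCoev D E p ≫ X ◁ E.π j) ▷ S j ≫ (α_ _ _ _).hom ≫ X ◁ (p j).evaluation' := by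
              rw [comp_sumEv_right]
              simp
        _ = ((p j).coevaluation' ▷ S j ≫ (α_ _ _ _).hom ≫ S j ◁ (p j).evaluation') ≫
              D.ι j ▷ 𝟙_ C := by
              rw [sumCoev_comp_right]
              simp only [comp_whiskerRight, Category.assoc, associator_naturality_left_assoc,
                ← whisker_exchange]
        _ = _ := by
              rw [(p j).evaluation_coevaluation']
              simp
    rw [← Category.id_comp (sumCoev D E p ▷ X ≫ _), ← Category.id_comp ((λ_ X).hom ≫ _),
      ← MonoidalCategory.whiskerLeft_id, ← D.total]
    simp only [whiskerLeft_sum, Preadditive.sum_comp,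
      MonoidalCategory.whiskerLeft_comp, Category.assoc, h]

end SumPairing

/-! ### Linear and abelian structure of `Vect(H, η)` -/

namespace Vect

variable {H : Type} [Group H] [Fintype H] {η : Cocycle3 H}

theorem lin_add {X Y : Vect η} (f g : X ⟶ Y) : lin (f + g) = lin f + lin g := rfl

theorem lin_smul {X Y : Vect η} (c : ℂ) (f : X ⟶ Y) : lin (c • f) = c • lin f := rfl

/-- The underlying linear map, as an additive map. -/
def linHom (X Y : Vect η) : (X ⟶ Y) →ₗ[ℂ] (X.V →ₗ[ℂ] Y.V) where
  toFun := lin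
  map_add' := lin_add
  map_smul' := lin_smul

theorem lin_sum {ι : Type} {X Y : Vect η} (s : Finset ι) (f : ι → (X ⟶ Y)) :
    lin (∑ i ∈ s, f i) = ∑ i ∈ s, lin (f i) := map_sum (linHom X Y) f s

instance : MonoidalPreadditive (Vect η) where
  whiskerLeft_zero := hom_ext (TensorProduct.map_zero_right _)
  zero_whiskerRight := hom_ext (TensorProduct.map_zero_left _)
  whiskerLeft_add f g := hom_ext (TensorProduct.map_add_right _ (lin f) (lin g))
  add_whiskerRight f g := hom_ext (TensorProduct.map_add_left (lin f) (lin g) _)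

instance : MonoidalLinear ℂ (Vect η) where
  whiskerLeft_smul _ _ _ r f := hom_ext (TensorProduct.map_smul_right r _ (lin f))
  smul_whiskerRight r _ _ f _ := hom_ext (TensorProduct.map_smul_left r (lin f) _)

theorem finite_hom (X Y : Vect η) : FiniteDimensional ℂ (X ⟶ Y) :=
  FiniteDimensional.of_injective (linHom X Y) fun _ _ h => hom_ext h

theorem regular : IsRegularCategory (Vect η) := fun {X Y} f => by
  obtain ⟨r, hr⟩ := (lin f).rangeRestrict.exists_rightInverse_of_surjective
    (LinearMap.range_rangeRestrict _)
  obtain ⟨q, hq⟩ := (lin f).range.subtype.exists_leftInverse_of_injective (Submodule.ker_subtype _)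
  have h0 : ∀ x, lin f (r (q (lin f x))) = lin f x := fun x => by
    have h1 : q (lin f x) = (lin f).rangeRestrict x :=
      LinearMap.congr_fun hq ((lin f).rangeRestrict x)
    rw [h1]
    exact congrArg Subtype.val (LinearMap.congr_fun hr ((lin f).rangeRestrict x))
  -- A linear quasi-inverse `r ∘ q` need not respect degrees; compressing it to its diagonal blocks
  -- makes it homogeneous, and since `f` is homogeneous the quasi-inverse property survives.
  let g : Y.V →ₗ[ℂ] X.V := ∑ h, X.grading.proj h ∘ₗ (r ∘ₗ q) ∘ₗ Y.grading.proj h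
  have hg : ∀ {a y}, Y.grading.proj a y = y → g y = X.grading.proj a (r (q y)) := fun {a y} hy => by
    simp only [g, LinearMap.sum_apply, LinearMap.comp_apply]
    rw [Finset.sum_eq_single a]
    · rw [hy]
    · intro b _ hb
      rw [Y.grading.proj_of_homog hy, if_neg hb, map_zero, map_zero, map_zero]
    · simp
  refine ⟨ofLin g (Grading.isHom_of_homog fun a y hy => ?_), hom_ext
    (X.grading.lin_ext fun a x hx => ?_)⟩
  · rw [hg hy, X.grading.proj_self]
  · change lin f (g (lin f x)) = lin f x
    rw [hg ((isHom_lin f).homog hx), isHom_lin f, h0, (isHom_lin f).homog hx]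

/-- The grading of a homogeneous subspace. -/
def subGrading {V : Type} [AddCommGroup V] [Module ℂ V] (P : Grading H V) (K : Submodule ℂ V)
    (hK : ∀ h, ∀ x ∈ K, P.proj h x ∈ K) : Grading H K where
  proj h := (P.proj h).restrict (hK h)
  proj_self h x := Subtype.ext (P.proj_self h x)
  proj_ne g h x hgh := Subtype.ext (P.proj_ne g h x hgh)
  sum_proj x := Subtype.ext (by
    rw [AddSubmonoidClass.coe_finsetSum]
    exact P.sum_proj x)

instance : IsIdempotentComplete (Vect η) where
  idempotents_split X p hp := by
    have hK : ∀ h, ∀ x ∈ (lin p).range, X.grading.proj h x ∈ (lin p).range := by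
      rintro h _ ⟨x, rfl⟩
      exact ⟨X.grading.proj h x, isHom_lin p h x⟩
    have hp' : ∀ x, lin p (lin p x) = lin p x := fun x =>
      LinearMap.congr_fun (congrArg lin hp) x
    let Y : Vect η := ⟨(lin p).range, subGrading X.grading _ hK⟩
    refine ⟨Y, ofLin (lin p).range.subtype fun h x => rfl,
      ofLin (lin p).rangeRestrict fun h x => Subtype.ext (isHom_lin p h x),
      hom_ext (LinearMap.ext ?_), hom_ext (LinearMap.ext fun x => rfl)⟩
    rintro ⟨_, x, rfl⟩
    exact Subtype.ext (hp' x)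

/-- The direct sum of graded vector spaces. -/
def pi {J : Type} [Fintype J] (f : J → Vect η) : Vect η where
  V := ∀ j, (f j).V
  grading :=
    { proj := fun h => LinearMap.pi fun j => (f j).grading.proj h ∘ₗ LinearMap.proj j
      proj_self := fun h x => funext fun j => (f j).grading.proj_self h (x j)
      proj_ne := fun g h x hgh => funext fun j => (f j).grading.proj_ne g h (x j) hgh
      sum_proj := fun x => funext fun j => by
        rw [Finset.sum_apply]
        exact (f j).grading.sum_proj (x j) }

open Classical in
/-- The decomposition of a direct sum. -/
noncomputable def piDecomposition {J : Type} [Fintype J] (f : J → Vect η) : Decomposition (pi f) f where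
  ι j := ofLin (Y := pi f) (LinearMap.single ℂ (fun j => (f j).V) j) fun h x => funext fun k => by
    change Pi.single (M := fun j => (f j).V) j ((f j).grading.proj h x) k =
      (f k).grading.proj h (Pi.single (M := fun j => (f j).V) j x k)
    by_cases hk : k = j
    · subst hk
      simp
    · simp [hk]
  π j := ofLin (X := pi f) (LinearMap.proj j) fun _ _ => rfl
  ι_π j := hom_ext (LinearMap.ext fun x => Pi.single_eq_same (M := fun j => (f j).V) j x)
  ι_π_ne i j h := hom_ext (LinearMap.ext fun x =>
    Pi.single_eq_of_ne (M := fun j => (f j).V) h.symm x)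
  total := hom_ext (by
    rw [lin_sum]
    refine LinearMap.ext fun x => ?_
    rw [LinearMap.sum_apply]
    exact Finset.univ_sum_single (f := x))

instance : HasFiniteBiproducts (Vect η) where
  out _ := ⟨fun f => by
    classical
    exact hasBiproduct_of_total
      { pt := pi f
        π := (piDecomposition f).π
        ι := (piDecomposition f).ι
        ι_π := fun i j => by
          split_ifs with h
          · subst h
            simpa using (piDecomposition f).ι_π i
          · exact (piDecomposition f).ι_π_ne i j h } (piDecomposition f).total⟩

end Vect

/-! ### Gradings concentrated in one degree -/

namespace Grading

variable {H : Type} [Fintype H]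

open Classical in
/-- The grading of `ℂ` concentrated in degree `a`. -/
noncomputable def line (a : H) : Grading H ℂ where
  proj h := if h = a then LinearMap.id else 0
  proj_self h x := by split_ifs <;> simp
  proj_ne g h x hgh := by
    by_cases h1 : h = a
    · have : g ≠ a := fun h' => hgh (h'.trans h1.symm)
      simp [this]
    · simp [h1]
  sum_proj x := by
    rw [Finset.sum_eq_single a] <;> simp +contextual

theorem line_proj (a : H) (x : ℂ) : (line a).proj a x = x := by
  simp [line]

theorem line_proj_ne {a b : H} (h : b ≠ a) (x : ℂ) : (line a).proj b x = 0 := by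
  simp [line, h]

theorem isHom_line {V : Type} [AddCommGroup V] [Module ℂ V] {P : Grading H V} {a : H}
    {f : ℂ →ₗ[ℂ] V} (hf : P.proj a (f 1) = f 1) : IsHom (line a) P f := fun h c => by
  have hc : f c = c • f 1 := by rw [← map_smul, smul_eq_mul, mul_one]
  by_cases hh : h = a
  · subst hh
    rw [line_proj, hc, map_smul, hf]
  · rw [line_proj_ne hh, map_zero, hc, map_smul, P.proj_of_homog hf, if_neg hh, smul_zero]

theorem isHom_line_tensor [Group H] {a b k : H} (h : a * b = k) :
    IsHom (tensor (line a) (line b)) (line k) (TensorProduct.lid ℂ ℂ).toLinearMap :=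
  isHom_tensor_of_homog fun c d x y hx hy => by
    by_cases hc : c = a
    · by_cases hd : d = b
      · subst hc hd h
        exact line_proj _ _
      · have : y = 0 := by rw [← hy, line_proj_ne hd]
        rw [this, TensorProduct.tmul_zero, map_zero, map_zero]
    · have : x = 0 := by rw [← hx, line_proj_ne hc]
      rw [this, TensorProduct.zero_tmul, map_zero, map_zero]

theorem isHom_line_tensor_symm [Group H] {a b k : H} (h : a * b = k) :
    IsHom (line k) (tensor (line a) (line b)) (TensorProduct.lid ℂ ℂ).symm.toLinearMap :=
  isHom_line (by
    rw [LinearEquiv.coe_coe, TensorProduct.lid_symm_apply, ← h]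
    exact tensor_homog _ _ (line_proj a 1) (line_proj b 1))

end Grading

/-! ### Lines as simple objects of `Vect(H, η)`: duals, invertibility and global dimension -/

namespace Vect

variable {H : Type} [Group H] [Fintype H] {η : Cocycle3 H}

/-- The one-dimensional space of degree `a`. -/
noncomputable abbrev line (η : Cocycle3 H) (a : H) : Vect η where
  V := ℂ
  grading := Grading.line a

theorem line_proj (a : H) (x : ℂ) : (line η a).grading.proj a x = x := Grading.line_proj a x

theorem line_proj_ne {a b : H} (h : b ≠ a) (x : ℂ) : (line η a).grading.proj b x = 0 :=
  Grading.line_proj_ne h x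

/-- The morphism from a line defined by a homogeneous vector. -/
noncomputable def ofVec {X : Vect η} {a : H} (x : X.V) (hx : X.grading.proj a x = x) :
    line η a ⟶ X :=
  ofLin (X := line η a) (LinearMap.toSpanSingleton ℂ X.V x)
    (Grading.isHom_line (by rw [LinearMap.toSpanSingleton_apply, one_smul, hx]))

theorem line_hom_ext {X : Vect η} {a : H} {f g : line η a ⟶ X}
    (h : lin f (1 : ℂ) = lin g (1 : ℂ)) : f = g :=
  hom_ext (LinearMap.ext_ring h)

theorem line_hom_homog {X : Vect η} {a : H} (f : line η a ⟶ X) :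
    X.grading.proj a (lin f (1 : ℂ)) = lin f (1 : ℂ) := by
  rw [← isHom_lin f, line_proj]

theorem line_hom_zero {a b : H} (hab : a ≠ b) (f : line η a ⟶ line η b) : f = 0 :=
  line_hom_ext (by rw [← line_hom_homog f, line_proj_ne hab]; rfl)

theorem isBrick_line (a : H) : IsBrick (line η a) := by
  refine ⟨fun c d h => ?_, fun f => ⟨lin f (1 : ℂ), line_hom_ext ?_⟩⟩
  · have h1 : c • (1 : ℂ) = d • (1 : ℂ) := congrArg (fun f : line η a ⟶ line η a => lin f (1 : ℂ)) h
    simpa using h1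
  · change lin f (1 : ℂ) • (1 : ℂ) = lin f (1 : ℂ)
    rw [smul_eq_mul, mul_one]

/-- The homogeneous components have bases. -/
theorem nonempty_decomposition (X : Vect η) : ∃ (J : Type) (_ : Fintype J) (d : J → H),
    Nonempty (Decomposition X (fun j => line η (d j))) := by
  let K : H → Submodule ℂ X.V := fun h => (X.grading.proj h).range
  let b : ∀ h, Module.Basis (Fin (Module.finrank ℂ (K h))) ℂ (K h) := fun h => Module.finBasis ℂ (K h)
  have hb : ∀ h i, X.grading.proj h (b h i : X.V) = b h i := fun h i => by
    obtain ⟨x, hx⟩ := (b h i).2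
    rw [← hx, X.grading.proj_self]
  let c : ∀ h, X.V →ₗ[ℂ] K h := fun h => (X.grading.proj h).rangeRestrict
  have hc : ∀ h i, c h (b h i : X.V) = b h i := fun h i => Subtype.ext (hb h i)
  have hc0 : ∀ h h' i, h' ≠ h → c h' (b h i : X.V) = 0 := fun h h' i hh => Subtype.ext (by
    change X.grading.proj h' (b h i : X.V) = 0
    rw [X.grading.proj_of_homog (hb h i), if_neg hh])
  refine ⟨Σ h, Fin (Module.finrank ℂ (K h)), inferInstance, Sigma.fst, ⟨?_⟩⟩
  refine
    { ι := fun j => ofVec (b j.1 j.2 : X.V) (hb _ _)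
      π := fun j => ofLin (Y := line η j.1) ((b j.1).coord j.2 ∘ₗ c j.1) fun h x => ?_
      ι_π := fun j => line_hom_ext ?_
      ι_π_ne := fun i j hij => line_hom_ext ?_
      total := hom_ext ?_ }
  · change (b j.1).coord j.2 (c j.1 (X.grading.proj h x)) =
      (line η j.1).grading.proj h ((b j.1).coord j.2 (c j.1 x))
    by_cases hh : h = j.1
    · subst hh
      rw [line_proj]
      have h0 : c j.1 (X.grading.proj j.1 x) = c j.1 x := Subtype.ext (X.grading.proj_self _ _)
      rw [h0]
    · rw [line_proj_ne hh]
      have h0 : c j.1 (X.grading.proj h x) = 0 := Subtype.ext (X.grading.proj_ne _ _ x (Ne.symm hh))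
      rw [h0]
      exact map_zero _
  · change (b j.1).coord j.2 (c j.1 ((1 : ℂ) • (b j.1 j.2 : X.V))) = (1 : ℂ)
    rw [one_smul, hc]
    simp
  · change (b j.1).coord j.2 (c j.1 ((1 : ℂ) • (b i.1 i.2 : X.V))) = (0 : ℂ)
    rw [one_smul]
    obtain ⟨h, i⟩ := i
    obtain ⟨h', j⟩ := j
    by_cases hh : h' = h
    · subst hh
      have : i ≠ j := fun h => hij (by rw [h])
      rw [hc]
      simp [this]
    · rw [hc0 _ _ _ hh, map_zero]
  · rw [lin_sum]
    refine LinearMap.ext fun x => ?_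
    rw [LinearMap.sum_apply, Fintype.sum_sigma]
    change ∑ h, ∑ i, ((b h).coord i (c h x)) • (b h i : X.V) = x
    conv_rhs => rw [← X.grading.sum_proj x]
    refine Finset.sum_congr rfl fun h _ => ?_
    have := congrArg (K h).subtype ((b h).sum_repr (c h x))
    rw [map_sum] at this
    exact this

/-- The tensor product of two lines. -/
noncomputable def lineTensor (a b k : H) (h : a * b = k) : line η k ≅ line η a ⊗ line η b where
  hom := ofLin (X := line η k) (Y := tensor (line η a) (line η b))
    (TensorProduct.lid ℂ ℂ).symm.toLinearMap (Grading.isHom_line_tensor_symm h)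
  inv := ofLin (X := tensor (line η a) (line η b)) (Y := line η k)
    (TensorProduct.lid ℂ ℂ).toLinearMap (Grading.isHom_line_tensor h)
  hom_inv_id := hom_ext (LinearMap.ext fun x => (TensorProduct.lid ℂ ℂ).apply_symm_apply x)
  inv_hom_id := hom_ext (LinearMap.ext fun x => (TensorProduct.lid ℂ ℂ).symm_apply_apply x)

/-- A morphism from a line is determined by its value at 1, and both sides send 1 to a multiple of
`1 ⊗ (1 ⊗ 1)`; the associator contributes `η a b c`. -/
theorem lineTensor_assoc (a b c ab bc k : H) (h1 : a * b = ab) (h2 : ab * c = k) (h3 : b * c = bc)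
    (h4 : a * bc = k) :
    (lineTensor (η := η) ab c k h2).hom ≫ (lineTensor a b ab h1).hom ▷ line η c ≫
      (α_ (line η a) (line η b) (line η c)).hom =
    (η a b c : ℂ) • (lineTensor a bc k h4).hom ≫ line η a ◁ (lineTensor b c bc h3).hom := by
  refine line_hom_ext ?_
  let l := (TensorProduct.lid ℂ ℂ).symm.toLinearMap
  have hl : l 1 = 1 ⊗ₜ 1 := TensorProduct.lid_symm_apply _
  change Grading.assocLin η (Grading.line a) (Grading.line b) (Grading.line c)
      (TensorProduct.map l LinearMap.id (l 1)) =
    (η a b c : ℂ) • TensorProduct.map LinearMap.id l (l 1)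
  rw [hl, TensorProduct.map_tmul, TensorProduct.map_tmul, hl]
  exact Grading.assocLin_tmul _ _ _ _ (Grading.line_proj a 1) (Grading.line_proj b 1)
    (Grading.line_proj c 1)

theorem isInvertible_line (a : H) : IsInvertible (line η a) :=
  ⟨line η a⁻¹, ⟨(lineTensor a a⁻¹ 1 (mul_inv_cancel a)).symm⟩,
    ⟨(lineTensor a⁻¹ a 1 (inv_mul_cancel a)).symm⟩⟩

/-- Each triangle identity for the lines of degrees `a` and `b` prescribes the scalar in the
evaluation, and this identity says that the two prescriptions agree. It comes from the cocycle
condition at `(a, b, a, b)`, with degenerate instances accounting for a non-normalized `η`. -/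
theorem pairing_identity (η : Cocycle3 H) {a b : H} (h : a * b = 1) :
    η b a b * η b 1 1 * η 1 1 b * (η a b a * η 1 1 a * η a 1 1) = 1 := by
  have hba : b * a = 1 := mul_eq_one_comm.1 h
  have h0 : η 1 1 1 = 1 := by
    have := η.cocycle 1 1 1 1
    simpa using this
  have h1 := η.cocycle a b a b
  have h2 := η.cocycle 1 1 a b
  have h3 := η.cocycle a b 1 1
  have h4 := triangle_identity η a b
  simp only [h, hba, one_mul, mul_one, h0] at h1 h2 h3
  have h2' : η 1 a b * η 1 1 a = 1 := by
    refine mul_left_cancel (a := η 1 a b) ?_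
    rw [← mul_assoc, h2, mul_one]
  have h3' : η b 1 1 * η a b 1 = 1 := by
    refine mul_right_cancel (b := η a b 1) ?_
    rw [h3, one_mul]
  rw [mul_inv_eq_iff_eq_mul] at h4
  rw [h4] at h1
  calc _ = (η b a b * (η a 1 1 * η 1 1 b) * η a b a) * (η b 1 1 * η 1 1 a) := by
        simp only [mul_assoc, mul_comm, mul_left_comm]
    _ = (η 1 a b * η 1 1 a) * (η b 1 1 * η a b 1) := by
        rw [h1]
        simp only [mul_assoc, mul_comm, mul_left_comm]
    _ = 1 := by rw [h2', h3', one_mul]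

/-- The lines of inverse degrees are dual. -/
@[reducible] noncomputable def linePairing (a b : H) (h : a * b = 1) :
    ExactPairing (line η a) (line η b) where
  coevaluation' := (lineTensor a b 1 h).hom
  -- The scalar is the one imposed by the first triangle identity when the coevaluation is left
  -- unscaled.
  evaluation' := ((η b a b * η b 1 1 * η 1 1 b : ℂˣ) : ℂ) •
    (lineTensor b a 1 (mul_eq_one_comm.1 h)).inv
  coevaluation_evaluation' := by
    generalize hs : η b a b * η b 1 1 * η 1 1 b = s
    let l := (TensorProduct.lid ℂ ℂ).symm.toLinearMap
    let m := (TensorProduct.lid ℂ ℂ).toLinearMap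
    have hl : l 1 = 1 ⊗ₜ 1 := TensorProduct.lid_symm_apply _
    have hm : ∀ x y, m (x ⊗ₜ y) = x * y := fun x y => TensorProduct.lid_tmul y x
    refine hom_ext (TensorProduct.ext (LinearMap.ext_ring (LinearMap.ext_ring ?_)))
    change TensorProduct.map ((s : ℂ) • m) LinearMap.id (Grading.assocInvLin η (Grading.line b)
      (Grading.line a) (Grading.line b) (TensorProduct.map LinearMap.id l (1 ⊗ₜ 1))) =
      l (Grading.scale (fun a => (η 1 1 a)⁻¹⁻¹) (Grading.line b)
        (Grading.scale (fun a => η a 1 1) (Grading.line b) (TensorProduct.rid ℂ ℂ (1 ⊗ₜ 1))))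
    rw [TensorProduct.map_tmul, hl, LinearMap.id_apply, Grading.assocInvLin_tmul _ _ _ _
      (Grading.line_proj b 1) (Grading.line_proj a 1) (Grading.line_proj b 1), map_smul,
      TensorProduct.map_tmul, LinearMap.smul_apply, hm, TensorProduct.rid_tmul, one_smul,
      Grading.scale_homog _ _ (Grading.line_proj b 1), map_smul,
      Grading.scale_homog _ _ (Grading.line_proj b 1), map_smul, map_smul, hl, LinearMap.id_apply,
      mul_one, ← TensorProduct.smul_tmul', smul_smul, smul_smul, ← hs]
    congr 1
    simp only [inv_inv, ← Units.val_mul]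
    congr 1
    group
  evaluation_coevaluation' := by
    have hs := mul_eq_one_iff_eq_inv.1 (pairing_identity η h)
    rw [hs]
    generalize hs' : (η a b a * η 1 1 a * η a 1 1)⁻¹ = s
    let l := (TensorProduct.lid ℂ ℂ).symm.toLinearMap
    let m := (TensorProduct.lid ℂ ℂ).toLinearMap
    have hl : l 1 = 1 ⊗ₜ 1 := TensorProduct.lid_symm_apply _
    have hm : ∀ x y, m (x ⊗ₜ y) = x * y := fun x y => TensorProduct.lid_tmul y x
    refine hom_ext (TensorProduct.ext (LinearMap.ext_ring (LinearMap.ext_ring ?_)))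
    change TensorProduct.map LinearMap.id ((s : ℂ) • m) (Grading.assocLin η (Grading.line a)
      (Grading.line b) (Grading.line a) (TensorProduct.map l LinearMap.id (1 ⊗ₜ 1))) =
      (TensorProduct.rid ℂ ℂ).symm (Grading.scale (fun a => (η a 1 1)⁻¹) (Grading.line a)
        (Grading.scale (fun a => (η 1 1 a)⁻¹) (Grading.line a) (TensorProduct.lid ℂ ℂ (1 ⊗ₜ 1))))
    rw [TensorProduct.map_tmul, hl, LinearMap.id_apply, Grading.assocLin_tmul _ _ _ _
      (Grading.line_proj a 1) (Grading.line_proj b 1) (Grading.line_proj a 1), map_smul,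
      TensorProduct.map_tmul, LinearMap.smul_apply, hm, TensorProduct.lid_tmul, one_smul,
      Grading.scale_homog _ _ (Grading.line_proj a 1), map_smul,
      Grading.scale_homog _ _ (Grading.line_proj a 1), map_smul, map_smul,
      TensorProduct.rid_symm_apply, LinearMap.id_apply, mul_one, TensorProduct.tmul_smul,
      smul_smul, smul_smul, ← hs']
    congr 1
    simp only [← Units.val_mul]
    congr 1
    generalize η a b a = x
    generalize η 1 1 a = y
    generalize η a 1 1 = z
    rw [mul_assoc, mul_inv, mul_comm x⁻¹, mul_comm x, inv_mul_cancel_right, mul_inv]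

theorem isBrick_unit : IsBrick (𝟙_ (Vect η)) := isBrick_line 1

theorem exists_pairing (X : Vect η) :
    ∃ Y, Nonempty (ExactPairing X Y) ∧ Nonempty (ExactPairing Y X) := by
  obtain ⟨J, _, d, ⟨D⟩⟩ := nonempty_decomposition X
  let E := piDecomposition (fun j => line η (d j)⁻¹)
  exact ⟨_, ⟨sumPairing D E fun j => linePairing _ _ (mul_inv_cancel _)⟩,
    ⟨sumPairing E D fun j => linePairing _ _ (inv_mul_cancel _)⟩⟩

instance : HasKernels (Vect η) := regular.hasKernels

theorem simple_line (a : H) : Simple (line η a) := (isBrick_line a).simple regular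

/-- Some line of a decomposition has a nonzero inclusion into `X`, and a nonzero morphism between
simple objects is an isomorphism. -/
theorem exists_iso_line (X : Vect η) (hX : Simple X) : ∃ a, Nonempty (X ≅ line η a) := by
  obtain ⟨J, _, d, ⟨D⟩⟩ := nonempty_decomposition X
  have h : ∃ j, D.ι j ≠ 0 := by
    by_contra! h
    apply id_nonzero X
    rw [← D.total]
    exact Finset.sum_eq_zero fun j _ => by rw [h, comp_zero]
  obtain ⟨j, hj⟩ := h
  have := simple_line (η := η) (d j)
  have := isIso_of_hom_simple hj
  exact ⟨d j, ⟨(asIso (D.ι j)).symm⟩⟩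

theorem line_iso_iff {a b : H} : Nonempty (line η a ≅ line η b) ↔ a = b := by
  constructor
  · rintro ⟨e⟩
    by_contra h
    apply (isBrick_line (η := η) a).id_ne_zero
    rw [← e.hom_inv_id, line_hom_zero h e.hom, zero_comp]
  · rintro rfl
    exact ⟨Iso.refl _⟩

theorem isPointedFusion (η : Cocycle3 H) : IsPointedFusion (Vect η) where
  hasKernels := inferInstance
  hasCokernels := regular.hasCokernels
  normalMono := regular.isNormalMonoCategory
  normalEpi := regular.isNormalEpiCategory
  finite_hom := finite_hom
  semisimple X := by
    obtain ⟨J, _, d, ⟨D⟩⟩ := nonempty_decomposition X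
    exact ⟨_, _, fun i => simple_line _, (D.reindex (Fintype.equivFin J).symm).nonempty_iso⟩
  finite_simple := by
    refine ⟨_, fun i => line η ((Fintype.equivFin H).symm i), fun X hX => ?_⟩
    obtain ⟨a, ha⟩ := exists_iso_line X hX
    exact ⟨Fintype.equivFin H a, by simpa using ha⟩
  end_unit := isBrick_unit
  right_dual X := (exists_pairing X).imp fun _ h => h.1
  left_dual X := (exists_pairing X).imp fun _ h => h.2
  invertible X hX := by
    obtain ⟨a, ⟨e⟩⟩ := exists_iso_line X hX
    obtain ⟨Y, ⟨f⟩, ⟨g⟩⟩ := isInvertible_line (η := η) a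
    exact ⟨Y, ⟨whiskerRightIso e Y ≪≫ f⟩, ⟨whiskerLeftIso Y e ≪≫ g⟩⟩

theorem isSqDim_line (a : H) : IsSqDim (line η a) 1 := by
  refine ⟨line η a⁻¹, linePairing _ _ (mul_inv_cancel a), linePairing _ _ (inv_mul_cancel a), ?_⟩
  rw [one_smul]
  exact (isInvertible_line a).sqDim_eq_one (isBrick_line a).id_ne_zero isBrick_unit _ _

theorem hasGlobalDim (η : Cocycle3 H) : HasGlobalDim (Vect η) (Nat.card H) := by
  refine ⟨_, fun i => line η ((Fintype.equivFin H).symm i), fun _ => 1, fun i => simple_line _,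
    fun X hX => ?_, fun i => isSqDim_line _, by simp⟩
  obtain ⟨a, ⟨e⟩⟩ := exists_iso_line X hX
  refine ⟨Fintype.equivFin H a, ⟨e ≪≫ eqToIso (by simp)⟩, ?_⟩
  rintro j ⟨f⟩
  rw [line_iso_iff.1 ⟨e.symm ≪≫ f⟩, Equiv.apply_symm_apply]

end Vect

/-! ### Transport of decompositions and of natural isomorphisms -/

theorem Vect.isIso_of_bijective {H : Type} [Group H] [Fintype H] {η : Cocycle3 H} {X Y : Vect η}
    (f : X ⟶ Y) (hf : Function.Bijective (lin f)) : IsIso f := by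
  let e := LinearEquiv.ofBijective (lin f) hf
  have he : ∀ x, e x = lin f x := fun _ => rfl
  refine ⟨ofLin e.symm.toLinearMap fun h y => ?_, hom_ext ?_, hom_ext ?_⟩
  · obtain ⟨x, rfl⟩ := e.surjective y
    apply e.injective
    change e (e.symm (Y.grading.proj h (e x))) = lin f (X.grading.proj h (e.symm (e x)))
    rw [e.symm_apply_apply, e.apply_symm_apply, isHom_lin f, he]
  · exact LinearMap.ext e.symm_apply_apply
  · exact LinearMap.ext e.apply_symm_apply

theorem Decomposition.nonempty_iso_of {C : Type u} [Category.{v} C] [Preadditive C] {J : Type}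
    [Fintype J] {X Y : C} {S : J → C} (D : Decomposition X S) (E : Decomposition Y S) :
    Nonempty (X ≅ Y) := by
  have key : ∀ {X Y : C} (D : Decomposition X S) (E : Decomposition Y S),
      (∑ i, D.π i ≫ E.ι i) ≫ (∑ i, E.π i ≫ D.ι i) = 𝟙 X := fun D E => by
    classical
    rw [← D.total, Preadditive.sum_comp]
    refine Finset.sum_congr rfl fun i _ => ?_
    rw [Preadditive.comp_sum, Finset.sum_eq_single i]
    · rw [Category.assoc, ← Category.assoc (E.ι i), E.ι_π, Category.id_comp]
    · intro j _ hj
      rw [Category.assoc, ← Category.assoc (E.ι i), E.ι_π_ne _ _ hj.symm, zero_comp, comp_zero]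
    · simp
  exact ⟨⟨_, _, key D E, key E D⟩⟩

/-- The decomposition of a direct sum. -/
noncomputable def Decomposition.biproduct {C : Type u} [Category.{v} C] [Preadditive C] {J : Type}
    [Fintype J] (S : J → C) [HasBiproduct S] : Decomposition (⨁ S) S := .ofIso (Iso.refl _)

/-- The image of a decomposition under an additive functor. -/
def Decomposition.map {C : Type u} [Category.{v} C] [Preadditive C] {E : Type u'} [Category.{v'} E]
    [Preadditive E] {J : Type} [Fintype J] {X : C} {S : J → C} (D : Decomposition X S) (F : C ⥤ E)
    [F.Additive] : Decomposition (F.obj X) (fun i => F.obj (S i)) where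
  ι i := F.map (D.ι i)
  π i := F.map (D.π i)
  ι_π i := by rw [← F.map_comp, D.ι_π, F.map_id]
  ι_π_ne i j h := by rw [← F.map_comp, D.ι_π_ne i j h, F.map_zero]
  total := by
    simp only [← F.map_comp]
    rw [← F.map_sum, D.total, F.map_id]

/-- Replace the summands of a decomposition by isomorphic objects. -/
def Decomposition.congr {C : Type u} [Category.{v} C] [Preadditive C] {J : Type} [Fintype J]
    {X : C} {S T : J → C} (D : Decomposition X S) (e : ∀ i, S i ≅ T i) : Decomposition X T where
  ι i := (e i).inv ≫ D.ι i
  π i := D.π i ≫ (e i).hom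
  ι_π i := by simp [reassoc_of% D.ι_π i]
  ι_π_ne i j h := by simp [reassoc_of% D.ι_π_ne i j h]
  total := by simp [D.total]

/-- Replace the direct sum of a decomposition by an isomorphic object. -/
def Decomposition.ofIsoLeft {C : Type u} [Category.{v} C] [Preadditive C] {J : Type} [Fintype J]
    {X Y : C} {S : J → C} (D : Decomposition X S) (e : X ≅ Y) : Decomposition Y S where
  ι i := D.ι i ≫ e.hom
  π i := e.inv ≫ D.π i
  ι_π i := by simp [D.ι_π i]
  ι_π_ne i j h := by simp [D.ι_π_ne i j h]
  total := by
    simp only [Category.assoc, ← Preadditive.comp_sum]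
    simp only [← Category.assoc, ← Preadditive.sum_comp]
    simp [D.total]

/-- The inverse is assembled from the inverses on the summands; naturality and additivity make it
two-sided. It reduces the tensorator to simple objects. -/
theorem isIso_app_of_decomposition {C : Type u} [Category.{v} C] [Preadditive C] {E : Type u'}
    [Category.{v'} E] [Preadditive E] {F G : C ⥤ E} [F.Additive] [G.Additive] (t : F ⟶ G)
    {J : Type} [Fintype J] {X : C} {S : J → C} (D : Decomposition X S) (h : ∀ i, IsIso (t.app (S i))) :
    IsIso (t.app X) := by
  refine ⟨∑ i, G.map (D.π i) ≫ inv (t.app (S i)) ≫ F.map (D.ι i), ?_, ?_⟩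
  · rw [Preadditive.comp_sum, ← (D.map F).total]
    exact Finset.sum_congr rfl fun i _ => by simp [Decomposition.map]
  · rw [Preadditive.sum_comp, ← (D.map G).total]
    exact Finset.sum_congr rfl fun i _ => by simp [Decomposition.map]

/-- A family of objects of `C` indexed by `H` which is tensored with associativity constraint `η`,
and of which every object is a direct sum. -/
structure PointedData (C : Type u) [Category.{v} C] [Preadditive C] [Linear ℂ C]
    [MonoidalCategory C] {H : Type} [Group H] (η : Cocycle3 H) where
  S : H → C
  -- The product is a variable `k` with an equation, so that the two bracketings of a triple product
  -- share one object and no transport is needed.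
  m : ∀ a b k, a * b = k → (S k ≅ S a ⊗ S b)
  assoc : ∀ a b c ab bc k (h1 : a * b = ab) (h2 : ab * c = k) (h3 : b * c = bc) (h4 : a * bc = k),
    (m ab c k h2).hom ≫ (m a b ab h1).hom ▷ S c ≫ (α_ (S a) (S b) (S c)).hom =
      (η a b c : ℂ) • (m a bc k h4).hom ≫ S a ◁ (m b c bc h3).hom
  unit : Nonempty (S 1 ≅ 𝟙_ C)
  brick : ∀ a, IsBrick (S a)
  hom_zero : ∀ a b, a ≠ b → ∀ f : S a ⟶ S b, f = 0
  span : ∀ X : C, ∃ (J : Type) (_ : Fintype J) (d : J → H),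
    Nonempty (Decomposition X (fun j => S (d j)))

/-! ### The functor of graded multiplicity spaces -/

namespace PointedData

variable {C : Type u} [Category.{v} C] [Preadditive C] [Linear ℂ C] [MonoidalCategory C]
variable {H : Type} [Group H] {η : Cocycle3 H} (D : PointedData C η)

section Functor

variable [∀ X Y : C, FiniteDimensional ℂ (X ⟶ Y)]

/-- Coordinates on the multiplicity space of `S h` in `X`. -/
noncomputable def coords (h : H) (X : C) :
    (D.S h ⟶ X) ≃ₗ[ℂ] (Fin (Module.finrank ℂ (D.S h ⟶ X)) → ℂ) :=
  -- Coordinates replace the morphism space, which lives in the universe `v`, by a space in `Type`,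
  -- as objects of `Vect η` require.
  (Module.finBasis ℂ (D.S h ⟶ X)).equivFun

/-- The direct sum of the multiplicity spaces. -/
abbrev MultSpace (X : C) : Type := ∀ h : H, Fin (Module.finrank ℂ (D.S h ⟶ X)) → ℂ

open Classical in
/-- The inclusion of a multiplicity space. -/
noncomputable def el {X : C} (h : H) : (D.S h ⟶ X) →ₗ[ℂ] D.MultSpace X :=
  LinearMap.single ℂ (fun h : H => Fin (Module.finrank ℂ (D.S h ⟶ X)) → ℂ) h ∘ₗ
    (D.coords h X).toLinearMap

/-- The projection to a multiplicity space. -/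
noncomputable def coel {X : C} (h : H) : D.MultSpace X →ₗ[ℂ] (D.S h ⟶ X) :=
  (D.coords h X).symm.toLinearMap ∘ₗ LinearMap.proj h

theorem coel_el {X : C} (h : H) (f : D.S h ⟶ X) : D.coel h (D.el h f) = f := by
  simp [coel, el]

theorem coel_el_ne {X : C} {g h : H} (hgh : g ≠ h) (f : D.S h ⟶ X) : D.coel g (D.el h f) = 0 := by
  simp [coel, el, hgh]

theorem el_injective {X : C} (h : H) : Function.Injective (D.el h (X := X)) :=
  Function.LeftInverse.injective (D.coel_el h)

theorem el_congr {X : C} {h : H} {f g : D.S h ⟶ X} (hfg : f = g) : D.el h f = D.el h g := by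
  rw [hfg]

variable [Fintype H]

theorem sum_el_coel {X : C} (x : D.MultSpace X) : ∑ h, D.el h (D.coel h x) = x := by
  classical
  simp only [coel, el, LinearMap.comp_apply, LinearEquiv.coe_coe, LinearEquiv.apply_symm_apply]
  exact LinearMap.sum_single_apply _ x

/-- The grading by the multiplicity spaces. -/
noncomputable def multGrading (X : C) : Grading H (D.MultSpace X) where
  proj h := D.el h ∘ₗ D.coel h
  proj_self h x := by simp [coel_el]
  proj_ne g h x hgh := by simp [D.coel_el_ne hgh]
  sum_proj x := D.sum_el_coel x

theorem proj_el {X : C} (h : H) (f : D.S h ⟶ X) :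
    (D.multGrading X).proj h (D.el h f) = D.el h f := by
  simp [multGrading, coel_el]

theorem exists_el {X : C} {h : H} {x : D.MultSpace X} (hx : (D.multGrading X).proj h x = x) :
    ∃ f, x = D.el h f := ⟨D.coel h x, hx.symm⟩

/-- The linear map given by linear maps on the multiplicity spaces. -/
noncomputable def desc {X : C} {W : Type} [AddCommGroup W] [Module ℂ W]
    (φ : ∀ h, (D.S h ⟶ X) →ₗ[ℂ] W) : D.MultSpace X →ₗ[ℂ] W := ∑ h, φ h ∘ₗ D.coel h

theorem desc_el {X : C} {W : Type} [AddCommGroup W] [Module ℂ W]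
    (φ : ∀ h, (D.S h ⟶ X) →ₗ[ℂ] W) (h : H) (f : D.S h ⟶ X) : D.desc φ (D.el h f) = φ h f := by
  classical
  rw [desc, LinearMap.sum_apply, Finset.sum_eq_single h]
  · simp [coel_el]
  · intro g _ hg
    simp [D.coel_el_ne hg]
  · simp

theorem lin_ext {X : C} {W : Type} [AddCommGroup W] [Module ℂ W] {φ ψ : D.MultSpace X →ₗ[ℂ] W}
    (h : ∀ a (f : D.S a ⟶ X), φ (D.el a f) = ψ (D.el a f)) : φ = ψ :=
  (D.multGrading X).lin_ext fun a x hx => by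
    obtain ⟨f, rfl⟩ := D.exists_el hx
    exact h a f

/-- The graded multiplicity space of `X`. -/
@[reducible] noncomputable def mult (X : C) : Vect η where
  V := D.MultSpace X
  grading := D.multGrading X

theorem isHom_of_el {X : C} {Y : Vect η} {φ : D.MultSpace X →ₗ[ℂ] Y.V}
    (h : ∀ a (f : D.S a ⟶ X), Y.grading.proj a (φ (D.el a f)) = φ (D.el a f)) :
    Grading.IsHom (D.multGrading X) Y.grading φ :=
  Grading.isHom_of_homog fun a x hx => by
    obtain ⟨f, rfl⟩ := D.exists_el hx
    exact h a f

/-- Composition with `g` on the multiplicity spaces. -/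
noncomputable def multMap {X Y : C} (g : X ⟶ Y) : D.mult X ⟶ D.mult Y :=
  Vect.ofLin (X := D.mult X) (Y := D.mult Y)
    (D.desc fun a => D.el a ∘ₗ Linear.rightComp ℂ (D.S a) g)
    (D.isHom_of_el (Y := D.mult Y) fun a f => by
      rw [desc_el]
      exact D.proj_el _ _)

theorem multMap_el {X Y : C} (g : X ⟶ Y) (a : H) (f : D.S a ⟶ X) :
    Vect.lin (D.multMap g) (D.el a f) = D.el a (f ≫ g) := D.desc_el _ a f

theorem mult_hom_ext {X : C} {Y : Vect η} {φ ψ : D.mult X ⟶ Y}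
    (h : ∀ a (f : D.S a ⟶ X), Vect.lin φ (D.el a f) = Vect.lin ψ (D.el a f)) : φ = ψ :=
  Vect.hom_ext (D.lin_ext h)

/-- The functor of graded multiplicity spaces. -/
noncomputable def multFunctor : C ⥤ Vect η where
  obj := D.mult
  map := D.multMap
  map_id X := D.mult_hom_ext fun a f => by
    rw [multMap_el, Category.comp_id]
    rfl
  map_comp f g := D.mult_hom_ext fun a h => by
    rw [Vect.lin_comp, LinearMap.comp_apply, multMap_el, multMap_el, multMap_el, Category.assoc]

theorem multMap_add {X Y : C} (f g : X ⟶ Y) : D.multMap (f + g) = D.multMap f + D.multMap g :=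
  D.mult_hom_ext fun a h => by
    rw [Vect.lin_add, LinearMap.add_apply, multMap_el, multMap_el, multMap_el,
      Preadditive.comp_add, map_add]

theorem multMap_smul {X Y : C} (c : ℂ) (f : X ⟶ Y) : D.multMap (c • f) = c • D.multMap f :=
  D.mult_hom_ext fun a h => by
    rw [Vect.lin_smul, LinearMap.smul_apply, multMap_el, multMap_el, Linear.comp_smul, map_smul]

instance : D.multFunctor.Additive where
  map_add := D.multMap_add _ _

instance : D.multFunctor.Linear ℂ where
  map_smul f c := D.multMap_smul c f

instance : D.multFunctor.Faithful where
  map_injective {X Y f g} h := by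
    obtain ⟨J, _, d, ⟨E⟩⟩ := D.span X
    refine E.hom_ext fun i => D.el_injective (d i) ?_
    rw [← multMap_el, ← multMap_el]
    exact congrArg (fun t => Vect.lin t (D.el (d i) (E.ι i))) h

/-- A morphism `S a ⟶ S b` is zero or a scalar, so degree-preserving linear maps automatically
commute with precomposition; this is what makes the functor full. -/
theorem lin_el_comp {X Y : C} (φ : D.mult X ⟶ D.mult Y) {a b : H} (t : D.S a ⟶ D.S b)
    (i : D.S b ⟶ X) (g : D.S b ⟶ Y) (h : Vect.lin φ (D.el b i) = D.el b g) :
    Vect.lin φ (D.el a (t ≫ i)) = D.el a (t ≫ g) := by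
  by_cases hab : a = b
  · subst hab
    obtain ⟨c, rfl⟩ := (D.brick a).exists_smul t
    simp only [Linear.smul_comp, Category.id_comp, map_smul, h]
  · rw [D.hom_zero a b hab t, zero_comp, zero_comp, map_zero, map_zero, map_zero]

instance : D.multFunctor.Full where
  map_surjective {X Y} φ := by
    obtain ⟨J, _, d, ⟨E⟩⟩ := D.span X
    have h : ∀ i, ∃ g, Vect.lin φ (D.el (d i) (E.ι i)) = D.el (d i) g := fun i =>
      D.exists_el ((Vect.isHom_lin φ).homog (D.proj_el _ _))
    choose g hg using h
    -- The values of `φ` on the inclusions of the summands of `X` prescribe the preimage on each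
    -- summand.
    refine ⟨∑ i, E.π i ≫ g i, D.mult_hom_ext fun a f => ?_⟩
    refine (D.multMap_el _ a f).trans ?_
    conv_rhs => rw [← Category.comp_id f, ← E.total]
    simp only [Preadditive.comp_sum, map_sum, ← Category.assoc]
    exact Finset.sum_congr rfl fun i _ => (D.lin_el_comp φ _ _ _ (hg i)).symm

theorem isIso_lineMult (a : H) :
    IsIso (Vect.ofVec (X := D.mult (D.S a)) (D.el a (𝟙 _)) (D.proj_el _ _)) := by
  refine Vect.isIso_of_bijective _ ⟨?_, fun x => ?_⟩
  · intro c d h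
    change c • D.el a (𝟙 _) = d • D.el a (𝟙 _) at h
    rw [← map_smul, ← map_smul] at h
    exact (D.brick a).eq_of_smul (D.el_injective a h)
  · refine (D.multGrading (D.S a)).homog_induction
      (C := fun x => ∃ c : ℂ, c • D.el a (𝟙 _) = x) ⟨0, zero_smul _ _⟩ ?_ ?_ x
    · intro b x hx
      obtain ⟨f, rfl⟩ := D.exists_el hx
      by_cases hab : b = a
      · subst hab
        obtain ⟨c, rfl⟩ := (D.brick b).exists_smul f
        exact ⟨c, (map_smul _ _ _).symm⟩
      · exact ⟨0, by rw [D.hom_zero b a hab f, zero_smul, map_zero]⟩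
    · rintro _ _ ⟨c, rfl⟩ ⟨d, rfl⟩
      exact ⟨c + d, add_smul _ _ _⟩

/-- The multiplicity space of `S a` is the line of degree `a`. -/
noncomputable def lineMult (a : H) : Vect.line η a ≅ D.mult (D.S a) :=
  have := D.isIso_lineMult a
  asIso (Vect.ofVec (X := D.mult (D.S a)) (D.el a (𝟙 _)) (D.proj_el _ _))

theorem lineMult_one (a : H) : Vect.lin (D.lineMult a).hom (1 : ℂ) = D.el a (𝟙 _) :=
  one_smul ℂ (D.el a (𝟙 _))

instance [HasFiniteBiproducts C] : D.multFunctor.EssSurj where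
  mem_essImage X := by
    obtain ⟨J, _, d, ⟨E⟩⟩ := Vect.nonempty_decomposition X
    exact ⟨⨁ fun j => D.S (d j), (((Decomposition.biproduct fun j => D.S (d j)).map
      D.multFunctor).congr fun j => (D.lineMult (d j)).symm).nonempty_iso_of E⟩

end Functor

end PointedData

/-! ### The tensor structure of the multiplicity functor -/

namespace PointedData

variable {C : Type u} [Category.{v} C] [Preadditive C] [Linear ℂ C] [MonoidalCategory C]
variable {H : Type} [Group H] {η : Cocycle3 H} (D : PointedData C η)

theorem m_ne_zero (a b k : H) (h : a * b = k) : (D.m a b k h).hom ≠ 0 := fun h0 =>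
  (D.brick k).id_ne_zero (by rw [← (D.m a b k h).hom_inv_id, h0, zero_comp])

section Unit

variable [MonoidalPreadditive C] [MonoidalLinear ℂ C]

/-- The unit constraints in terms of an isomorphism `S 1 ≅ 𝟙`. -/
theorem exists_unit_scalars (u : D.S 1 ≅ 𝟙_ C) : ∃ l r : H → ℂ,
    (∀ b, (D.m 1 b b (one_mul b)).hom ≫ u.hom ▷ D.S b ≫ (λ_ (D.S b)).hom = l b • 𝟙 (D.S b)) ∧
    (∀ a, (D.m a 1 a (mul_one a)).hom ≫ D.S a ◁ u.hom ≫ (ρ_ (D.S a)).hom = r a • 𝟙 (D.S a)) ∧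
    l 1 = r 1 ∧ ∀ a b, r a = η a 1 b * l b := by
  choose l hl using fun b => (D.brick b).exists_smul
    ((D.m 1 b b (one_mul b)).hom ≫ u.hom ▷ D.S b ≫ (λ_ (D.S b)).hom)
  choose r hr using fun a => (D.brick a).exists_smul
    ((D.m a 1 a (mul_one a)).hom ≫ D.S a ◁ u.hom ≫ (ρ_ (D.S a)).hom)
  refine ⟨l, r, hl, hr, (D.brick 1).eq_of_smul ?_, fun a b => ?_⟩
  · rw [← hl, ← hr]
    congr 1
    rw [← cancel_mono u.hom]
    rw [Category.assoc, Category.assoc, ← leftUnitor_naturality, ← rightUnitor_naturality,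
      ← whisker_exchange_assoc, unitors_equal]
  -- Associativity at `(a, 1, b)`, followed by `u` and the triangle axiom, compares the left scalar
  -- of `b` with the right scalar of `a`.
  · have h := D.assoc a 1 b a b (a * b) (mul_one a) rfl (one_mul b) rfl
    have h' := congrArg (· ≫ D.S a ◁ (u.hom ▷ D.S b ≫ (λ_ (D.S b)).hom)) h
    simp only [Category.assoc, Linear.smul_comp, ← MonoidalCategory.whiskerLeft_comp] at h'
    rw [hl, MonoidalCategory.whiskerLeft_comp, ← associator_naturality_middle_assoc, triangle,
      ← comp_whiskerRight, ← comp_whiskerRight, hr] at h'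
    simp only [MonoidalLinear.whiskerLeft_smul, MonoidalLinear.smul_whiskerRight, Linear.comp_smul,
      MonoidalCategory.whiskerLeft_id, id_whiskerRight, Category.comp_id, smul_smul] at h'
    exact smul_left_injective ℂ (D.m_ne_zero a b _ rfl) h'

/-- From `r a = η a 1 b * l b` and `l 1 = r 1`, dividing `u` by `l 1` turns the scalars into the
corrections in the unitors of `Vect η`. -/
theorem exists_unit_iso : ∃ u : D.S 1 ≅ 𝟙_ C,
    (∀ b, (D.m 1 b b (one_mul b)).hom ≫ u.hom ▷ D.S b ≫ (λ_ (D.S b)).hom =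
      (((η 1 1 b)⁻¹ : ℂˣ) : ℂ) • 𝟙 (D.S b)) ∧
    ∀ a, (D.m a 1 a (mul_one a)).hom ≫ D.S a ◁ u.hom ≫ (ρ_ (D.S a)).hom =
      (η a 1 1 : ℂ) • 𝟙 (D.S a) := by
  obtain ⟨u⟩ := D.unit
  obtain ⟨l, r, hl, hr, h1, hlr⟩ := D.exists_unit_scalars u
  have h0 : l 1 ≠ 0 := fun h0 => by
    have h := hl 1
    rw [h0, zero_smul, ← whiskerRightIso_hom, ← Iso.trans_hom, ← Iso.trans_hom] at h
    apply (D.brick 1).id_ne_zero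
    rw [← Iso.hom_inv_id (D.m 1 1 1 (one_mul 1) ≪≫ whiskerRightIso u (D.S 1) ≪≫ λ_ (D.S 1)), h,
      zero_comp]
  have hl' : ∀ b, (l 1)⁻¹ * l b = (((η 1 1 b)⁻¹ : ℂˣ) : ℂ) := fun b => by
    rw [h1, hlr 1 b]
    have : l b ≠ 0 := fun h => h0 (by rw [h1, hlr 1 b, h, mul_zero])
    rw [mul_inv, inv_mul_cancel_right₀ this, Units.val_inv_eq_inv_val]
  have hr' : ∀ a, (l 1)⁻¹ * r a = η a 1 1 := fun a => by
    rw [hlr a 1, mul_comm, mul_inv_cancel_right₀ h0]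
  refine ⟨⟨(l 1)⁻¹ • u.hom, l 1 • u.inv, by simp [h0], by simp [h0]⟩, fun b => ?_, fun a => ?_⟩
  · simp only [MonoidalLinear.smul_whiskerRight, Linear.smul_comp, Linear.comp_smul, hl, smul_smul,
      hl']
  · simp only [MonoidalLinear.whiskerLeft_smul, Linear.smul_comp, Linear.comp_smul, hr, smul_smul,
      hr']

end Unit

section Monoidal

variable [∀ X Y : C, FiniteDimensional ℂ (X ⟶ Y)] [Fintype H]
variable [MonoidalPreadditive C] [MonoidalLinear ℂ C]

/-- The product of multiplicity vectors of degrees `a` and `b`. -/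
noncomputable def elMul (X Y : C) (a b : H) :
    (D.S a ⟶ X) →ₗ[ℂ] (D.S b ⟶ Y) →ₗ[ℂ] D.MultSpace (X ⊗ Y) :=
  LinearMap.mk₂ ℂ (fun f g => D.el (a * b) ((D.m a b _ rfl).hom ≫ (f ⊗ₘ g)))
    (fun f f' g => by rw [MonoidalPreadditive.add_tensor, Preadditive.comp_add, map_add])
    (fun c f g => by
      rw [MonoidalCategory.tensorHom_def, MonoidalLinear.smul_whiskerRight, Linear.smul_comp, Linear.comp_smul,
        map_smul, ← MonoidalCategory.tensorHom_def])
    (fun f g g' => by rw [MonoidalPreadditive.tensor_add, Preadditive.comp_add, map_add])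
    (fun c f g => by
      rw [MonoidalCategory.tensorHom_def, MonoidalLinear.whiskerLeft_smul, Linear.comp_smul, Linear.comp_smul,
        map_smul, ← MonoidalCategory.tensorHom_def])

/-- The linear map underlying the tensorator. -/
noncomputable def tensoratorLin (X Y : C) :
    D.MultSpace X ⊗[ℂ] D.MultSpace Y →ₗ[ℂ] D.MultSpace (X ⊗ Y) :=
  TensorProduct.lift (∑ a, ∑ b, (D.elMul X Y a b).compl₁₂ (D.coel a) (D.coel b))

theorem tensoratorLin_el {X Y : C} (a b k : H) (h : a * b = k) (f : D.S a ⟶ X) (g : D.S b ⟶ Y) :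
    D.tensoratorLin X Y (D.el a f ⊗ₜ D.el b g) = D.el k ((D.m a b k h).hom ≫ (f ⊗ₘ g)) := by
  subst h
  rw [tensoratorLin, TensorProduct.lift.tmul, LinearMap.sum_apply, LinearMap.sum_apply,
    Finset.sum_eq_single a, LinearMap.sum_apply, LinearMap.sum_apply, Finset.sum_eq_single b]
  · rw [LinearMap.compl₁₂_apply, coel_el, coel_el]
    rfl
  · intro b' _ hb
    rw [LinearMap.compl₁₂_apply, D.coel_el_ne hb, map_zero]
  · simp
  · intro a' _ ha
    rw [LinearMap.sum_apply, LinearMap.sum_apply]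
    refine Finset.sum_eq_zero fun b' _ => ?_
    rw [LinearMap.compl₁₂_apply, D.coel_el_ne ha, map_zero, LinearMap.zero_apply]
  · simp

/-- The tensorator of the functor of multiplicity spaces. -/
noncomputable def tensorator (X Y : C) : D.mult X ⊗ D.mult Y ⟶ D.mult (X ⊗ Y) :=
  Vect.ofLin (X := Vect.tensor (D.mult X) (D.mult Y)) (Y := D.mult (X ⊗ Y)) (D.tensoratorLin X Y)
    (Grading.isHom_tensor_of_homog fun a b x y hx hy => by
      obtain ⟨f, rfl⟩ := D.exists_el hx
      obtain ⟨g, rfl⟩ := D.exists_el hy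
      rw [D.tensoratorLin_el a b _ rfl]
      exact D.proj_el _ _)

theorem tensor_mult_hom_ext {X Y : C} {Z : Vect η} {φ ψ : D.mult X ⊗ D.mult Y ⟶ Z}
    (h : ∀ a b (f : D.S a ⟶ X) (g : D.S b ⟶ Y),
      (show D.MultSpace X ⊗[ℂ] D.MultSpace Y →ₗ[ℂ] Z.V from Vect.lin φ) (D.el a f ⊗ₜ D.el b g) =
      (show D.MultSpace X ⊗[ℂ] D.MultSpace Y →ₗ[ℂ] Z.V from Vect.lin ψ) (D.el a f ⊗ₜ D.el b g)) :
    φ = ψ :=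
  Vect.hom_ext (TensorProduct.ext (D.lin_ext fun a f => D.lin_ext fun b g => h a b f g))

theorem tensorator_naturality {X Y X' Y' : C} (f : X ⟶ X') (g : Y ⟶ Y') :
    (D.multMap f ⊗ₘ D.multMap g) ≫ D.tensorator X' Y' = D.tensorator X Y ≫ D.multMap (f ⊗ₘ g) := by
  refine D.tensor_mult_hom_ext fun a b p q => ?_
  change D.tensoratorLin X' Y' (Vect.lin (D.multMap f) (D.el a p) ⊗ₜ
    Vect.lin (D.multMap g) (D.el b q)) =
      Vect.lin (D.multMap (f ⊗ₘ g)) (D.tensoratorLin X Y (D.el a p ⊗ₜ D.el b q))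
  rw [multMap_el, multMap_el, D.tensoratorLin_el a b _ rfl, D.tensoratorLin_el a b _ rfl,
    multMap_el, Category.assoc, tensorHom_comp_tensorHom]

theorem tensorator_naturality_left {X X' : C} (f : X ⟶ X') (Y : C) :
    D.multMap f ▷ D.mult Y ≫ D.tensorator X' Y = D.tensorator X Y ≫ D.multMap (f ▷ Y) := by
  have h := D.tensorator_naturality f (𝟙 Y)
  have h1 : D.multMap (𝟙 Y) = 𝟙 (D.mult Y) := D.multFunctor.map_id Y
  rwa [h1, tensorHom_id, tensorHom_id] at h

theorem tensorator_naturality_right (X : C) {Y Y' : C} (f : Y ⟶ Y') :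
    D.mult X ◁ D.multMap f ≫ D.tensorator X Y' = D.tensorator X Y ≫ D.multMap (X ◁ f) := by
  have h := D.tensorator_naturality (𝟙 X) f
  have h1 : D.multMap (𝟙 X) = 𝟙 (D.mult X) := D.multFunctor.map_id X
  rwa [h1, id_tensorHom, id_tensorHom] at h

theorem isIso_tensorator_S (a b : H) : IsIso (D.tensorator (D.S a) (D.S b)) := by
  have h : (Vect.lineTensor a b _ rfl).hom ≫ ((D.lineMult a).hom ⊗ₘ (D.lineMult b).hom) ≫
      D.tensorator (D.S a) (D.S b) =
      (D.lineMult (a * b)).hom ≫ D.multMap (D.m a b _ rfl).hom := by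
    refine Vect.line_hom_ext ?_
    change D.tensoratorLin (D.S a) (D.S b)
        (TensorProduct.map (Vect.lin (D.lineMult a).hom) (Vect.lin (D.lineMult b).hom)
          ((TensorProduct.lid ℂ ℂ).symm 1)) =
      Vect.lin (D.multMap (D.m a b _ rfl).hom) (Vect.lin (D.lineMult (a * b)).hom (1 : ℂ))
    rw [TensorProduct.lid_symm_apply, TensorProduct.map_tmul, lineMult_one, lineMult_one,
      lineMult_one, D.tensoratorLin_el a b _ rfl, multMap_el, id_tensorHom_id, Category.comp_id,
      Category.id_comp]
  have h0 : IsIso (D.multMap (D.m a b _ rfl).hom) :=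
    inferInstanceAs (IsIso (D.multFunctor.map (D.m a b _ rfl).hom))
  have h1 : IsIso (((D.lineMult a).hom ⊗ₘ (D.lineMult b).hom) ≫ D.tensorator (D.S a) (D.S b)) :=
    IsIso.of_isIso_fac_left h
  exact IsIso.of_isIso_comp_left ((D.lineMult a).hom ⊗ₘ (D.lineMult b).hom) _

/-- Naturality in each variable reduces the claim to `S a` and `S b`, where the tensorator is
induced by the isomorphism `D.m`. -/
theorem isIso_tensorator (X Y : C) : IsIso (D.tensorator X Y) := by
  obtain ⟨J, _, d, ⟨E⟩⟩ := D.span X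
  let t (Y : C) : D.multFunctor ⋙ tensorRight (D.mult Y) ⟶ tensorRight Y ⋙ D.multFunctor :=
    { app X := D.tensorator X Y
      naturality _ _ f := D.tensorator_naturality_left f Y }
  suffices h : ∀ i, IsIso ((t Y).app (D.S (d i))) from isIso_app_of_decomposition (t Y) E h
  intro i
  obtain ⟨J', _, d', ⟨E'⟩⟩ := D.span Y
  let t' (X : C) : D.multFunctor ⋙ tensorLeft (D.mult X) ⟶ tensorLeft X ⋙ D.multFunctor :=
    { app Y := D.tensorator X Y
      naturality _ _ f := D.tensorator_naturality_right X f }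
  have h : ∀ j, IsIso ((t' (D.S (d i))).app (D.S (d' j))) := fun j => D.isIso_tensorator_S _ _
  exact isIso_app_of_decomposition (t' (D.S (d i))) E' h

/-- The tensorator as an isomorphism. -/
noncomputable def tensoratorIso (X Y : C) : D.mult X ⊗ D.mult Y ≅ D.mult (X ⊗ Y) :=
  have := D.isIso_tensorator X Y
  asIso (D.tensorator X Y)

/-- On multiplicity vectors `f`, `g`, `h` this is the relation `D.assoc` followed by `f ⊗ g ⊗ h`;
the scalar `η a b c` there is the one in the associator of `Vect η`. -/
theorem tensorator_assoc (X Y Z : C) :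
    D.tensorator X Y ▷ D.mult Z ≫ D.tensorator (X ⊗ Y) Z ≫ D.multMap (α_ X Y Z).hom =
      (α_ (D.mult X) (D.mult Y) (D.mult Z)).hom ≫ D.mult X ◁ D.tensorator Y Z ≫
        D.tensorator X (Y ⊗ Z) := by
  refine Vect.hom_ext (TensorProduct.ext (TensorProduct.ext (D.lin_ext fun a f =>
    D.lin_ext fun b g => D.lin_ext fun c h => ?_)))
  change Vect.lin (D.multMap (α_ X Y Z).hom) (D.tensoratorLin (X ⊗ Y) Z
      (D.tensoratorLin X Y (D.el a f ⊗ₜ D.el b g) ⊗ₜ D.el c h)) =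
    D.tensoratorLin X (Y ⊗ Z) (TensorProduct.map LinearMap.id (D.tensoratorLin Y Z)
      (Grading.assocLin η (D.multGrading X) (D.multGrading Y) (D.multGrading Z)
        ((D.el a f ⊗ₜ D.el b g) ⊗ₜ D.el c h)))
  rw [Grading.assocLin_tmul _ _ _ _ (D.proj_el a f) (D.proj_el b g) (D.proj_el c h), map_smul,
    map_smul, TensorProduct.map_tmul, LinearMap.id_apply, D.tensoratorLin_el a b _ rfl,
    D.tensoratorLin_el b c _ rfl, D.tensoratorLin_el (a * b) c _ rfl,
    D.tensoratorLin_el a (b * c) _ (mul_assoc a b c).symm, multMap_el, ← map_smul]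
  refine D.el_congr ?_
  have key := congrArg (· ≫ (f ⊗ₘ g ⊗ₘ h))
    (D.assoc a b c _ _ _ rfl rfl rfl (mul_assoc a b c).symm)
  simp only [Category.assoc, Linear.smul_comp] at key
  rw [← associator_naturality, ← tensorHom_id, tensorHom_comp_tensorHom_assoc, Category.id_comp,
    ← id_tensorHom, tensorHom_comp_tensorHom, Category.id_comp] at key
  simpa only [Category.assoc] using key

/-- The functor of multiplicity spaces is a tensor functor. -/
theorem nonempty_monoidal : Nonempty D.multFunctor.Monoidal := by
  obtain ⟨u, hl, hr⟩ := D.exists_unit_iso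
  have hε : ∀ c : ℂ, Vect.lin ((D.lineMult 1).hom ≫ D.multMap u.hom) c = c • D.el 1 u.hom :=
    fun c => by
      have h1 : Vect.lin ((D.lineMult 1).hom ≫ D.multMap u.hom) (1 : ℂ) = D.el 1 u.hom := by
        rw [Vect.lin_comp, LinearMap.comp_apply, lineMult_one, multMap_el, Category.id_comp]
      rw [← h1, ← map_smul, smul_eq_mul, mul_one]
  refine ⟨Functor.CoreMonoidal.toMonoidal
    { εIso := (D.lineMult 1 : 𝟙_ (Vect η) ≅ D.mult (D.S 1)) ≪≫ D.multFunctor.mapIso u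
      μIso := fun X Y => D.tensoratorIso X Y
      μIso_hom_natural_left := fun f X' => D.tensorator_naturality_left f X'
      μIso_hom_natural_right := fun X' f => D.tensorator_naturality_right X' f
      associativity := D.tensorator_assoc
      left_unitality := fun X => ?_
      right_unitality := fun X => ?_ }⟩
  · refine Vect.hom_ext (TensorProduct.ext (LinearMap.ext_ring (D.lin_ext fun b f => ?_)))
    change Grading.scale (fun a => (η 1 1 a)⁻¹) (D.multGrading X) ((1 : ℂ) • D.el b f) =
      Vect.lin (D.multMap (λ_ X).hom) (D.tensoratorLin (𝟙_ C) X
        (Vect.lin ((D.lineMult 1).hom ≫ D.multMap u.hom) (1 : ℂ) ⊗ₜ D.el b f))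
    rw [one_smul, Grading.scale_homog _ _ (D.proj_el b f), hε, one_smul,
      D.tensoratorLin_el 1 b b (one_mul b), multMap_el, ← map_smul]
    refine D.el_congr ?_
    have h := congrArg (· ≫ f) (hl b)
    simp only [Category.assoc, Linear.smul_comp, Category.id_comp] at h
    rw [← h, ← leftUnitor_naturality, MonoidalCategory.tensorHom_def, Category.assoc, Category.assoc]
  · refine Vect.hom_ext (TensorProduct.ext (D.lin_ext fun b f => LinearMap.ext_ring ?_))
    change Grading.scale (fun a => η a 1 1) (D.multGrading X) ((1 : ℂ) • D.el b f) =
      Vect.lin (D.multMap (ρ_ X).hom) (D.tensoratorLin X (𝟙_ C)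
        (D.el b f ⊗ₜ Vect.lin ((D.lineMult 1).hom ≫ D.multMap u.hom) (1 : ℂ)))
    rw [one_smul, Grading.scale_homog _ _ (D.proj_el b f), hε, one_smul,
      D.tensoratorLin_el b 1 b (mul_one b), multMap_el, ← map_smul]
    refine D.el_congr ?_
    have h := congrArg (· ≫ f) (hr b)
    simp only [Category.assoc, Linear.smul_comp, Category.id_comp] at h
    rw [← h, ← rightUnitor_naturality, MonoidalCategory.tensorHom_def', Category.assoc, Category.assoc]

theorem tensorEquiv (D : PointedData C η) [HasFiniteBiproducts C] : TensorEquiv C (Vect η) :=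
  -- The functor is an equivalence by the instances for full, faithful and essentially surjective.
  ⟨D.multFunctor, { }, D.nonempty_monoidal, inferInstance, inferInstance⟩

end Monoidal

end PointedData

/-! ### Bricks under decompositions and equivalences -/

section Bricks

variable {C : Type u} [Category.{v} C] [Preadditive C] [Linear ℂ C]

theorem IsBrick.exists_iso {X : C} (h : IsBrick X) {J : Type} [Fintype J] {S : J → C}
    (D : Decomposition X S) : ∃ j, Nonempty (X ≅ S j) := by
  have h0 : ∃ j, D.π j ≫ D.ι j ≠ 0 := by
    by_contra! h0
    exact h.id_ne_zero (by rw [← D.total, Finset.sum_eq_zero fun j _ => h0 j])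
  obtain ⟨j, hj⟩ := h0
  exact ⟨j, ⟨⟨D.π j, D.ι j, h.eq_id_of_idem
    (by rw [Category.assoc, reassoc_of% D.ι_π j]) hj, D.ι_π j⟩⟩⟩

theorem isBrick_obj_iff {E : Type u'} [Category.{v'} E] [Preadditive E] [Linear ℂ E] (F : C ⥤ E)
    [F.Additive] [F.Linear ℂ] [F.Full] [F.Faithful] (X : C) : IsBrick (F.obj X) ↔ IsBrick X := by
  have h : (fun c : ℂ => c • 𝟙 (F.obj X)) =
      (fun f : X ⟶ X => F.map f) ∘ (fun c : ℂ => c • 𝟙 X) := funext fun c => by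
    simp [Functor.map_smul]
  rw [IsBrick, IsBrick, h]
  exact Function.Bijective.of_comp_iff' ⟨F.map_injective, F.map_surjective⟩ _

/-- Tensoring with an invertible object is an equivalence and so preserves endomorphism rings; this
is why products of simple objects are simple. -/
theorem isBrick_tensor_iff [MonoidalCategory C] [MonoidalPreadditive C] [MonoidalLinear ℂ C]
    {X : C} (h : IsInvertible X) (Y : C) : IsBrick (X ⊗ Y) ↔ IsBrick Y := by
  have := h.isEquivalence
  exact isBrick_obj_iff (tensorLeft X) Y

end Bricks

/-! ### Comparison of two families of simple objects -/

namespace PointedData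

section

variable {C : Type u} [Category.{v} C] [Preadditive C] [Linear ℂ C] [MonoidalCategory C]
variable {H : Type} [Group H] {η : Cocycle3 H}

theorem eq_of_iso (D : PointedData C η) {a b : H} (e : D.S a ≅ D.S b) : a = b := by
  by_contra h
  apply (D.brick a).id_ne_zero
  rw [← e.hom_inv_id, D.hom_zero a b h e.hom, zero_comp]

/-- The lines in `Vect η`. -/
noncomputable def lines [Fintype H] (η : Cocycle3 H) : PointedData (Vect η) η where
  S := Vect.line η
  m a b k h := Vect.lineTensor a b k h
  assoc := Vect.lineTensor_assoc
  unit := ⟨Iso.refl _⟩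
  brick := Vect.isBrick_line
  hom_zero _ _ h f := Vect.line_hom_zero h f
  span := Vect.nonempty_decomposition

/-- Relabelling by a group isomorphism. -/
def reindex {H' : Type} [Group H'] {η : Cocycle3 H'} (D : PointedData C η) (φ : H ≃* H') :
    PointedData C (η.comap φ.toMonoidHom) where
  S a := D.S (φ a)
  m a b k h := D.m (φ a) (φ b) (φ k) (by rw [← map_mul, h])
  assoc a b c ab bc k h1 h2 h3 h4 := D.assoc _ _ _ _ _ _ _ _ _ _
  unit := by rw [map_one]; exact D.unit
  brick a := D.brick _
  hom_zero a b h f := D.hom_zero _ _ (φ.injective.ne h) f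
  span X := by
    obtain ⟨J, i, d, E⟩ := D.span X
    exact ⟨J, i, fun j => φ.symm (d j), by simpa using E⟩

/-- The image under a tensor equivalence. -/
def map {E : Type u'} [Category.{v'} E] [Preadditive E] [Linear ℂ E] [MonoidalCategory E]
    (D : PointedData C η) (F : C ⥤ E) [F.IsEquivalence] [F.Monoidal] [F.Additive] [F.Linear ℂ] :
    PointedData E η where
  S a := F.obj (D.S a)
  m a b k h := F.mapIso (D.m a b k h) ≪≫ (Functor.Monoidal.μIso F _ _).symm
  assoc a b c ab bc k h1 h2 h3 h4 := by
    have h := congrArg (fun t => F.map t ≫ Functor.OplaxMonoidal.δ F _ _ ≫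
      F.obj (D.S a) ◁ Functor.OplaxMonoidal.δ F _ _) (D.assoc a b c ab bc k h1 h2 h3 h4)
    simp only [F.map_comp, Category.assoc, Functor.map_smul, Linear.smul_comp] at h
    rw [← Functor.OplaxMonoidal.associativity, ← Functor.OplaxMonoidal.δ_natural_left_assoc,
      ← Functor.OplaxMonoidal.δ_natural_right_assoc] at h
    simpa using h
  unit := D.unit.map fun u => F.mapIso u ≪≫ (Functor.Monoidal.εIso F).symm
  brick a := (isBrick_obj_iff F _).2 (D.brick a)
  hom_zero a b h f := by
    obtain ⟨g, rfl⟩ := F.map_surjective f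
    rw [D.hom_zero a b h g, F.map_zero]
  span Y := by
    obtain ⟨J, i, d, ⟨E⟩⟩ := D.span (F.objPreimage Y)
    exact ⟨J, i, d, ⟨(E.map F).ofIsoLeft (F.objObjPreimageIso Y)⟩⟩

variable [MonoidalPreadditive C] [MonoidalLinear ℂ C]

/-- Change of the cocycle by a coboundary. -/
def rescale {η' : Cocycle3 H} (D : PointedData C η) (h : H → H → ℂˣ)
    (hh : ∀ a b c, η a b c * (h (a * b) c * h a b) = η' a b c * (h b c * h a (b * c))) :
    PointedData C η' where
  S := D.S
  m a b k hk :=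
    { hom := (h a b : ℂ) • (D.m a b k hk).hom
      inv := (((h a b)⁻¹ : ℂˣ) : ℂ) • (D.m a b k hk).inv
      hom_inv_id := by simp
      inv_hom_id := by simp }
  assoc a b c ab bc k h1 h2 h3 h4 := by
    simp only [MonoidalLinear.smul_whiskerRight, MonoidalLinear.whiskerLeft_smul, Linear.smul_comp,
      Linear.comp_smul, D.assoc a b c ab bc k h1 h2 h3 h4, smul_smul]
    congr 1
    subst h1 h3
    have := congrArg Units.val (hh a b c)
    push_cast at this
    linear_combination this
  unit := D.unit
  brick := D.brick
  hom_zero := D.hom_zero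
  span := D.span

/-- The isomorphisms `θ` intertwine the two multiplications up to scalars `s a b`. Comparing
associativity for the two families shows that `s` is a 2-cochain whose coboundary relates the
cocycles. -/
theorem cls_eq {η' : Cocycle3 H} (D : PointedData C η) (D' : PointedData C η')
    (θ : ∀ a, D.S a ≅ D'.S a) : η.cls = η'.cls := by
  have hex : ∀ a b, ∃ c : ℂ, (D.m a b _ rfl).hom ≫ ((θ a).hom ⊗ₘ (θ b).hom) =
      c • (θ (a * b)).hom ≫ (D'.m a b _ rfl).hom := fun a b => by
    obtain ⟨c, hc⟩ := (D.brick (a * b)).exists_smul ((D.m a b _ rfl).hom ≫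
      ((θ a).hom ⊗ₘ (θ b).hom) ≫ (D'.m a b _ rfl).inv ≫ (θ (a * b)).inv)
    refine ⟨c, ?_⟩
    have := congrArg (· ≫ (θ (a * b)).hom ≫ (D'.m a b _ rfl).hom) hc
    simpa using this
  choose s hs using hex
  have h0 : ∀ a b, s a b ≠ 0 := fun a b h0 => by
    have h := hs a b
    rw [h0, zero_smul] at h
    apply D.m_ne_zero a b _ rfl
    rw [← cancel_mono ((θ a).hom ⊗ₘ (θ b).hom), h, zero_comp]
  have hs' : ∀ a b k (h : a * b = k), (D.m a b k h).hom ≫ ((θ a).hom ⊗ₘ (θ b).hom) =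
      s a b • (θ k).hom ≫ (D'.m a b k h).hom := by
    rintro a b _ rfl
    exact hs a b
  refine ((Cocycle3.cls_eq_iff _ _).2 ⟨fun a b => Units.mk0 (s a b) (h0 a b), fun a b c =>
    Units.ext ?_⟩).symm
  simp only [Units.val_mul, Units.val_mk0]
  have key := congrArg (· ≫ ((θ a).hom ⊗ₘ (θ b).hom ⊗ₘ (θ c).hom))
    (D.assoc a b c _ _ _ rfl rfl rfl (mul_assoc a b c).symm)
  simp only [Category.assoc, Linear.smul_comp] at key
  rw [← associator_naturality, ← tensorHom_id, tensorHom_comp_tensorHom_assoc, Category.id_comp,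
    ← id_tensorHom, tensorHom_comp_tensorHom, Category.id_comp, hs' a b _ rfl, hs' b c _ rfl] at key
  have e1 : s a b • (θ (a * b)).hom ≫ (D'.m a b _ rfl).hom ⊗ₘ (θ c).hom =
      s a b • ((θ (a * b)).hom ⊗ₘ (θ c).hom) ≫ (D'.m a b _ rfl).hom ▷ D'.S c := by
    rw [MonoidalCategory.tensorHom_def, MonoidalLinear.smul_whiskerRight, Linear.smul_comp,
      ← MonoidalCategory.tensorHom_def, ← tensorHom_id, tensorHom_comp_tensorHom, Category.comp_id]
  have e2 : (θ a).hom ⊗ₘ s b c • (θ (b * c)).hom ≫ (D'.m b c _ rfl).hom =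
      s b c • ((θ a).hom ⊗ₘ (θ (b * c)).hom) ≫ D'.S a ◁ (D'.m b c _ rfl).hom := by
    rw [MonoidalCategory.tensorHom_def, MonoidalLinear.whiskerLeft_smul, Linear.comp_smul,
      ← MonoidalCategory.tensorHom_def, ← id_tensorHom, tensorHom_comp_tensorHom, Category.comp_id]
  rw [e1, e2] at key
  simp only [Linear.smul_comp, Linear.comp_smul, Category.assoc] at key
  rw [reassoc_of% hs' (a * b) c _ rfl, reassoc_of% hs' a (b * c) _ (mul_assoc a b c).symm] at key
  simp only [Linear.smul_comp, Category.assoc,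
    D'.assoc a b c _ _ _ rfl rfl rfl (mul_assoc a b c).symm, Linear.comp_smul, smul_smul] at key
  have hne : (θ (a * b * c)).hom ≫ (D'.m a (b * c) _ (mul_assoc a b c).symm).hom ≫
      D'.S a ◁ (D'.m b c _ rfl).hom ≠ 0 := fun h => by
    apply D'.m_ne_zero a (b * c) _ (mul_assoc a b c).symm
    rw [← cancel_epi (θ (a * b * c)).hom, ← cancel_mono (D'.S a ◁ (D'.m b c _ rfl).hom),
      Category.assoc, h, comp_zero, zero_comp]
  have := smul_left_injective ℂ hne key
  linear_combination this

/-- The group and the class of the cocycle are determined by the tensor category. -/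
theorem exists_mulEquiv {H' : Type} [Group H'] {η' : Cocycle3 H'} (D : PointedData C η)
    (D' : PointedData C η') :
    ∃ φ : H ≃* H', cohPullback (Additive ℂˣ) 3 φ.toMonoidHom η'.cls = η.cls := by
  have h1 : ∀ a, ∃ b, Nonempty (D.S a ≅ D'.S b) := fun a => by
    obtain ⟨J, _, d, ⟨E⟩⟩ := D'.span (D.S a)
    obtain ⟨j, hj⟩ := (D.brick a).exists_iso E
    exact ⟨d j, hj⟩
  have h2 : ∀ b, ∃ a, Nonempty (D'.S b ≅ D.S a) := fun a => by
    obtain ⟨J, _, d, ⟨E⟩⟩ := D.span (D'.S a)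
    obtain ⟨j, hj⟩ := (D'.brick a).exists_iso E
    exact ⟨d j, hj⟩
  choose f e using h1
  choose g e' using h2
  let φ : H ≃* H' :=
    { toFun := f
      invFun := g
      left_inv := fun a => by
        obtain ⟨i⟩ := e a
        obtain ⟨j⟩ := e' (f a)
        exact D.eq_of_iso (j.symm ≪≫ i.symm)
      right_inv := fun a => by
        obtain ⟨i⟩ := e' a
        obtain ⟨j⟩ := e (g a)
        exact D'.eq_of_iso (j.symm ≪≫ i.symm)
      map_mul' := fun a b => by
        obtain ⟨i⟩ := e a
        obtain ⟨j⟩ := e b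
        obtain ⟨k⟩ := e (a * b)
        exact D'.eq_of_iso (k.symm ≪≫ D.m a b _ rfl ≪≫ (i ⊗ᵢ j) ≪≫ (D'.m _ _ _ rfl).symm) }
  refine ⟨φ, ?_⟩
  rw [← Cocycle3.cls_comap]
  exact (D.cls_eq (D'.reindex φ) fun a => (e a).some).symm

end

end PointedData

/-- An equivalence transports the lines of `Vect η` to a second family in `Vect η'`. Conversely the
lines of `Vect η'`, relabelled by `φ` and rescaled by a cochain, have cocycle exactly `η`, and the
multiplicity functor gives the equivalence. -/
theorem tensorEquiv_vect_iff {H H' : Type} [Group H] [Fintype H] [Group H'] [Fintype H']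
    (η : Cocycle3 H) (η' : Cocycle3 H') : TensorEquiv (Vect η) (Vect η') ↔
      ∃ φ : H ≃* H', cohPullback (Additive ℂˣ) 3 φ.toMonoidHom η'.cls = η.cls := by
  constructor
  · rintro ⟨F, _, ⟨_⟩, _, _⟩
    exact ((PointedData.lines η).map F).exists_mulEquiv (PointedData.lines η')
  · rintro ⟨φ, h⟩
    rw [← Cocycle3.cls_comap] at h
    obtain ⟨s, hs⟩ := (Cocycle3.cls_eq_iff _ _).1 h
    have := Vect.finite_hom (η := η')
    exact (((PointedData.lines η').reindex φ).rescale s hs).tensorEquiv.symm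

/-! ### The group and the cocycle of a pointed fusion category -/

section

variable {C : Type u} [Category.{v} C] [Preadditive C] [Linear ℂ C] [MonoidalCategory C]

/-- The associativity scalars of a family of bricks that is multiplied by a group satisfy the
cocycle identity. -/
theorem pentagon_scalars [MonoidalPreadditive C] [MonoidalLinear ℂ C] {H : Type} [Group H]
    (S : H → C) (hS : ∀ a, IsBrick (S a)) (m : ∀ a b k, a * b = k → (S k ≅ S a ⊗ S b))
    (η : H → H → H → ℂ)
    (assoc : ∀ a b c ab bc k (h1 : a * b = ab) (h2 : ab * c = k) (h3 : b * c = bc)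
      (h4 : a * bc = k),
      (m ab c k h2).hom ≫ (m a b ab h1).hom ▷ S c ≫ (α_ (S a) (S b) (S c)).hom =
        η a b c • (m a bc k h4).hom ≫ S a ◁ (m b c bc h3).hom) (a b c d : H) :
    η b c d * η a (b * c) d * η a b c = η (a * b) c d * η a b (c * d) := by
  -- `P` splits off factors from the right, `Q` from the left. Each of the two paths of associators
  -- in the pentagon carries `P` to a multiple of `Q`, and the two multiples are the sides of the
  -- cocycle identity.
  let P := (m (a * b * c) d _ rfl).hom ≫ ((m (a * b) c _ rfl).hom ≫ (m a b _ rfl).hom ▷ S c) ▷ S d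
  let Q := (m a (b * (c * d)) (a * b * c * d) (by simp only [mul_assoc])).hom ≫
    S a ◁ (m b (c * d) _ rfl).hom ≫ S a ◁ S b ◁ (m c d _ rfl).hom
  have h1 : P ≫ (α_ (S a ⊗ S b) (S c) (S d)).hom ≫ (α_ (S a) (S b) (S c ⊗ S d)).hom =
      (η (a * b) c d * η a b (c * d)) • Q := by
    have e1 := assoc (a * b) c d _ _ _ rfl rfl rfl (mul_assoc (a * b) c d).symm
    have e2 := assoc a b (c * d) _ _ (a * b * c * d) rfl (mul_assoc (a * b) c d).symm rfl
      (by simp only [mul_assoc])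
    simp only [P, Q, comp_whiskerRight, Category.assoc, associator_naturality_left_assoc]
    rw [reassoc_of% e1]
    simp only [Linear.smul_comp, Category.assoc, whisker_exchange_assoc]
    rw [associator_naturality_right, reassoc_of% e2]
    simp only [Linear.smul_comp, Category.assoc, smul_smul]
  have h2 : P ≫ (α_ (S a) (S b) (S c)).hom ▷ S d ≫ (α_ (S a) (S b ⊗ S c) (S d)).hom ≫
      S a ◁ (α_ (S b) (S c) (S d)).hom = (η b c d * η a (b * c) d * η a b c) • Q := by
    have e1 := assoc a b c _ _ _ rfl rfl rfl (mul_assoc a b c).symm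
    have e2 := assoc a (b * c) d (a * b * c) _ (a * b * c * d) (mul_assoc a b c).symm rfl
      (mul_assoc b c d) (by simp only [mul_assoc])
    have e3 := assoc b c d _ _ _ rfl (mul_assoc b c d) rfl rfl
    simp only [P, Q, Category.assoc, ← comp_whiskerRight_assoc]
    rw [e1]
    simp only [MonoidalLinear.smul_whiskerRight, comp_whiskerRight, Linear.smul_comp,
      Linear.comp_smul, Category.assoc, associator_naturality_middle_assoc]
    rw [reassoc_of% e2]
    simp only [Linear.smul_comp, Category.assoc, ← MonoidalCategory.whiskerLeft_comp]
    rw [e3]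
    simp only [MonoidalLinear.whiskerLeft_smul, Linear.comp_smul, smul_smul]
    congr 1
    ring
  have hQ : Q ≠ 0 := fun h0 => by
    let q := m a (b * (c * d)) (a * b * c * d) (by simp only [mul_assoc]) ≪≫
      whiskerLeftIso (S a) (m b (c * d) _ rfl) ≪≫
        whiskerLeftIso (S a) (whiskerLeftIso (S b) (m c d _ rfl))
    have hq : q.hom = 0 := h0
    apply (hS (a * b * c * d)).id_ne_zero
    rw [← q.hom_inv_id, hq, zero_comp]
  rw [pentagon] at h2
  exact smul_left_injective ℂ hQ (h2.symm.trans h1)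

/-- A family of simple objects that represents every simple object once is multiplied by a
group. -/
theorem IsPointedFusion.exists_pointedData (hC : IsPointedFusion C) {H : Type} [Fintype H]
    (S : H → C) (hS : ∀ i, Simple (S i)) (hS' : ∀ X : C, Simple X → ∃! i, Nonempty (X ≅ S i)) :
    ∃ (_ : Group H) (η : Cocycle3 H), Nonempty (PointedData C η) := by
  have := hC.monoidalPreadditive
  have := hC.monoidalLinear
  have := hC.hasFiniteBiproducts
  have := hC.hasKernels
  have := hC.finite_hom
  have hinv : ∀ X : C, Simple X → IsInvertible X := hC.invertible
  have hbrick : ∀ X : C, Simple X → IsBrick X := fun X _ => isBrick_of_simple X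
  -- A brick is a direct sum of simple objects, hence isomorphic to one of them.
  have hsimple : ∀ X : C, IsBrick X → Simple X := fun X hX => by
    obtain ⟨n, T, hT, ⟨e⟩⟩ := hC.semisimple X
    obtain ⟨j, ⟨f⟩⟩ := hX.exists_iso (Decomposition.ofIso e)
    have := hT j
    exact Simple.of_iso f
  have hex : ∀ X : C, IsBrick X → ∃ i, Nonempty (X ≅ S i) := fun X hX =>
    (hS' X (hsimple X hX)).exists
  have huniq : ∀ i j, Nonempty (S i ≅ S j) → i = j := fun i j h =>
    (hS' (S i) (hS i)).unique ⟨Iso.refl _⟩ h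
  obtain ⟨o, ⟨u⟩⟩ := hex _ hC.end_unit
  have hmul : ∀ i j, ∃ k, Nonempty (S i ⊗ S j ≅ S k) := fun i j =>
    hex _ ((isBrick_tensor_iff (hinv _ (hS i)) _).2 (hbrick _ (hS j)))
  choose mu m using hmul
  -- The tensor inverse of `S i` is a brick because its product with `S i` is the unit object, which
  -- is one.
  have hinverse : ∀ i, ∃ j, Nonempty (S j ⊗ S i ≅ 𝟙_ C) := fun i => by
    obtain ⟨Y, ⟨e⟩, ⟨e'⟩⟩ := hinv _ (hS i)
    obtain ⟨j, ⟨f⟩⟩ := hex Y ((isBrick_tensor_iff (hinv _ (hS i)) _).1 (.of_iso e.symm hC.end_unit))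
    exact ⟨j, ⟨whiskerRightIso f.symm _ ≪≫ e'⟩⟩
  choose iv hiv using hinverse
  let _ : Mul H := ⟨mu⟩
  let _ : One H := ⟨o⟩
  let _ : Inv H := ⟨iv⟩
  let G : Group H := Group.ofLeftAxioms
    (fun a b c => huniq _ _ ⟨(m _ _).some.symm ≪≫ whiskerRightIso (m a b).some.symm _ ≪≫
      α_ _ _ _ ≪≫ whiskerLeftIso _ (m b c).some ≪≫ (m _ _).some⟩)
    (fun a => huniq _ _ ⟨(m _ _).some.symm ≪≫ whiskerRightIso u.symm _ ≪≫ λ_ _⟩)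
    (fun a => huniq _ _ ⟨(m _ _).some.symm ≪≫ (hiv a).some ≪≫ u⟩)
  refine ⟨G, ?_⟩
  let M : ∀ a b k : H, a * b = k → (S k ≅ S a ⊗ S b) := fun a b k h =>
    eqToIso (congrArg S h.symm) ≪≫ (m a b).some.symm
  have hη : ∀ a b c : H, ∃ s : ℂˣ,
      (M (a * b) c _ rfl).hom ≫ (M a b _ rfl).hom ▷ S c ≫ (α_ (S a) (S b) (S c)).hom =
        (s : ℂ) • (M a (b * c) _ (mul_assoc a b c).symm).hom ≫ S a ◁ (M b c _ rfl).hom :=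
    fun a b c => by
      let p := M (a * b) c _ rfl ≪≫ whiskerRightIso (M a b _ rfl) (S c) ≪≫ α_ (S a) (S b) (S c)
      let q := M a (b * c) _ (mul_assoc a b c).symm ≪≫ whiskerLeftIso (S a) (M b c _ rfl)
      obtain ⟨s, hs⟩ := (hbrick _ (hS _)).exists_smul (p.hom ≫ q.inv)
      have h0 : s ≠ 0 := fun h0 => (hbrick _ (hS (a * b * c))).id_ne_zero (by
        have h1 := (p ≪≫ q.symm).hom_inv_id
        have h2 : (p ≪≫ q.symm).hom = 0 := by
          rw [Iso.trans_hom, Iso.symm_hom, hs, h0, zero_smul]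
        rw [← h1, h2, zero_comp])
      refine ⟨Units.mk0 s h0, ?_⟩
      have h1 : p.hom = s • q.hom := by
        rw [← cancel_mono q.inv, hs, Linear.smul_comp, q.hom_inv_id]
      exact h1
  choose η hη using hη
  have assoc : ∀ a b c ab bc k (h1 : a * b = ab) (h2 : ab * c = k) (h3 : b * c = bc)
      (h4 : a * bc = k),
      (M ab c k h2).hom ≫ (M a b ab h1).hom ▷ S c ≫ (α_ (S a) (S b) (S c)).hom =
        (η a b c : ℂ) • (M a bc k h4).hom ≫ S a ◁ (M b c bc h3).hom := by
    rintro a b c _ _ _ rfl rfl rfl _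
    exact hη a b c
  have hcoc := pentagon_scalars S (fun a => hbrick _ (hS a)) M (fun a b c => η a b c) assoc
  refine ⟨⟨η, fun a b c d => Units.ext ?_⟩, ⟨⟨S, M, assoc, ⟨u.symm⟩, fun a => hbrick _ (hS a),
    fun a b hab f => ?_, fun X => ?_⟩⟩⟩
  · exact_mod_cast hcoc a b c d
  · by_contra hf
    have := hS a
    have := hS b
    have := isIso_of_hom_simple hf
    exact hab (huniq _ _ ⟨asIso f⟩)
  · obtain ⟨n, T, hT, ⟨e⟩⟩ := hC.semisimple X
    choose d hd using fun i => (hS' (T i) (hT i)).exists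
    exact ⟨_, _, d, ⟨(Decomposition.ofIso e).congr fun i => (hd i).some⟩⟩

/-- Pointed fusion categories are the categories `Vect η`. -/
theorem IsPointedFusion.exists_tensorEquiv (hC : IsPointedFusion C) {d : ℂ}
    (hd : HasGlobalDim C d) : ∃ (H : Type) (_ : Group H) (_ : Fintype H) (η : Cocycle3 H),
      (Nat.card H : ℂ) = d ∧ TensorEquiv C (Vect η) := by
  have := hC.monoidalPreadditive
  have := hC.monoidalLinear
  have := hC.hasFiniteBiproducts
  have := hC.finite_hom
  obtain ⟨n, S, δ, hS, hS', hδ, hsum⟩ := hd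
  obtain ⟨G, η, ⟨D⟩⟩ := hC.exists_pointedData S hS hS'
  refine ⟨Fin n, G, inferInstance, η, ?_, D.tensorEquiv⟩
  -- All simple objects are invertible, so the global dimension counts them.
  have h1 : ∀ i, δ i = 1 := fun i => by
    obtain ⟨Y, p, q, h⟩ := hδ i
    have := hS i
    rw [(show IsInvertible (S i) from hC.invertible _ (hS i)).sqDim_eq_one (id_nonzero _)
      hC.end_unit] at h
    exact IsBrick.eq_of_smul hC.end_unit (by rw [← h, one_smul])
  rw [← hsum]
  simp [h1]

end

/-! ### The groups of order eight -/

section OrderEight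

/-- Generators of a group of order 8 with a cyclic subgroup of order 4. -/
structure IsGenPair (G : Type) [Group G] (r s : G) (a b : ZMod 4) : Prop where
  orderOf_eq : orderOf r = 4
  ne_pow : ∀ i : ZMod 4, s ≠ r ^ i.val
  conj : s * r = r ^ b.val * s
  sq : s * s = r ^ a.val

namespace IsGenPair

variable {G : Type} [Group G] {r s : G} {a b : ZMod 4} (h : IsGenPair G r s a b)

theorem pow_val_add (h : IsGenPair G r s a b) (i j : ZMod 4) :
    r ^ (i + j).val = r ^ i.val * r ^ j.val := by
  have := pow_mod_orderOf r (i.val + j.val)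
  rwa [h.orderOf_eq, ← ZMod.val_add, pow_add] at this

theorem pow_val_mul (h : IsGenPair G r s a b) (i j : ZMod 4) :
    r ^ (i * j).val = (r ^ i.val) ^ j.val := by
  have := pow_mod_orderOf r (i.val * j.val)
  rwa [h.orderOf_eq, ← ZMod.val_mul, pow_mul] at this

theorem pow_val_injective (h : IsGenPair G r s a b) :
    Function.Injective (fun i : ZMod 4 => r ^ i.val) := fun i j hij => by
  have := (pow_inj_mod (x := r)).1 hij
  rw [h.orderOf_eq, Nat.mod_eq_of_lt i.val_lt, Nat.mod_eq_of_lt j.val_lt] at this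
  exact ZMod.val_injective 4 this

theorem conj_pow (h : IsGenPair G r s a b) (n : ℕ) : s * r ^ n = (r ^ b.val) ^ n * s := by
  induction n with
  | zero => simp
  | succ n ih => rw [pow_succ, ← mul_assoc, ih, mul_assoc, h.conj, pow_succ, mul_assoc]

/-- The normal form of the elements. -/
def elem (r s : G) (x : ZMod 4 × ZMod 2) : G := r ^ x.1.val * if x.2 = 0 then 1 else s

/-- Multiplication of normal forms. -/
def op (a b : ZMod 4) (x y : ZMod 4 × ZMod 2) : ZMod 4 × ZMod 2 :=
  if x.2 = 0 then (x.1 + y.1, y.2)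
  else if y.2 = 0 then (x.1 + b * y.1, x.2) else (x.1 + b * y.1 + a, 0)

theorem elem_mul (h : IsGenPair G r s a b) (x y : ZMod 4 × ZMod 2) :
    elem r s x * elem r s y = elem r s (op a b x y) := by
  by_cases hx : x.2 = 0
  · simp only [elem, op, hx, if_true, mul_one]
    rw [h.pow_val_add, mul_assoc]
  · by_cases hy : y.2 = 0
    · simp only [elem, op, hx, hy, if_true, if_false, mul_one]
      rw [h.pow_val_add, h.pow_val_mul, mul_assoc, h.conj_pow, mul_assoc]
    · simp only [elem, op, hx, hy, if_true, if_false, mul_one]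
      rw [h.pow_val_add, h.pow_val_add, h.pow_val_mul, ← h.sq, mul_assoc, ← mul_assoc s,
        h.conj_pow]
      simp only [mul_assoc]

theorem elem_injective (h : IsGenPair G r s a b) : Function.Injective (elem r s) := by
  have key : ∀ i j : ZMod 4, r ^ i.val ≠ r ^ j.val * s := fun i j hij => h.ne_pow (i - j) (by
    refine mul_left_cancel (a := r ^ j.val) ?_
    rw [← hij, ← h.pow_val_add, add_sub_cancel])
  rintro ⟨i, x⟩ ⟨j, y⟩ hxy
  have h2 : ∀ z : ZMod 2, z ≠ 0 → z = 1 := by decide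
  by_cases hx : x = 0 <;> by_cases hy : y = 0
  · subst hx hy
    simp only [elem, if_true, mul_one] at hxy
    rw [h.pow_val_injective hxy]
  · simp only [elem, hx, hy, if_true, if_false, mul_one] at hxy
    exact (key _ _ hxy).elim
  · simp only [elem, hx, hy, if_true, if_false, mul_one] at hxy
    exact (key _ _ hxy.symm).elim
  · simp only [elem, hx, hy, if_false, mul_left_inj] at hxy
    rw [h.pow_val_injective hxy, h2 x hx, h2 y hy]

theorem elem_bijective (h : IsGenPair G r s a b) (hG : Nat.card G = 8) :
    Function.Bijective (elem r s) := by
  have : Finite G := Nat.finite_of_card_ne_zero (by rw [hG]; decide)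
  refine h.elem_injective.bijective_of_nat_card_le ?_
  rw [hG]
  simp

/-- Every element has a unique normal form `rⁱ` or `rⁱ s`, and the multiplication of normal forms
depends only on `a` and `b`. -/
theorem nonempty_mulEquiv (h : IsGenPair G r s a b) (hG : Nat.card G = 8) {G' : Type} [Group G']
    {r' s' : G'} (h' : IsGenPair G' r' s' a b) (hG' : Nat.card G' = 8) : Nonempty (G ≃* G') := by
  let e := Equiv.ofBijective _ (h.elem_bijective hG)
  let e' := Equiv.ofBijective _ (h'.elem_bijective hG')
  have he : ∀ x y, e x * e y = e (op a b x y) := h.elem_mul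
  have he' : ∀ x y, e' x * e' y = e' (op a b x y) := h'.elem_mul
  refine ⟨{ e.symm.trans e' with map_mul' := fun x y => ?_ }⟩
  obtain ⟨x, rfl⟩ := e.surjective x
  obtain ⟨y, rfl⟩ := e.surjective y
  simp [he, he']

end IsGenPair

theorem isGenPair_Z4Z2 : IsGenPair Z4Z2 (.ofAdd (1, 0)) (.ofAdd (0, 1)) 0 1 where
  orderOf_eq := orderOf_eq_prime_pow (p := 2) (n := 1) (by decide) (by decide)
  ne_pow := by decide
  conj := by decide
  sq := by decide

theorem isGenPair_D8 : IsGenPair D8 (.r 1) (.sr 0) 0 3 where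
  orderOf_eq := orderOf_eq_prime_pow (p := 2) (n := 1) (by decide) (by decide)
  ne_pow := by decide
  conj := by decide
  sq := by decide

theorem isGenPair_Q8 : IsGenPair Q8 (.a 1) (.xa 0) 2 3 where
  orderOf_eq := orderOf_eq_prime_pow (p := 2) (n := 1) (by decide) (by decide)
  ne_pow := by decide
  conj := by decide
  sq := by decide

/-- The subgroup generated by `r` has index 2. For `s` outside it only `s²` and the conjugate of `r`
by `s` need to be known, and orders leave two possibilities for each. -/
theorem exists_mulEquiv_of_orderOf_eq_four {G : Type} [Group G] (hG : Nat.card G = 8)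
    (h8 : ∀ g : G, orderOf g ≠ 8) {r : G} (hr : orderOf r = 4) :
    Nonempty (G ≃* Z4Z2) ∨ Nonempty (G ≃* D8) ∨ Nonempty (G ≃* Q8) := by
  have hfin : Finite G := Nat.finite_of_card_ne_zero (by rw [hG]; decide)
  let K := Subgroup.zpowers r
  have hK : Nat.card K = 4 := by rw [Nat.card_zpowers, hr]
  have hindex : K.index = 2 := by
    have := K.card_mul_index
    rw [hK, hG] at this
    omega
  have hnormal : K.Normal := Subgroup.normal_of_index_eq_two hindex
  classical
  have hpow : ∀ x ∈ K, x = 1 ∨ x = r ∨ x = r ^ 2 ∨ x = r ^ 3 := fun x hx => by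
    obtain ⟨n, hn, rfl⟩ := Finset.mem_image.1 (mem_zpowers_iff_mem_range_orderOf.1 hx)
    rw [hr, Finset.mem_range] at hn
    interval_cases n <;> simp
  have hr4 : r ^ 4 = 1 := hr ▸ pow_orderOf_eq_one r
  have hr2 : r ^ 2 ≠ 1 := fun h => by
    have := orderOf_dvd_of_pow_eq_one h
    rw [hr] at this
    omega
  obtain ⟨s, hs⟩ : ∃ s, s ∉ K := by
    by_contra! h
    have : K = ⊤ := Subgroup.ext fun x => ⟨fun _ => trivial, fun _ => h x⟩
    rw [this, Subgroup.index_top] at hindex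
    omega
  have hs2 : s ^ 2 ∈ K := by
    have := Subgroup.sq_mem_of_index_two hindex s
    exact this
  have hd : ∀ g : G, orderOf g ∣ 2 ^ 3 := fun g => by
    have := orderOf_dvd_natCard g
    rwa [hG] at this
  have hnot8 : s ^ 4 = 1 := by
    obtain ⟨k, hk, hsk⟩ := (Nat.dvd_prime_pow Nat.prime_two).1 (hd s)
    rw [← orderOf_dvd_iff_pow_eq_one, hsk]
    interval_cases k
    · norm_num
    · norm_num
    · norm_num
    · exact (h8 s hsk).elim
  -- If `s²` were `r` or `r³`, then `s⁴` would be `r² ≠ 1`, against the absence of elements of order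
  -- 8.
  have hsq : s * s = 1 ∨ s * s = r ^ 2 := by
    rw [← sq]
    rcases hpow _ hs2 with h | h | h | h
    · exact Or.inl h
    · exact (hr2 (by rw [← h, ← pow_mul, hnot8])).elim
    · exact Or.inr h
    · refine (hr2 ?_).elim
      have : (s ^ 2) ^ 2 = 1 := by rw [← pow_mul, hnot8]
      rw [h, ← pow_mul, show 3 * 2 = 4 + 2 from rfl, pow_add, hr4, one_mul] at this
      exact this
  -- The conjugate of `r` lies in the normal subgroup and has order 4, so it is `r` or `r³`.
  have hconj : s * r = r * s ∨ s * r = r ^ 3 * s := by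
    have h1 : s * r * s⁻¹ ∈ K := hnormal.conj_mem r (Subgroup.mem_zpowers r) s
    rcases hpow _ h1 with h | h | h | h
    · refine (hr2 ?_).elim
      rw [conj_eq_one_iff.1 h, one_pow]
    · exact Or.inl (mul_inv_eq_iff_eq_mul.1 h)
    · refine (hr2 ?_).elim
      have h2 : (s * r * s⁻¹) ^ 2 = 1 := by rw [h, ← pow_mul, hr4]
      rwa [conj_pow, conj_eq_one_iff] at h2
    · exact Or.inr (mul_inv_eq_iff_eq_mul.1 h)
  have hs' : ∀ i : ZMod 4, s ≠ r ^ i.val := fun i hi =>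
    hs (hi ▸ Subgroup.npow_mem_zpowers r i.val)
  have hZ : Nat.card Z4Z2 = 8 := by simp
  have hD : Nat.card D8 = 8 := by rw [Nat.card_eq_fintype_card]; rfl
  have hQ : Nat.card Q8 = 8 := by rw [Nat.card_eq_fintype_card]; rfl
  rcases hconj with hc | hc
  · left
    rcases hsq with hq | hq
    · have h : IsGenPair G r s 0 1 := ⟨hr, hs',
        by rw [hc]; exact congrArg (· * s) (pow_one r).symm, hq.trans (pow_zero r).symm⟩
      exact h.nonempty_mulEquiv hG isGenPair_Z4Z2 hZ
    -- In the commutative case with `s² = r²`, the element `r s` squares to `r⁴ = 1` and replaces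
    -- `s`.
    · have h : IsGenPair G r (r * s) 0 1 := ⟨hr, fun i hi => hs ?_, ?_, ?_⟩
      · exact h.nonempty_mulEquiv hG isGenPair_Z4Z2 hZ
      · refine (Subgroup.mul_mem_cancel_left K (Subgroup.mem_zpowers r)).1 ?_
        rw [hi]
        exact Subgroup.npow_mem_zpowers r i.val
      · rw [mul_assoc, hc]
        exact congrArg (· * (r * s)) (pow_one r).symm
      · refine Eq.trans ?_ (pow_zero r).symm
        rw [mul_assoc, ← mul_assoc s, hc, mul_assoc r s s, hq, ← mul_assoc, ← sq, ← pow_add, hr4]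
  · right
    rcases hsq with hq | hq
    · have h : IsGenPair G r s 0 3 := ⟨hr, hs', hc, hq.trans (pow_zero r).symm⟩
      exact Or.inl (h.nonempty_mulEquiv hG isGenPair_D8 hD)
    · have h : IsGenPair G r s 2 3 := ⟨hr, hs', hc, hq⟩
      exact Or.inr (h.nonempty_mulEquiv hG isGenPair_Q8 hQ)

/-- A group with all squares trivial is commutative, hence a vector space over `𝔽₂`, here of
dimension 3. -/
theorem nonempty_mulEquiv_Z2Cubed {G : Type} [Group G] (hG : Nat.card G = 8)
    (h : ∀ g : G, g * g = 1) : Nonempty (G ≃* Z2Cubed) := by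
  have hcomm : ∀ a b : G, a * b = b * a := fun a b => by
    have h1 := h (a * b)
    rwa [mul_eq_one_iff_eq_inv, mul_inv_rev, ← mul_eq_one_iff_eq_inv.1 (h a),
      ← mul_eq_one_iff_eq_inv.1 (h b)] at h1
  let _ : CommGroup G := { mul_comm := hcomm }
  let _ : Module (ZMod 2) (Additive G) := AddCommGroup.zmodModule fun x => by
    rw [two_nsmul]
    exact h x.toMul
  have hfin : Finite G := Nat.finite_of_card_ne_zero (by rw [hG]; decide)
  have : Finite (Additive G) := hfin
  have : Module.Finite (ZMod 2) (Additive G) := Module.Finite.of_finite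
  have hcard : Nat.card (Additive G) = 2 ^ 3 := hG
  have hrank : Module.finrank (ZMod 2) (Additive G) = 3 := by
    rw [Module.natCard_eq_pow_finrank (K := ZMod 2), Nat.card_zmod] at hcard
    exact Nat.pow_right_injective le_rfl hcard
  let e := (Module.finBasisOfFinrankEq (ZMod 2) (Additive G) hrank).equivFun
  exact ⟨AddEquiv.toMultiplicativeRight e.toAddEquiv⟩

/-- The groups of order 8. -/
theorem exists_mulEquiv_of_card_eq_eight {G : Type} [Group G] (hG : Nat.card G = 8) :
    Nonempty (G ≃* Z2Cubed) ∨ Nonempty (G ≃* Z4Z2) ∨ Nonempty (G ≃* Z8) ∨ Nonempty (G ≃* D8) ∨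
      Nonempty (G ≃* Q8) := by
  by_cases h8 : ∃ g : G, orderOf g = 8
  · obtain ⟨g, hg⟩ := h8
    have hfin : Finite G := Nat.finite_of_card_ne_zero (by rw [hG]; decide)
    have hc : IsCyclic G := isCyclic_of_orderOf_eq_card g (by rw [hg, hG])
    have e := zmodCyclicMulEquiv hc
    rw [hG] at e
    exact Or.inr (Or.inr (Or.inl ⟨e.symm⟩))
  push Not at h8
  by_cases h4 : ∃ g : G, orderOf g = 4
  · obtain ⟨g, hg⟩ := h4
    rcases exists_mulEquiv_of_orderOf_eq_four hG h8 hg with h | h | h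
    · exact Or.inr (Or.inl h)
    · exact Or.inr (Or.inr (Or.inr (Or.inl h)))
    · exact Or.inr (Or.inr (Or.inr (Or.inr h)))
  push Not at h4
  refine Or.inl (nonempty_mulEquiv_Z2Cubed hG fun g => ?_)
  have hd : orderOf g ∣ 2 ^ 3 := by
    have := orderOf_dvd_natCard g
    rwa [hG] at this
  obtain ⟨k, hk, hgk⟩ := (Nat.dvd_prime_pow Nat.prime_two).1 hd
  have : orderOf g ∣ 2 := by
    interval_cases k
    · simp [hgk]
    · simp [hgk]
    · exact (h4 g hgk).elim
    · exact (h8 g hgk).elim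
  rw [← sq]
  exact orderOf_dvd_iff_pow_eq_one.1 this

/-- The number of solutions of `g² = 1`. -/
noncomputable def numSqOne (G : Type) [Group G] : ℕ := Nat.card {g : G // g * g = 1}

theorem numSqOne_eq {G G' : Type} [Group G] [Group G'] (e : G ≃* G') :
    numSqOne G = numSqOne G' :=
  Nat.card_congr (e.toEquiv.subtypeEquiv fun g => by
    change _ ↔ e g * e g = 1
    rw [← map_mul, EmbeddingLike.map_eq_one_iff])

theorem numSqOne_Z2Cubed : numSqOne Z2Cubed = 8 := by
  rw [numSqOne, Nat.card_eq_fintype_card]; decide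

theorem numSqOne_Z4Z2 : numSqOne Z4Z2 = 4 := by
  rw [numSqOne, Nat.card_eq_fintype_card]; decide

theorem numSqOne_Z8 : numSqOne Z8 = 2 := by
  rw [numSqOne, Nat.card_eq_fintype_card]; decide

theorem numSqOne_D8 : numSqOne D8 = 6 := by
  rw [numSqOne, Nat.card_eq_fintype_card]; decide

theorem numSqOne_Q8 : numSqOne Q8 = 2 := by
  rw [numSqOne, Nat.card_eq_fintype_card]; decide

/-- This is the one pair not separated by the number of solutions of `g² = 1`, so commutativity is
used. -/
theorem isEmpty_Z8_mulEquiv_Q8 : IsEmpty (Z8 ≃* Q8) := ⟨fun e => by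
  have h : (QuaternionGroup.a 1 * QuaternionGroup.xa 0 : Q8) =
      QuaternionGroup.xa 0 * QuaternionGroup.a 1 := by
    apply e.symm.injective
    rw [map_mul, map_mul, mul_comm]
  revert h
  decide⟩

end OrderEight

/-! ### Counting the tensor equivalence classes -/

section Classification

theorem Vect.hasGlobalDim_eight {H : Type} [Group H] [Fintype H] (η : Cocycle3 H)
    (hH : Nat.card H = 8) : HasGlobalDim (Vect η) 8 := by
  have h := Vect.hasGlobalDim η
  rw [hH] at h
  exact_mod_cast h

/-- The tensor equivalence class of `Vect η` for a group of order 8. -/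
noncomputable def vectClass {H : Type} [Group H] [Fintype H] (hH : Nat.card H = 8) (η : Cocycle3 H) :
    PointedFusionClasses.{0, 1} 8 :=
  Quotient.mk _ ⟨Vect η, Vect.isPointedFusion η, Vect.hasGlobalDim_eight η hH⟩

theorem vectClass_eq_iff {H H' : Type} [Group H] [Fintype H] [Group H'] [Fintype H']
    (hH : Nat.card H = 8) (hH' : Nat.card H' = 8) (η : Cocycle3 H) (η' : Cocycle3 H') :
    vectClass hH η = vectClass hH' η' ↔
      ∃ φ : H ≃* H', cohPullback (Additive ℂˣ) 3 φ.toMonoidHom η'.cls = η.cls := by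
  rw [vectClass, vectClass, Quotient.eq]
  exact tensorEquiv_vect_iff η η'

/-- The tensor equivalence class defined by an orbit of cohomology classes. -/
noncomputable def orbitClass {H : Type} [Group H] [Fintype H] (hH : Nat.card H = 8) :
    OrbitSpace H (Additive ℂˣ) 3 → PointedFusionClasses.{0, 1} 8 :=
  Quotient.lift (fun c => vectClass hH (Cocycle3.exists_cls_eq c).choose) fun c d h => by
    rw [vectClass_eq_iff, (Cocycle3.exists_cls_eq c).choose_spec,
      (Cocycle3.exists_cls_eq d).choose_spec]
    exact h

theorem exists_orbitClass {H : Type} [Group H] [Fintype H] (hH : Nat.card H = 8)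
    (x : OrbitSpace H (Additive ℂˣ) 3) :
    ∃ η : Cocycle3 H, ⟦η.cls⟧ = x ∧ orbitClass hH x = vectClass hH η := by
  induction x using Quotient.inductionOn with
  | h c => exact ⟨_, by rw [(Cocycle3.exists_cls_eq c).choose_spec], rfl⟩

theorem orbitClass_cls {H : Type} [Group H] [Fintype H] (hH : Nat.card H = 8) (η : Cocycle3 H) :
    orbitClass hH ⟦η.cls⟧ = vectClass hH η := by
  obtain ⟨η', h, h'⟩ := exists_orbitClass hH ⟦η.cls⟧
  rw [h', vectClass_eq_iff]
  exact Quotient.exact h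

theorem orbitClass_injective {H : Type} [Group H] [Fintype H] (hH : Nat.card H = 8) :
    Function.Injective (orbitClass hH) := fun x y h => by
  obtain ⟨η, rfl, hη⟩ := exists_orbitClass hH x
  obtain ⟨η', rfl, hη'⟩ := exists_orbitClass hH y
  rw [hη, hη', vectClass_eq_iff] at h
  exact Quotient.sound h

theorem orbitClass_ne {H H' : Type} [Group H] [Fintype H] [Group H'] [Fintype H']
    (hH : Nat.card H = 8) (hH' : Nat.card H' = 8) (h : IsEmpty (H ≃* H'))
    (x : OrbitSpace H (Additive ℂˣ) 3) (y : OrbitSpace H' (Additive ℂˣ) 3) :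
    orbitClass hH x ≠ orbitClass hH' y := fun hxy => by
  obtain ⟨η, rfl, hη⟩ := exists_orbitClass hH x
  obtain ⟨η', rfl, hη'⟩ := exists_orbitClass hH' y
  rw [hη, hη', vectClass_eq_iff] at hxy
  exact h.false hxy.choose

theorem card_Z2Cubed : Nat.card Z2Cubed = 8 := by rw [Nat.card_eq_fintype_card]; rfl
theorem card_Z4Z2 : Nat.card Z4Z2 = 8 := by rw [Nat.card_eq_fintype_card]; rfl
theorem card_Z8 : Nat.card Z8 = 8 := by rw [Nat.card_eq_fintype_card]; rfl
theorem card_D8 : Nat.card D8 = 8 := by rw [Nat.card_eq_fintype_card]; rfl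
theorem card_Q8 : Nat.card Q8 = 8 := by rw [Nat.card_eq_fintype_card]; rfl

theorem IsPointedFusion.tensorEquiv_of_dim_eight {C : Type u} [Category.{v} C] [Preadditive C]
    [Linear ℂ C] [MonoidalCategory C] (hC : IsPointedFusion C) (hd : HasGlobalDim C 8) :
    (∃ η : Cocycle3 Z2Cubed, TensorEquiv C (Vect η)) ∨
      (∃ η : Cocycle3 Z4Z2, TensorEquiv C (Vect η)) ∨
      (∃ η : Cocycle3 Z8, TensorEquiv C (Vect η)) ∨
      (∃ η : Cocycle3 D8, TensorEquiv C (Vect η)) ∨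
      (∃ η : Cocycle3 Q8, TensorEquiv C (Vect η)) := by
  obtain ⟨H, _, _, η, hH, e⟩ := hC.exists_tensorEquiv hd
  have hH : Nat.card H = 8 := by exact_mod_cast hH
  have key : ∀ {H' : Type} [Group H'] [Fintype H'], Nonempty (H ≃* H') →
      ∃ η' : Cocycle3 H', TensorEquiv C (Vect η') := by
    rintro H' _ _ ⟨φ⟩
    refine ⟨η.comap φ.symm.toMonoidHom, e.trans ((tensorEquiv_vect_iff _ _).2 ⟨φ, ?_⟩)⟩
    rw [Cocycle3.cls_comap, ← cohPullback_comp]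
    convert cohPullback_id _ 3 η.cls
    ext x
    simp
  exact (exists_mulEquiv_of_card_eq_eight hH).imp key (.imp key (.imp key (.imp key key)))

/-- The classification map. -/
noncomputable def classification : OrbitSpace Z2Cubed (Additive ℂˣ) 3 ⊕
    OrbitSpace Z4Z2 (Additive ℂˣ) 3 ⊕ OrbitSpace Z8 (Additive ℂˣ) 3 ⊕
      OrbitSpace D8 (Additive ℂˣ) 3 ⊕ OrbitSpace Q8 (Additive ℂˣ) 3 →
        PointedFusionClasses.{0, 1} 8 :=
  Sum.elim (orbitClass card_Z2Cubed) (Sum.elim (orbitClass card_Z4Z2)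
    (Sum.elim (orbitClass card_Z8) (Sum.elim (orbitClass card_D8) (orbitClass card_Q8))))

/-- Over one group, distinct orbits give inequivalent categories; over different groups an
equivalence would force an isomorphism of groups. Surjectivity is the description of pointed fusion
categories together with the list of groups of order 8. -/
theorem classification_bijective : Function.Bijective classification := by
  have hne : ∀ {H H' : Type} [Group H] [Group H'], numSqOne H ≠ numSqOne H' →
      IsEmpty (H ≃* H') := fun h => ⟨fun e => h (numSqOne_eq e)⟩
  constructor
  · refine (orbitClass_injective _).sumElim ((orbitClass_injective _).sumElim
      ((orbitClass_injective _).sumElim ((orbitClass_injective _).sumElim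
        (orbitClass_injective _) ?_) ?_) ?_) ?_
    · refine fun x y => orbitClass_ne _ _ (hne ?_) x y
      rw [numSqOne_D8, numSqOne_Q8]
      decide
    · rintro x (y | y)
      · refine orbitClass_ne _ _ (hne ?_) x y
        rw [numSqOne_Z8, numSqOne_D8]
        decide
      · exact orbitClass_ne _ _ isEmpty_Z8_mulEquiv_Q8 x y
    · rintro x (y | y | y) <;> refine orbitClass_ne _ _ (hne ?_) x y
      · rw [numSqOne_Z4Z2, numSqOne_Z8]
        decide
      · rw [numSqOne_Z4Z2, numSqOne_D8]
        decide
      · rw [numSqOne_Z4Z2, numSqOne_Q8]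
        decide
    · rintro x (y | y | y | y) <;> refine orbitClass_ne _ _ (hne ?_) x y
      · rw [numSqOne_Z2Cubed, numSqOne_Z4Z2]
        decide
      · rw [numSqOne_Z2Cubed, numSqOne_Z8]
        decide
      · rw [numSqOne_Z2Cubed, numSqOne_D8]
        decide
      · rw [numSqOne_Z2Cubed, numSqOne_Q8]
        decide
  · intro x
    induction x using Quotient.inductionOn with
    | h X =>
      have key : ∀ {H : Type} [Group H] [Fintype H] (hH : Nat.card H = 8) (η : Cocycle3 H),
          TensorEquiv X.C (Vect η) → orbitClass hH ⟦η.cls⟧ = ⟦X⟧ := fun hH η e => by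
        rw [orbitClass_cls]
        exact Quotient.sound e.symm
      rcases X.isPointedFusion.tensorEquiv_of_dim_eight X.hasGlobalDim with
        ⟨η, e⟩ | ⟨η, e⟩ | ⟨η, e⟩ | ⟨η, e⟩ | ⟨η, e⟩
      · exact ⟨.inl ⟦η.cls⟧, key card_Z2Cubed η e⟩
      · exact ⟨.inr (.inl ⟦η.cls⟧), key card_Z4Z2 η e⟩
      · exact ⟨.inr (.inr (.inl ⟦η.cls⟧)), key card_Z8 η e⟩
      · exact ⟨.inr (.inr (.inr (.inl ⟦η.cls⟧))), key card_D8 η e⟩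
      · exact ⟨.inr (.inr (.inr (.inr ⟦η.cls⟧))), key card_Q8 η e⟩

theorem card_pointedFusionClasses : Nat.card (PointedFusionClasses.{0, 1} 8) = 47 := by
  have h1 := card_orbitSpace_Z2Cubed
  have h2 := card_orbitSpace_Z4Z2
  have h3 := card_orbitSpace_of_eq exists_equiv_Z8
  have h4 := card_orbitSpace_D8
  have h5 := card_orbitSpace_of_eq exists_equiv_Q8
  -- A nonzero `Nat.card` certifies finiteness, which is needed to add the five numbers.
  have := Nat.finite_of_card_ne_zero (h1.trans_ne (by decide))
  have := Nat.finite_of_card_ne_zero (h2.trans_ne (by decide))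
  have := Nat.finite_of_card_ne_zero (h3.trans_ne (by decide))
  have := Nat.finite_of_card_ne_zero (h4.trans_ne (by decide))
  have := Nat.finite_of_card_ne_zero (h5.trans_ne (by decide))
  rw [← Nat.card_congr (Equiv.ofBijective _ classification_bijective), Nat.card_sum, Nat.card_sum,
    Nat.card_sum, Nat.card_sum, h1, h2, h3, h4, h5]

end Classification

end PointedFusion

theorem mainTheorem1 :
    -- equivalence classes of pointed fusion categories of global dimension 8
    Nat.card (PointedFusionClasses.{0, 1} 8) = 47 ∧
    -- each of them is some `Vect(H, η)` with `H` one of the five groups of order 8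
    (∀ (C : Type u) [Category.{v} C] [Preadditive C] [Linear ℂ C] [MonoidalCategory C],
      IsPointedFusion C → HasGlobalDim C 8 →
        ((∃ η : Cocycle3 Z2Cubed, TensorEquiv C (Vect η)) ∨
          (∃ η : Cocycle3 Z4Z2, TensorEquiv C (Vect η)) ∨
          (∃ η : Cocycle3 Z8, TensorEquiv C (Vect η)) ∨
          (∃ η : Cocycle3 D8, TensorEquiv C (Vect η)) ∨
          (∃ η : Cocycle3 Q8, TensorEquiv C (Vect η)))) ∧
    -- every such `Vect(H, η)` occurs
    (∀ (H : Type) [Group H] [Fintype H] (η : Cocycle3 H), Nat.card H = 8 →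
      IsPointedFusion (Vect η) ∧ HasGlobalDim (Vect η) 8) ∧
    -- the equivalences among them are those given by isomorphisms of groups
    (∀ (H H' : Type) [Group H] [Fintype H] [Group H'] [Fintype H'] (η : Cocycle3 H)
      (η' : Cocycle3 H'), Nat.card H = 8 → Nat.card H' = 8 →
      (TensorEquiv (Vect η) (Vect η') ↔
        ∃ φ : H ≃* H', cohPullback (Additive ℂˣ) 3 φ.toMonoidHom η'.cls = η.cls)) ∧
    -- every class in `H³(H, ℂ^*)` is the class of some `η`
    (∀ (H : Type) [Group H] (c : H3 H), ∃ η : Cocycle3 H, η.cls = c) ∧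
    -- `H³(H, ℂ^*) ≅ H⁴(H, ℤ)`, compatibly with automorphisms
    (∀ (H : Type) [Group H] [Finite H], ∃ e : H3 H ≃+ H4 H, ∀ (φ : H ≃* H) (c : H3 H),
      e (cohPullback (Additive ℂˣ) 3 φ.toMonoidHom c) = cohPullback ℤ 4 φ.toMonoidHom (e c)) ∧
    -- the numbers of orbits
    Nat.card (OrbitSpace Z2Cubed (Additive ℂˣ) 3) = 10 ∧
    Nat.card (OrbitSpace Z4Z2 (Additive ℂˣ) 3) = 9 ∧
    Nat.card (OrbitSpace Z8 (Additive ℂˣ) 3) = 8 ∧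
    Nat.card (OrbitSpace D8 (Additive ℂˣ) 3) = 12 ∧
    Nat.card (OrbitSpace Q8 (Additive ℂˣ) 3) = 8 ∧
    -- the orbits for `(ℤ/2)³`
    (∃ e : H3 Z2Cubed ≃+ kerSq1,
      (∀ (φ : Z2Cubed ≃* Z2Cubed) (c : H3 Z2Cubed),
        (e (cohPullback (Additive ℂˣ) 3 φ.toMonoidHom c) : Poly) = linSubst φ (e c)) ∧
      (∀ i, ∃ c : H3 Z2Cubed, (e c : Poly) = repsZ2Cubed i) ∧
      ∀ c : H3 Z2Cubed, ∃! i, ∃ d : H3 Z2Cubed, SameOrbit c d ∧ (e d : Poly) = repsZ2Cubed i) ∧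
    -- the orbits for `ℤ/4 × ℤ/2`
    (∃ e : H3 Z4Z2 ≃+ ZMod 4 × ZMod 2 × ZMod 2, ∀ c d : H3 Z4Z2,
      SameOrbit c d ↔ ∃ O ∈ orbitsZ4Z2, e c ∈ O ∧ e d ∈ O) ∧
    -- the orbits for `ℤ/8`
    (∃ _ : H3 Z8 ≃+ ZMod 8, ∀ c d : H3 Z8, SameOrbit c d ↔ c = d) ∧
    -- the orbits for `D₈`
    (∃ e : H3 D8 ≃+ ZMod 4 × ZMod 2 × ZMod 2, ∀ c d : H3 D8,
      SameOrbit c d ↔ ∃ O ∈ orbitsD8, e c ∈ O ∧ e d ∈ O) ∧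
    -- the orbits for `Q₈`
    (∃ _ : H3 Q8 ≃+ ZMod 8, ∀ c d : H3 Q8, SameOrbit c d ↔ c = d) := by
  refine ⟨card_pointedFusionClasses, fun C _ _ _ _ hC hd => hC.tensorEquiv_of_dim_eight hd,
    fun H _ _ η hH => ⟨Vect.isPointedFusion η, Vect.hasGlobalDim_eight η hH⟩,
    fun H H' _ _ _ _ η η' _ _ => tensorEquiv_vect_iff η η', fun H _ c => Cocycle3.exists_cls_eq c,
    fun H _ _ => exists_H3_equiv_H4 H, card_orbitSpace_Z2Cubed, card_orbitSpace_Z4Z2,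
    card_orbitSpace_of_eq exists_equiv_Z8, card_orbitSpace_D8,
    card_orbitSpace_of_eq exists_equiv_Q8, exists_equiv_kerSq1, exists_equiv_orbitsZ4Z2,
    exists_equiv_Z8, exists_equiv_orbitsD8, exists_equiv_Q8⟩
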